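/- Let $d\ge 2$. For a sequence of points $(v_i)_{i\in\mathbb Z}$ of $\mathbb{RP}^d$ let $P_i$ be the subspace spanned by the $d$ points $v_{i-(d-1)},v_{i-(d-1)+2},\dots,v_{i+(d-1)}$. The short-diagonal pentagram map sends $v_i$ to $T(v_i)=P_{i-\kappa}\cap\dots\cap P_{i+\kappa}$ if $d=2\kappa+1$, and to $T(v_i)=P_{i-\kappa+1}\cap\dots\cap P_{i+\kappa}$ if $d=2\kappa$. For a curve $\gamma:\mathbb R\to\mathbb{RP}^d$ let $T_\epsilon(\gamma)(x)$ be the image of $v_0$ under this map for the vertices $v_i=\gamma(x+i\epsilon)$, and put $$\tilde\gamma_\epsilon(x)=\begin{cases}T_\epsilon(\gamma)(x)& d \text{ odd},\\ T_\epsilon(\gamma)(x-\tfrac{\epsilon}{2})& d\text{ even.}\end{cases}$$ There is a nonzero constant $\tilde C_d$, depending only on $d$, such that the following holds. Let $\gamma$ be a nondegenerate smooth curve in $\mathbb{RP}^d$ with monodromy, that is, $\gamma(x+2\pi)=M\gamma(x)$ for all $x$ and some $M\in \mathrm{PGL}(d+1,\mathbb R)$, and let $\Gamma:\mathbb R\to\mathbb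 R^{d+1}$ be a smooth lift of $\gamma$ with $\det(\Gamma,\Gamma',\dots,\Gamma^{(d)})\equiv 1$. Then $L\Gamma=0$ for an operator $L=\partial^{d+1}+u_{d-1}\partial^{d-1}+\dots+u_0$ with smooth $2\pi$-periodic coefficients. This $L$ has a unique root $L^{1/(d+1)}$ of the form $\partial+\sum_{i<0}b_i\partial^i$ among the formal pseudodifferential operators with smooth $2\pi$-periodic coefficients, and the differential part of its square is $Q_2:=(L^{2/(d+1)})_+=\partial^2+\frac{2}{d+1}u_{d-1}$. For all sufficiently small $\epsilon\neq0$, the subspaces that are intersected are hyperplanes and meet in exactly one point for every $x$, so that $\tilde\gamma_\epsilon$ is well defined. It has a smooth lift $\tilde\Gamma_\epsilon$ with $\det(\tilde\Gamma_\epsilon,\tilde\Gamma_\epsilon',\dots,\tilde\Gamma_\epsilon^{(d)})\equiv1$ (unique for even $d$; unique up to sign, which is chosen suitably, for odd $d$), and $$\tilde\Gamma_\epsilon(x)=\Gamma(x)+\epsilon^2\,\tilde C_d\Big(\Gamma''(x)+\frac{2}{d+1}u_{d-1}(x)\Gamma(x)\Big)+O(\epsilon^4)\qquad(\epsilon\to0),$$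 where $O(\epsilon^4)$ holds uniformly on bounded sets of $x$, together with all derivatives in $x$. The curve $\tilde\Gamma_\epsilon$ is annihilated by an operator $L_\epsilon=\partial^{d+1}+u_{d-1,\epsilon}\partial^{d-1}+\dots+u_{0,\epsilon}$ with smooth $2\pi$-periodic coefficients, and, coefficientwise in the same sense, $$L_\epsilon=L+\epsilon^2\,\tilde C_d\,[Q_2,L]+O(\epsilon^4).$$ Thus, with $\epsilon^2$ as time, the limiting evolution of $L$ is, up to the constant rescaling of time by $\tilde C_d$, the $(2,d+1)$-KdV flow $dL/dt=[Q_2,L]$. Moreover, let $\Gamma(t,\cdot)$ be a family of curves in $\mathbb R^{d+1}$, smooth in $(t,x)$ for $t$ in an open interval, with $\det(\Gamma,\Gamma',\dots,\Gamma^{(d)})\ne0$ everywhere and $L(t)\Gamma(t,\cdot)=0$ for operators $L(t)$ of the above form with smooth $2\pi$-periodic coefficients. If $d\Gamma/dt=Q_2\Gamma$ with $Q_2=(L(t)^{2/(d+1)})_+$, then $dL/dt=[Q_2,L]$. -/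

import Mathlib

open scoped ContDiff

noncomputable section

namespace PentagramLimit

/-- Points of real projective space `ℝP^d`: lines through the origin of `ℝ^(d+1)`. -/
abbrev RP (d : ℕ) : Type := Projectivization ℝ (Fin (d + 1) → ℝ)

/-! ### The short-diagonal pentagram map -/

/-- The short-diagonal subspace `P_i`, as a linear subspace of `ℝ^(d+1)`: the span of the `d`
vertices `v_(i-(d-1)), v_(i-(d-1)+2), …, v_(i+(d-1))`. For `d = 2κ+1` these are
`v_(i-2κ), v_(i-2κ+2), …, v_(i+2κ)`; for `d = 2κ` they are
`v_(i-2κ+1), …, v_(i-1), v_(i+1), …, v_(i+2κ-1)`. -/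
def shortDiagonalPlane {d : ℕ} (v : ℤ → RP d) (i : ℤ) : Submodule ℝ (Fin (d + 1) → ℝ) :=
  ⨆ k : Fin d, (v (i - ((d : ℤ) - 1) + 2 * (k : ℤ))).submodule

/-- `p = T(v_i)` for the short-diagonal pentagram map `T`: the `d` consecutive subspaces `P_j`
around `v_i` are hyperplanes and the point `p` is their intersection. The indices run over
`j = i-κ, …, i+κ` if `d = 2κ+1`, and over `j = i-κ+1, …, i+κ` if `d = 2κ`; that is, over
`j = i - ⌊(d-1)/2⌋ + k` with `0 ≤ k < d`. -/
def IsShortDiagonalImage {d : ℕ} (v : ℤ → RP d) (i : ℤ) (p : RP d) : Prop :=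
  (∀ k : Fin d,
    Module.finrank ℝ (shortDiagonalPlane v (i - ((d : ℤ) - 1) / 2 + (k : ℤ))) = d) ∧
  p.submodule = ⨅ k : Fin d, shortDiagonalPlane v (i - ((d : ℤ) - 1) / 2 + (k : ℤ))

/-- The vertices `v_i = γ(x + iε)`. -/
def discretize {d : ℕ} (γ : ℝ → RP d) (ε x : ℝ) (i : ℤ) : RP d := γ (x + i * ε)

/-- The curve `δ` is the result of applying the short-diagonal pentagram map directly to the
discretized curve `γ`: `δ(x) = T_ε(γ)(x)` if `d` is odd and `δ(x) = T_ε(γ)(x - ε/2)` if `d` is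
even, where `T_ε(γ)(y)` is the image of `v_0 = γ(y)` computed with `v_i = γ(y + iε)`. -/
def IsPentagramCurve {d : ℕ} (γ : ℝ → RP d) (ε : ℝ) (δ : ℝ → RP d) : Prop :=
  ∀ x : ℝ, IsShortDiagonalImage
    (discretize γ ε (if Odd d then x else x - ε / 2)) 0 (δ x)

/-! ### Curves, lifts and differential operators -/

/-- `γ(x + 2π) = M · γ(x)` for all `x`; the monodromy in `PGL(d+1, ℝ)` is represented by an
invertible linear map. -/
def HasMonodromy {d : ℕ} (γ : ℝ → RP d)
    (M : (Fin (d + 1) → ℝ) ≃ₗ[ℝ] (Fin (d + 1) → ℝ)) : Prop :=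
  ∀ x : ℝ, γ (x + 2 * Real.pi) = Projectivization.map M.toLinearMap M.injective (γ x)

/-- `det (Γ, Γ', …, Γ^(d)) (x)`. -/
def wronskian {d : ℕ} (Γ : ℝ → Fin (d + 1) → ℝ) (x : ℝ) : ℝ :=
  Matrix.det (Matrix.of fun i : Fin (d + 1) => iteratedDeriv (i : ℕ) Γ x)

/-- `Γ` is a smooth lift of `γ` to `ℝ^(d+1)` with `det (Γ, Γ', …, Γ^(d)) ≡ 1`. -/
structure IsNormalizedLift {d : ℕ} (γ : ℝ → RP d) (Γ : ℝ → Fin (d + 1) → ℝ) : Prop where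
  smooth : ContDiff ℝ ∞ Γ
  lift : ∀ x, ∃ h : Γ x ≠ 0, Projectivization.mk ℝ (Γ x) h = γ x
  normalized : ∀ x, wronskian Γ x = 1

/-- `L = ∂^(d+1) + u_(d-1) ∂^(d-1) + … + u_0`, with smooth `2π`-periodic `u_0, …, u_(d-1)`,
is the differential operator of the curve `Γ`, i.e. `L Γ = 0`. -/
structure IsCurveOperator {d : ℕ} (Γ : ℝ → Fin (d + 1) → ℝ) (u : ℕ → ℝ → ℝ) : Prop where
  smooth : ∀ i < d, ContDiff ℝ ∞ (u i)
  periodic : ∀ i < d, Function.Periodic (u i) (2 * Real.pi)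
  equation : ∀ x, iteratedDeriv (d + 1) Γ x
    + ∑ i ∈ Finset.range d, u i x • iteratedDeriv i Γ x = 0

/-! ### Formal pseudodifferential operators and the KdV hierarchy

A formal series `∑ A_k ∂^k` is represented by its coefficient family `A : ℤ → ℝ → ℝ`. -/

/-- Membership in the algebra of formal pseudodifferential operators: the order is bounded above
and the coefficients are smooth and `2π`-periodic. -/
structure IsPseudoDiff (A : ℤ → ℝ → ℝ) : Prop where
  order : ∃ N : ℤ, ∀ k, N < k → A k = 0
  smooth : ∀ k, ContDiff ℝ ∞ (A k)
  periodic : ∀ k, Function.Periodic (A k) (2 * Real.pi)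

/-- The product determined by `∂^i ∘ b = ∑_{n ≥ 0} (i choose n) b^(n) ∂^(i-n)`. The coefficient
of `∂^k` in `A ∘ B` is the sum over `(i, n)` below, which has finitely many nonzero terms as
soon as the orders of `A` and `B` are bounded above. -/
def psiMul (A B : ℤ → ℝ → ℝ) : ℤ → ℝ → ℝ := fun k x =>
  ∑ᶠ p : ℤ × ℕ,
    ((Ring.choose p.1 p.2 : ℤ) : ℝ) * A p.1 x * iteratedDeriv p.2 (B (k - p.1 + (p.2 : ℤ))) x

/-- Powers of a pseudodifferential operator. -/
def psiPow (A : ℤ → ℝ → ℝ) : ℕ → ℤ → ℝ → ℝ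
  | 0 => fun k _ => if k = 0 then 1 else 0
  | n + 1 => psiMul (psiPow A n) A

/-- The commutator `[A, B] = A ∘ B - B ∘ A`. -/
def psiComm (A B : ℤ → ℝ → ℝ) : ℤ → ℝ → ℝ := psiMul A B - psiMul B A

/-- The purely differential part `A_+`. -/
def diffPart (A : ℤ → ℝ → ℝ) : ℤ → ℝ → ℝ := fun k => if 0 ≤ k then A k else 0

/-- The operator `∂^(d+1) + u_(d-1) ∂^(d-1) + … + u_0`. -/
def diffOp (d : ℕ) (u : ℕ → ℝ → ℝ) : ℤ → ℝ → ℝ := fun k =>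
  if k = (d : ℤ) + 1 then 1 else if 0 ≤ k ∧ k < (d : ℤ) then u k.toNat else 0

/-- `R = ∂ + ∑_{i < 0} b_i ∂^i` and `R^n = L`. -/
structure IsRoot (n : ℕ) (L R : ℤ → ℝ → ℝ) : Prop where
  pseudoDiff : IsPseudoDiff R
  leading : R 1 = 1
  zeroth : R 0 = 0
  higher : ∀ k : ℤ, 1 < k → R k = 0
  pow_eq : psiPow R n = L

/-- `Q_m = (L^(m/(d+1)))_+` for `L = ∂^(d+1) + u_(d-1) ∂^(d-1) + … + u_0`, where
`L^(1/(d+1))` is the (unique) root of `L`. -/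
def kdvQ (m d : ℕ) (u : ℕ → ℝ → ℝ) : ℤ → ℝ → ℝ :=
  diffPart (psiPow (Classical.epsilon fun R => IsRoot (d + 1) (diffOp d u) R) m)

/-- The `(m, d+1)`-KdV equation `dL/dt = [Q_m, L]`, coefficient by coefficient, on a set `I` of
times. -/
def SolvesKdV (m d : ℕ) (I : Set ℝ) (u : ℝ → ℕ → ℝ → ℝ) : Prop :=
  ∀ t ∈ I, ∀ (k : ℤ) (x : ℝ), HasDerivAt (fun s => diffOp d (u s) k x)
    (psiComm (kdvQ m d (u t)) (diffOp d (u t)) k x) t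

/-- The action of a differential operator on a vector-valued curve. -/
def applyOp {d : ℕ} (A : ℤ → ℝ → ℝ) (Γ : ℝ → Fin (d + 1) → ℝ) (x : ℝ) : Fin (d + 1) → ℝ :=
  ∑ᶠ k : ℕ, A (k : ℤ) x • iteratedDeriv k Γ x

/-! ### Expansions in `ε` -/

/-- `F_ε(x) = O(ε^n)` as `ε → 0`, uniformly for `x` in bounded sets, for `F_ε` and for each of
its derivatives in `x`. -/
def IsBigOSmooth {E : Type*} [NormedAddCommGroup E] [NormedSpace ℝ E]
    (n : ℕ) (F : ℝ → ℝ → E) : Prop :=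
  ∀ (j : ℕ) (r : ℝ), ∃ c δ : ℝ, 0 < δ ∧
    ∀ ε : ℝ, 0 < |ε| → |ε| < δ → ∀ x : ℝ, |x| ≤ r →
      ‖iteratedDeriv j (F ε) x‖ ≤ c * |ε| ^ n

end PentagramLimit

end

/-! Fix x and use the rescaled frame Γ(x), εΓ'(x), …, ε^d Γ^(d)(x). The vertex γ(x+sε) has
coordinates s^i g_i(sε, x) there, with g_i smooth and g_i(0, x) = 1/i! (`exists_isFrameExpansion`).
At ε = 0 the vertices therefore become points of the moment curve, and the construction stays
nondegenerate.

In this limit the construction is solved by polynomials. The vertices of the k-th hyperplane have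
parameters c_k + 2c_l, where the c_l have unit steps and are centred at 0; for even d the shift by
ε/2 achieves the centring. With φ = ∏ (X - 2c_l), the k-th hyperplane has covector entries
φ^(i)(-c_k). The intersection point q, with q_0 = 1, satisfies ∑ q_i φ^(i) = ∏ (X + c_k). Two
coefficient comparisons give q_1 = 0 and q_2 = 3∑c_k² / (2d(d-1)), the constant of the theorem
(`moment_point`).

For small ε the relevant determinants stay nonzero, uniformly in x: the normalized lift has linear
monodromy, so all coordinates are 2π-periodic and compactness applies (`exists_linear_monodromy`,
`exists_isGeneric`). Cramer's rule makes the image point smooth in (ε, x) across ε = 0. Because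
Γ^(d+1) has no Γ^(d) component, the first t-derivatives of the g_i vanish at t = 0, and so does the
first ε-derivative of q. Reflecting the nodes shows that the image curve is even in ε. Together
these give Γ + ε² C Γ'' + O(ε⁴).

Normalizing the determinant adds ε² m Γ at this order. The linearized condition is C·tr(∂²) + (d+1)m
= 0, and the trace in the frame is -2u_(d-1). Hence m = C·2u_(d-1)/(d+1), which matches the zeroth
order term of Q_2 (`exists_normalization`, `kdvQ_two`).

For the operators, varying LΓ = 0 along δΓ = Q_2Γ gives (δL)Γ = -L Q_2 Γ = [Q_2, L]Γ. Both δL and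
[Q_2, L] have order at most d, and the d+1 components of Γ have nonzero Wronskian, so the two
operators coincide (`psiComm_eq_of_variation`). This one argument serves both the ε-expansion of L_ε
and the time evolution. -/

noncomputable section

namespace PentagramLimit

open Set Filter Topology

/-! ### Calculus of functions jointly smooth in a parameter and in x -/

section Families

variable {E F' : Type*} [NormedAddCommGroup E] [NormedSpace ℝ E]
  [NormedAddCommGroup F'] [NormedSpace ℝ F']

/-- A family `F ε` of functions of a real variable, jointly smooth for `ε ∈ I`. -/
def SmoothFamily (I : Set ℝ) (F : ℝ → ℝ → E) : Prop :=
  ContDiffOn ℝ ∞ (fun p : ℝ × ℝ => F p.1 p.2) (I ×ˢ univ)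

variable {I J : Set ℝ} {F G : ℝ → ℝ → E}

theorem SmoothFamily.mono (hF : SmoothFamily I F) (h : J ⊆ I) : SmoothFamily J F :=
  ContDiffOn.mono hF (prod_mono h le_rfl)

theorem SmoothFamily.congr (hF : SmoothFamily I F) (h : ∀ ε ∈ I, ∀ x, G ε x = F ε x) :
    SmoothFamily I G :=
  ContDiffOn.congr hF fun p hp => h p.1 hp.1 p.2

theorem SmoothFamily.const {f : ℝ → E} (hf : ContDiff ℝ ∞ f) : SmoothFamily I fun _ x => f x :=
  (hf.comp contDiff_snd).contDiffOn

theorem SmoothFamily.contDiffAt (hF : SmoothFamily I F) (hI : IsOpen I) {ε : ℝ} (hε : ε ∈ I)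
    (x : ℝ) : ContDiffAt ℝ ∞ (fun p : ℝ × ℝ => F p.1 p.2) (ε, x) :=
  ContDiffOn.contDiffAt hF ((hI.prod isOpen_univ).mem_nhds ⟨hε, mem_univ _⟩)

theorem SmoothFamily.contDiff (hF : SmoothFamily I F) {ε : ℝ} (hε : ε ∈ I) :
    ContDiff ℝ ∞ (F ε) := by
  rw [← contDiffOn_univ]
  exact ContDiffOn.comp (f := fun x : ℝ => (ε, x)) hF (by fun_prop) fun x _ => ⟨hε, mem_univ _⟩

theorem SmoothFamily.contDiffAt_fst (hF : SmoothFamily I F) (hI : IsOpen I) {ε : ℝ} (hε : ε ∈ I)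
    (x : ℝ) : ContDiffAt ℝ ∞ (fun s => F s x) ε :=
  ContDiffAt.comp (f := fun s : ℝ => (s, x)) ε (hF.contDiffAt hI hε x) (by fun_prop)

theorem SmoothFamily.continuousAt_fst (hF : SmoothFamily I F) (hI : IsOpen I) {ε : ℝ}
    (hε : ε ∈ I) (x : ℝ) : ContinuousAt (fun s => F s x) ε :=
  (hF.contDiffAt_fst hI hε x).continuousAt

theorem SmoothFamily.differentiableAt_fst (hF : SmoothFamily I F) (hI : IsOpen I) {ε : ℝ}
    (hε : ε ∈ I) (x : ℝ) : DifferentiableAt ℝ (fun s => F s x) ε :=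
  (hF.contDiffAt_fst hI hε x).differentiableAt (by simp)

theorem SmoothFamily.add (hF : SmoothFamily I F) (hG : SmoothFamily I G) :
    SmoothFamily I fun ε x => F ε x + G ε x :=
  ContDiffOn.add hF hG

theorem SmoothFamily.neg (hF : SmoothFamily I F) : SmoothFamily I fun ε x => -F ε x :=
  ContDiffOn.neg hF

theorem SmoothFamily.smul {a : ℝ → ℝ → ℝ} (ha : SmoothFamily I a) (hF : SmoothFamily I F) :
    SmoothFamily I fun ε x => a ε x • F ε x :=
  ContDiffOn.smul ha hF

theorem SmoothFamily.mul {a b : ℝ → ℝ → ℝ} (ha : SmoothFamily I a) (hb : SmoothFamily I b) :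
    SmoothFamily I fun ε x => a ε x * b ε x :=
  ContDiffOn.mul ha hb

theorem SmoothFamily.sum {ι : Type*} {s : Finset ι} {A : ι → ℝ → ℝ → E}
    (h : ∀ i ∈ s, SmoothFamily I (A i)) : SmoothFamily I fun ε x => ∑ i ∈ s, A i ε x :=
  ContDiffOn.sum h

theorem SmoothFamily.prod {ι : Type*} {s : Finset ι} {A : ι → ℝ → ℝ → ℝ}
    (h : ∀ i ∈ s, SmoothFamily I (A i)) : SmoothFamily I fun ε x => ∏ i ∈ s, A i ε x :=
  contDiffOn_prod h

theorem SmoothFamily.inv {a : ℝ → ℝ → ℝ} (ha : SmoothFamily I a)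
    (h : ∀ ε ∈ I, ∀ x, a ε x ≠ 0) : SmoothFamily I fun ε x => (a ε x)⁻¹ :=
  ContDiffOn.inv ha fun p hp => h p.1 hp.1 p.2

theorem SmoothFamily.rpow {a : ℝ → ℝ → ℝ} (ha : SmoothFamily I a) (c : ℝ)
    (h : ∀ ε ∈ I, ∀ x, a ε x ≠ 0) : SmoothFamily I fun ε x => a ε x ^ c :=
  ContDiffOn.rpow_const_of_ne ha fun p hp => h p.1 hp.1 p.2

theorem SmoothFamily.apply {ι : Type*} [Fintype ι] {A : ℝ → ℝ → ι → E}
    (h : SmoothFamily I A) (i : ι) : SmoothFamily I fun ε x => A ε x i :=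
  contDiffOn_pi.1 h i

theorem SmoothFamily.fst : SmoothFamily I fun ε _ => ε := contDiffOn_fst

theorem SmoothFamily.pow (n : ℕ) : SmoothFamily I fun ε _ => ε ^ n :=
  ContDiffOn.pow SmoothFamily.fst n

theorem SmoothFamily.det {n : Type*} [Fintype n] [DecidableEq n] {A : ℝ → ℝ → Matrix n n ℝ}
    (h : ∀ i j, SmoothFamily I fun ε x => A ε x i j) : SmoothFamily I fun ε x => (A ε x).det := by
  simp only [Matrix.det_apply']
  exact .sum fun σ _ => (SmoothFamily.const contDiff_const).mul (.prod fun i _ => h _ _)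

/-- Cramer's rule: the inverse is the adjugate over the determinant, and both are polynomial in the
entries. The hyperplanes and the image point become smooth in (ε, x) through this. -/
theorem SmoothFamily.inv_mulVec {n : Type*} [Fintype n] [DecidableEq n]
    {A : ℝ → ℝ → Matrix n n ℝ} {b : ℝ → ℝ → n → ℝ}
    (hA : ∀ i j, SmoothFamily I fun ε x => A ε x i j)
    (hb : ∀ i, SmoothFamily I fun ε x => b ε x i)
    (h : ∀ ε ∈ I, ∀ x, (A ε x).det ≠ 0) (i : n) :
    SmoothFamily I fun ε x => ((A ε x)⁻¹.mulVec (b ε x)) i := by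
  simp only [Matrix.mulVec, dotProduct, Matrix.inv_def, Ring.inverse_eq_inv', Matrix.smul_apply,
    smul_eq_mul, Matrix.adjugate_apply]
  refine .sum fun j _ => (((SmoothFamily.det hA).inv h).mul (.det fun k l => ?_)).mul (hb j)
  by_cases hk : k = j
  · subst hk
    simp only [Matrix.updateRow_self]
    exact .const contDiff_const
  · simpa only [Matrix.updateRow_ne hk] using hA k l

theorem SmoothFamily.hasDerivAt_snd (hF : SmoothFamily I F) (hI : IsOpen I) {ε : ℝ}
    (hε : ε ∈ I) (x : ℝ) :
    HasDerivAt (F ε) (fderiv ℝ (fun p : ℝ × ℝ => F p.1 p.2) (ε, x) (0, 1)) x :=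
  HasFDerivAt.comp_hasDerivAt (f := fun y : ℝ => (ε, y)) x
    ((hF.contDiffAt hI hε x).differentiableAt (by simp)).hasFDerivAt
    ((hasDerivAt_const x ε).prodMk (hasDerivAt_id x))

theorem SmoothFamily.hasDerivAt_fst (hF : SmoothFamily I F) (hI : IsOpen I) {ε : ℝ}
    (hε : ε ∈ I) (x : ℝ) :
    HasDerivAt (fun s => F s x) (fderiv ℝ (fun p : ℝ × ℝ => F p.1 p.2) (ε, x) (1, 0)) ε :=
  HasFDerivAt.comp_hasDerivAt (f := fun y : ℝ => (y, x)) ε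
    ((hF.contDiffAt hI hε x).differentiableAt (by simp)).hasFDerivAt
    ((hasDerivAt_id ε).prodMk (hasDerivAt_const ε x))

theorem SmoothFamily.fderiv_apply (hF : SmoothFamily I F) (hI : IsOpen I) (v : ℝ × ℝ) :
    SmoothFamily I fun ε x => fderiv ℝ (fun p : ℝ × ℝ => F p.1 p.2) (ε, x) v :=
  ContDiffOn.clm_apply (ContDiffOn.fderiv_of_isOpen (m := ∞) hF (hI.prod isOpen_univ) (by simp))
    contDiffOn_const

theorem SmoothFamily.deriv_snd (hF : SmoothFamily I F) (hI : IsOpen I) :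
    SmoothFamily I fun ε x => deriv (F ε) x :=
  (hF.fderiv_apply hI (0, 1)).congr fun _ hε x => (hF.hasDerivAt_snd hI hε x).deriv

theorem SmoothFamily.iteratedDeriv_snd (hF : SmoothFamily I F) (hI : IsOpen I) (j : ℕ) :
    SmoothFamily I fun ε x => iteratedDeriv j (F ε) x := by
  induction j with
  | zero => simpa using hF
  | succ j ih => simpa only [iteratedDeriv_succ] using ih.deriv_snd hI

/-- Mixed partial derivatives commute. -/
theorem SmoothFamily.deriv_deriv_comm (hF : SmoothFamily I F) (hI : IsOpen I) {ε : ℝ}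
    (hε : ε ∈ I) (x : ℝ) :
    deriv (fun s => deriv (F s) x) ε = deriv (fun y => deriv (fun s => F s y) ε) x := by
  have h1 : (fun s => deriv (F s) x) =ᶠ[𝓝 ε]
      fun s => fderiv ℝ (fun p : ℝ × ℝ => F p.1 p.2) (s, x) (0, 1) := by
    filter_upwards [hI.mem_nhds hε] with s hs using (hF.hasDerivAt_snd hI hs x).deriv
  have h2 : (fun y => deriv (fun s => F s y) ε) =
      fun y => fderiv ℝ (fun p : ℝ × ℝ => F p.1 p.2) (ε, y) (1, 0) :=
    funext fun y => (hF.hasDerivAt_fst hI hε y).deriv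
  have hd : DifferentiableAt ℝ (fderiv ℝ (fun p : ℝ × ℝ => F p.1 p.2)) (ε, x) :=
    ((hF.contDiffAt hI hε x).fderiv_right (m := ∞) (by simp)).differentiableAt (by simp)
  rw [h1.deriv_eq, h2, ((hF.fderiv_apply hI (0, 1)).hasDerivAt_fst hI hε x).deriv,
    ((hF.fderiv_apply hI (1, 0)).hasDerivAt_snd hI hε x).deriv]
  rw [fderiv_clm_apply hd (by fun_prop), fderiv_clm_apply hd (by fun_prop)]
  simpa using ((hF.contDiffAt hI hε x).isSymmSndFDerivAt
    (by simpa using WithTop.coe_le_coe.2 (le_top : (2 : ℕ∞) ≤ ⊤))).eq (1, 0) (0, 1)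

theorem SmoothFamily.hasDerivAt_iteratedDeriv (hF : SmoothFamily I F) (hI : IsOpen I) (j : ℕ)
    {ε : ℝ} (hε : ε ∈ I) (x : ℝ) :
    HasDerivAt (fun s => iteratedDeriv j (F s) x)
      (iteratedDeriv j (fun y => deriv (fun s => F s y) ε) x) ε := by
  have key : ∀ x, deriv (fun s => iteratedDeriv j (F s) x) ε =
      iteratedDeriv j (fun y => deriv (fun s => F s y) ε) x := by
    induction j with
    | zero => simp
    | succ j ih =>
      intro x
      simp only [iteratedDeriv_succ]
      rw [(hF.iteratedDeriv_snd hI j).deriv_deriv_comm hI hε x, funext ih]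
  rw [← key]
  exact ((hF.iteratedDeriv_snd hI j).differentiableAt_fst hI hε x).hasDerivAt

theorem SmoothFamily.of_contDiff (hF : ContDiff ℝ ∞ fun p : ℝ × ℝ => F p.1 p.2) :
    SmoothFamily I F := hF.contDiffOn

end Families

/-! ### Smoothness of integrals depending on parameters -/

section ParametricIntegral

open MeasureTheory

/-- Dominated convergence; the constant bound comes from compactness of a closed ball times [0, 1].
-/
theorem continuousOn_parametric_integral {E : Type*} [NormedAddCommGroup E] [NormedSpace ℝ E]
    {U : Set (ℝ × ℝ)} (hU : IsOpen U) {f : (ℝ × ℝ) × ℝ → E}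
    (hf : ContinuousOn f (U ×ˢ Icc 0 1)) :
    ContinuousOn (fun p => ∫ θ in (0 : ℝ)..1, f (p, θ)) U := by
  intro p hp
  obtain ⟨δ, hδ, hsub⟩ := Metric.nhds_basis_closedBall.mem_iff.1 (hU.mem_nhds hp)
  obtain ⟨c, hc⟩ := ((isCompact_closedBall p δ).prod isCompact_Icc).exists_bound_of_continuousOn
    (hf.mono (prod_mono hsub le_rfl))
  have hsec : ∀ y ∈ U, ContinuousOn (fun θ => f (y, θ)) (Icc 0 1) := fun y hy =>
    hf.comp (by fun_prop) fun θ hθ => ⟨hy, hθ⟩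
  refine (intervalIntegral.continuousAt_of_dominated_interval (bound := fun _ => c) ?_ ?_
    (by simp) ?_).continuousWithinAt
  · filter_upwards [hU.mem_nhds hp] with y hy
    rw [uIoc_of_le zero_le_one]
    exact ((hsec y hy).mono Ioc_subset_Icc_self).aestronglyMeasurable measurableSet_Ioc
  · filter_upwards [Metric.closedBall_mem_nhds p hδ] with y hy
    refine .of_forall fun θ hθ => hc (y, θ) ⟨hy, ?_⟩
    rw [uIoc_of_le zero_le_one] at hθ
    exact Ioc_subset_Icc_self hθ
  · refine .of_forall fun θ hθ => ?_
    rw [uIoc_of_le zero_le_one] at hθ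
    exact (hf.comp (f := fun y => (y, θ)) (by fun_prop)
      fun y hy => ⟨hy, Ioc_subset_Icc_self hθ⟩).continuousAt (hU.mem_nhds hp)

theorem hasFDerivAt_parametric_integral {E : Type*} [NormedAddCommGroup E] [NormedSpace ℝ E]
    {U : Set (ℝ × ℝ)} (hU : IsOpen U) {f : (ℝ × ℝ) × ℝ → E}
    (hf : ∀ p ∈ U, ∀ θ ∈ Icc (0 : ℝ) 1, ContDiffAt ℝ 1 f (p, θ)) {p : ℝ × ℝ} (hp : p ∈ U) :
    HasFDerivAt (fun p => ∫ θ in (0 : ℝ)..1, f (p, θ))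
      (∫ θ in (0 : ℝ)..1,
        (fderiv ℝ f (p, θ)).comp (ContinuousLinearMap.inl ℝ (ℝ × ℝ) ℝ)) p := by
  have hf' : ContinuousOn (fun q => (fderiv ℝ f q).comp (ContinuousLinearMap.inl ℝ (ℝ × ℝ) ℝ))
      (U ×ˢ Icc 0 1) := fun q hq => by
    have : ContinuousAt (fderiv ℝ f) q :=
      ((hf q.1 hq.1 q.2 hq.2).fderiv_right (m := 0) (by simp)).continuousAt
    exact (this.clm_comp continuousAt_const).continuousWithinAt
  obtain ⟨δ, hδ, hsub⟩ := Metric.nhds_basis_closedBall.mem_iff.1 (hU.mem_nhds hp)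
  obtain ⟨c, hc⟩ := ((isCompact_closedBall p δ).prod isCompact_Icc).exists_bound_of_continuousOn
    (hf'.mono (prod_mono hsub le_rfl))
  have hsec : ∀ y ∈ U, ContinuousOn (fun θ => f (y, θ)) (Icc 0 1) := fun y hy θ hθ =>
    (ContinuousAt.comp (f := fun θ => (y, θ)) (hf y hy θ hθ).continuousAt
      (by fun_prop)).continuousWithinAt
  refine intervalIntegral.hasFDerivAt_integral_of_dominated_of_fderiv_le
    (F' := fun p θ => (fderiv ℝ f (p, θ)).comp (ContinuousLinearMap.inl ℝ (ℝ × ℝ) ℝ))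
    (bound := fun _ => c) (Metric.closedBall_mem_nhds p hδ) ?_ ?_ ?_ ?_ (by simp) ?_
  · filter_upwards [hU.mem_nhds hp] with y hy
    rw [uIoc_of_le zero_le_one]
    exact ((hsec y hy).mono Ioc_subset_Icc_self).aestronglyMeasurable measurableSet_Ioc
  · exact ContinuousOn.intervalIntegrable (by rw [uIcc_of_le zero_le_one]; exact hsec p hp)
  · rw [uIoc_of_le zero_le_one]
    exact ((hf'.comp (f := fun θ => (p, θ)) (by fun_prop) fun θ hθ => ⟨hp, hθ⟩).mono
      Ioc_subset_Icc_self).aestronglyMeasurable measurableSet_Ioc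
  · refine .of_forall fun θ hθ y hy => hc (y, θ) ⟨hy, ?_⟩
    rw [uIoc_of_le zero_le_one] at hθ
    exact Ioc_subset_Icc_self hθ
  · refine .of_forall fun θ hθ y hy => ?_
    rw [uIoc_of_le zero_le_one] at hθ
    have h1 := ((hf y (hsub hy) θ (Ioc_subset_Icc_self hθ)).differentiableAt
      (by simp)).hasFDerivAt
    exact h1.comp (f := fun y : ℝ × ℝ => (y, θ)) y (hasFDerivAt_prodMk_left y θ)

/-- The target space is quantified inside the induction because the derivative of the integral is
again a parametric integral, with values in a space of linear maps. -/
theorem contDiffOn_parametric_integral_nat {U : Set (ℝ × ℝ)} (hU : IsOpen U) (n : ℕ) :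
    ∀ {E : Type} [NormedAddCommGroup E] [NormedSpace ℝ E] {f : (ℝ × ℝ) × ℝ → E},
      (∀ p ∈ U, ∀ θ ∈ Icc (0 : ℝ) 1, ContDiffAt ℝ ∞ f (p, θ)) →
      ContDiffOn ℝ n (fun p => ∫ θ in (0 : ℝ)..1, f (p, θ)) U := by
  induction n with
  | zero =>
    intro E _ _ f hf
    rw [Nat.cast_zero, contDiffOn_zero]
    exact continuousOn_parametric_integral hU fun q hq =>
      (hf q.1 hq.1 q.2 hq.2).continuousAt.continuousWithinAt
  | succ n ih =>
    intro E _ _ f hf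
    have hder : ∀ p ∈ U, HasFDerivAt _ _ p := fun p hp => hasFDerivAt_parametric_integral hU
      (fun p hp θ hθ => (hf p hp θ hθ).of_le (by exact_mod_cast le_top)) hp
    rw [Nat.cast_succ, contDiffOn_succ_iff_fderiv_of_isOpen hU]
    refine ⟨fun p hp => (hder p hp).differentiableAt.differentiableWithinAt, by simp, ?_⟩
    refine (ih (f := fun q => (fderiv ℝ f q).comp (ContinuousLinearMap.inl ℝ (ℝ × ℝ) ℝ))
      fun p hp θ hθ => ?_).congr fun p hp => (hder p hp).fderiv
    exact ((hf p hp θ hθ).fderiv_right (m := ∞) (by simp)).clm_comp contDiffAt_const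

theorem contDiffOn_parametric_integral {E : Type} [NormedAddCommGroup E] [NormedSpace ℝ E]
    {U : Set (ℝ × ℝ)} (hU : IsOpen U) {f : (ℝ × ℝ) × ℝ → E}
    (hf : ∀ p ∈ U, ∀ θ ∈ Icc (0 : ℝ) 1, ContDiffAt ℝ ∞ f (p, θ)) :
    ContDiffOn ℝ ∞ (fun p => ∫ θ in (0 : ℝ)..1, f (p, θ)) U :=
  contDiffOn_infty.2 fun n => contDiffOn_parametric_integral_nat hU n hf

end ParametricIntegral

/-! ### Hadamard's lemma, even families and remainder estimates -/

section Hadamard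

variable {E : Type} [NormedAddCommGroup E] [NormedSpace ℝ E]
  {I : Set ℝ} {F : ℝ → ℝ → E}

/-- Hadamard's lemma with a parameter. -/
theorem SmoothFamily.exists_eq_add_smul [CompleteSpace E] (hF : SmoothFamily I F) (hI : IsOpen I)
    (hstar : StarConvex ℝ 0 I) :
    ∃ G : ℝ → ℝ → E, SmoothFamily I G ∧ ∀ ε ∈ I, ∀ x, F ε x = F 0 x + ε • G ε x := by
  have hmem : ∀ ε ∈ I, ∀ θ ∈ Icc (0 : ℝ) 1, θ * ε ∈ I := fun ε hε θ hθ => by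
    simpa using hstar.smul_mem hε hθ.1 hθ.2
  have hD := hF.fderiv_apply hI (1, 0)
  refine ⟨fun ε x => ∫ θ in (0 : ℝ)..1, fderiv ℝ (fun p : ℝ × ℝ => F p.1 p.2) (θ * ε, x) (1, 0),
    ?_, fun ε hε x => ?_⟩
  · refine contDiffOn_parametric_integral (f := fun q => fderiv ℝ (fun p : ℝ × ℝ => F p.1 p.2)
      (q.2 * q.1.1, q.1.2) (1, 0)) (hI.prod isOpen_univ) fun p hp θ hθ => ?_
    exact ContDiffAt.comp (f := fun q : (ℝ × ℝ) × ℝ => (q.2 * q.1.1, q.1.2)) (p, θ)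
      (hD.contDiffAt hI (hmem p.1 hp.1 θ hθ) p.2) (by fun_prop)
  · have hderiv : ∀ θ ∈ uIcc (0 : ℝ) 1, HasDerivAt (fun θ => F (θ * ε) x)
        (ε • fderiv ℝ (fun p : ℝ × ℝ => F p.1 p.2) (θ * ε, x) (1, 0)) θ := fun θ hθ => by
      rw [uIcc_of_le zero_le_one] at hθ
      exact (hF.hasDerivAt_fst hI (hmem ε hε θ hθ) x).scomp θ
        (by simpa using (hasDerivAt_id θ).mul_const ε)
    have hcont : ContinuousOn
        (fun θ => ε • fderiv ℝ (fun p : ℝ × ℝ => F p.1 p.2) (θ * ε, x) (1, 0)) (uIcc 0 1) := by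
      rw [uIcc_of_le zero_le_one]
      intro θ hθ
      refine (ContinuousAt.const_smul ?_ ε).continuousWithinAt
      exact ContinuousAt.comp (f := fun θ : ℝ => θ * ε)
        (hD.continuousAt_fst hI (hmem ε hε θ hθ) x) (by fun_prop)
    have := intervalIntegral.integral_eq_sub_of_hasDerivAt hderiv hcont.intervalIntegrable
    rw [intervalIntegral.integral_smul] at this
    simp only [one_mul, zero_mul] at this
    rw [this]
    abel

/-- Continuity in ε. It recovers the value at ε = 0 of identities that can only be divided by a
power of ε when ε ≠ 0. -/
theorem SmoothFamily.eq_at_zero {G : ℝ → ℝ → E} (hF : SmoothFamily I F)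
    (hG : SmoothFamily I G) (hI : IsOpen I) (h0 : (0 : ℝ) ∈ I) {x : ℝ}
    (h : ∀ ε ∈ I, ε ≠ 0 → F ε x = G ε x) : F 0 x = G 0 x := by
  have h1 := (hF.continuousAt_fst hI h0 x).continuousWithinAt (s := {0}ᶜ)
  have h2 := (hG.continuousAt_fst hI h0 x).continuousWithinAt (s := {0}ᶜ)
  refine tendsto_nhds_unique_of_eventuallyEq h1 h2 ?_
  filter_upwards [self_mem_nhdsWithin, mem_nhdsWithin_of_mem_nhds (hI.mem_nhds h0)] with ε hε hεI
    using h ε hεI hε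

theorem starConvex_zero_Ioo {r : ℝ} : StarConvex ℝ 0 (Ioo (-r) r) := by
  by_cases h : 0 < r
  · exact (convex_Ioo _ _).starConvex (by simp [h])
  · rw [Ioo_eq_empty (by linarith)]
    exact starConvex_empty _

/-- An even smooth family is a smooth family in `ε²`, to first order. -/
theorem SmoothFamily.exists_eq_add_sq_smul [CompleteSpace E] {r : ℝ} (hF : SmoothFamily (Ioo (-r) r) F)
    (heven : ∀ ε ∈ Ioo (-r) r, ∀ x, F (-ε) x = F ε x) :
    ∃ H : ℝ → ℝ → E, SmoothFamily (Ioo (-r) r) H ∧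
      (∀ ε ∈ Ioo (-r) r, ∀ x, H (-ε) x = H ε x) ∧
      ∀ ε ∈ Ioo (-r) r, ∀ x, F ε x = F 0 x + ε ^ 2 • H ε x := by
  have hneg : ∀ ε ∈ Ioo (-r) r, -ε ∈ Ioo (-r) r := fun ε hε => ⟨by linarith [hε.2],
    by linarith [hε.1]⟩
  by_cases hr : 0 < r
  swap
  · rw [Ioo_eq_empty (by linarith)]
    exact ⟨0, by simp [SmoothFamily], by simp, by simp⟩
  have h0 : (0 : ℝ) ∈ Ioo (-r) r := by simp [hr]
  obtain ⟨G, hG, hFG⟩ := hF.exists_eq_add_smul isOpen_Ioo starConvex_zero_Ioo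
  -- Evenness of F makes the quotient G odd away from 0; by continuity it vanishes at 0, so a second
  -- division by ε is possible and restores evenness.
  have hGodd : ∀ ε ∈ Ioo (-r) r, ∀ x, ε ≠ 0 → G (-ε) x = -G ε x := fun ε hε x hne => by
    have h1 := hFG ε hε x
    have h2 := hFG (-ε) (hneg ε hε) x
    rw [heven ε hε x, h1] at h2
    have h3 : ε • (G (-ε) x + G ε x) = 0 := by
      rw [smul_add]
      have := add_left_cancel h2
      rw [this, neg_smul]
      abel
    exact eq_neg_of_add_eq_zero_left ((smul_eq_zero.1 h3).resolve_left hne)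
  have hG0 : ∀ x, G 0 x = 0 := fun x => by
    have hc := hG.continuousAt_fst isOpen_Ioo h0 x
    have hc' : ContinuousAt (fun s => G (-s) x) 0 :=
      ContinuousAt.comp (g := fun s => G s x) (by simpa using hc) continuousAt_neg
    have h1 := (hc.add hc').continuousWithinAt (s := {0}ᶜ)
    have h2 : G 0 x + G (-0) x = 0 := by
      refine tendsto_nhds_unique_of_eventuallyEq h1 tendsto_const_nhds ?_
      filter_upwards [self_mem_nhdsWithin,
        mem_nhdsWithin_of_mem_nhds (isOpen_Ioo.mem_nhds h0)] with ε hε hεI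
      simp [hGodd ε hεI x hε]
    rw [neg_zero, ← two_smul ℝ] at h2
    exact (smul_eq_zero.1 h2).resolve_left two_ne_zero
  obtain ⟨H, hH, hGH⟩ := hG.exists_eq_add_smul isOpen_Ioo starConvex_zero_Ioo
  refine ⟨H, hH, fun ε hε x => ?_, fun ε hε x => ?_⟩
  · by_cases hne : ε = 0
    · simp [hne]
    have h1 := hGodd ε hε x hne
    rw [hGH ε hε x, hGH (-ε) (hneg ε hε) x, hG0, zero_add, zero_add, neg_smul, neg_inj] at h1
    exact smul_right_injective E hne h1
  · rw [hFG ε hε x, hGH ε hε x, hG0, zero_add, smul_smul, sq]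

/-- Division of a smooth family by the power of `t` to which it vanishes at `t = 0`. -/
theorem SmoothFamily.exists_eq_pow_smul {F : ℝ → ℝ → ℝ} (i : ℕ) (hF : SmoothFamily univ F)
    (hvan : ∀ k < i, ∀ x, iteratedDeriv k (fun t => F t x) 0 = 0) :
    ∃ G : ℝ → ℝ → ℝ, SmoothFamily univ G ∧ (∀ t x, F t x = t ^ i * G t x) ∧
      ∀ j x, iteratedDeriv (i + j) (fun t => F t x) 0 =
        (i + j).descFactorial i * iteratedDeriv j (fun t => G t x) 0 := by
  induction i generalizing F with
  | zero => exact ⟨F, hF, by simp, by simp⟩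
  | succ i ih =>
    obtain ⟨G₁, hG₁, hFG₁⟩ := hF.exists_eq_add_smul isOpen_univ (starConvex_univ _)
    have hF0 : ∀ x, F 0 x = 0 := fun x => by simpa using hvan 0 (by omega) x
    have hF₁ : ∀ x, (fun t => F t x) = fun t => t * G₁ t x := fun x => funext fun t => by
      rw [hFG₁ t trivial x, hF0, zero_add, smul_eq_mul]
    -- Only the first derivative of the factor t survives at 0. The order of vanishing drops by one,
    -- and the factors k + 1 accumulate to the descending factorial.
    have hder : ∀ k x, iteratedDeriv (k + 1) (fun t => F t x) 0 =
        (k + 1) * iteratedDeriv k (fun t => G₁ t x) 0 := fun k x => by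
      have hs : ContDiffAt ℝ (k + 1 : ℕ) (fun t => G₁ t x) 0 :=
        (hG₁.contDiffAt_fst isOpen_univ trivial x).of_le (by exact_mod_cast le_top)
      rw [hF₁, iteratedDeriv_fun_mul (f := fun t => t) contDiffAt_id hs, Finset.sum_eq_single 1]
      · simp [iteratedDeriv_fun_id_zero]
      · intro b _ hb
        simp [iteratedDeriv_fun_id_zero, hb]
      · simp
    obtain ⟨G, hG, hGG, hGd⟩ := ih hG₁ fun k hk x => by
      have := hvan (k + 1) (by omega) x
      rw [hder] at this
      exact (mul_eq_zero.1 this).resolve_left (by positivity)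
    refine ⟨G, hG, fun t x => ?_, fun j x => ?_⟩
    · rw [congrFun (hF₁ x) t, hGG]; ring
    · rw [show i + 1 + j = (i + j) + 1 by ring, hder, hGd, Nat.succ_descFactorial_succ]
      push_cast; ring

/-- Each x-derivative of the cofactor K is continuous in (ε, x), hence bounded on a compact
rectangle. -/
theorem isBigOSmooth_of_eq {r : ℝ} (hr : 0 < r) {n : ℕ} {K : ℝ → ℝ → E}
    (hK : SmoothFamily (Ioo (-r) r) K)
    (h : ∀ ε ∈ Ioo (-r) r, ∀ x, F ε x = ε ^ n • K ε x) : IsBigOSmooth n F := by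
  intro j R
  have hcont := (hK.iteratedDeriv_snd isOpen_Ioo j).continuousOn
  obtain ⟨c, hc⟩ := ((isCompact_Icc (a := -(r / 2)) (b := r / 2)).prod
    (isCompact_Icc (a := -R) (b := R))).exists_bound_of_continuousOn (hcont.mono
      (prod_mono (Icc_subset_Ioo (by linarith) (by linarith)) (subset_univ _)))
  refine ⟨c, r / 2, by positivity, fun ε _ hε x hx => ?_⟩
  have hεI : ε ∈ Icc (-(r / 2)) (r / 2) := abs_le.1 hε.le
  have heq : F ε = fun x => ε ^ n • K ε x :=
    funext fun x => h ε (Icc_subset_Ioo (by linarith) (by linarith) hεI) x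
  rw [heq, iteratedDeriv_fun_const_smul_field, norm_smul, norm_pow, Real.norm_eq_abs, mul_comm]
  exact mul_le_mul_of_nonneg_right (hc (ε, x) ⟨hεI, abs_le.1 hx⟩) (by positivity)

/-- The second order expansion of an even smooth family. -/
theorem SmoothFamily.isBigOSmooth_four [CompleteSpace E] {r : ℝ} (hr : 0 < r) {H : ℝ → ℝ → E}
    (hH : SmoothFamily (Ioo (-r) r) H)
    (heven : ∀ ε ∈ Ioo (-r) r, ∀ x, H (-ε) x = H ε x)
    (h : ∀ ε ∈ Ioo (-r) r, ∀ x, F ε x = F 0 x + ε ^ 2 • H ε x) :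
    IsBigOSmooth 4 fun ε x => F ε x - (F 0 x + ε ^ 2 • H 0 x) := by
  obtain ⟨K, hK, -, hHK⟩ := hH.exists_eq_add_sq_smul heven
  refine isBigOSmooth_of_eq hr hK fun ε hε x => ?_
  rw [h ε hε x, hHK ε hε x, smul_add, smul_smul, ← pow_add]
  abel

end Hadamard

/-- If a smooth family of periodic functions takes values in an open set for `ε = 0`, then it does
so for all small `ε`. -/
theorem SmoothFamily.exists_forall_mem {r T : ℝ} (hr : 0 < r) (hT : 0 < T) {h : ℝ → ℝ → ℝ}
    (hs : SmoothFamily (Ioo (-r) r) h) (hper : ∀ ε ∈ Ioo (-r) r, Function.Periodic (h ε) T)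
    {S : Set ℝ} (hS : IsOpen S) (h0 : ∀ x, h 0 x ∈ S) :
    ∃ r', 0 < r' ∧ r' ≤ r ∧ ∀ ε ∈ Ioo (-r') r', ∀ x, h ε x ∈ S := by
  -- One period is compact, so a single neighbourhood of ε = 0 serves all its points; periodicity
  -- then covers the line.
  have hev : ∀ᶠ ε in 𝓝 (0 : ℝ), ∀ x ∈ Icc (0 : ℝ) T, h ε x ∈ S :=
    isCompact_Icc.eventually_forall_of_forall_eventually (P := fun ε x => h ε x ∈ S)
      fun x _ => (hs.contDiffAt isOpen_Ioo (ε := 0) (by simp [hr]) x).continuousAt.eventually_mem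
        (hS.mem_nhds (h0 x))
  obtain ⟨δ, hδ, hball⟩ := Metric.eventually_nhds_iff.1 hev
  refine ⟨min δ r, lt_min hδ hr, min_le_right _ _, fun ε hε x => ?_⟩
  have hεr : ε ∈ Ioo (-r) r :=
    ⟨by linarith [hε.1, min_le_right δ r], hε.2.trans_le (min_le_right _ _)⟩
  obtain ⟨y, hy, hxy⟩ := (hper ε hεr).exists_mem_Ico₀ hT x
  rw [hxy]
  refine hball ?_ y (Ico_subset_Icc_self hy)
  rw [Real.dist_eq, sub_zero, abs_lt]
  exact ⟨by linarith [hε.1, min_le_left δ r], hε.2.trans_le (min_le_left _ _)⟩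

/-! ### Formal pseudodifferential operators: products, powers and roots -/

section PseudoDiff

variable {A A' B B' R R' L : ℤ → ℝ → ℝ}

/-- A nonzero term needs p.1 ≤ a and k - p.1 + p.2 ≤ b, which forces k - b ≤ p.1 and p.2 ≤ a + b -
k. Any box containing this range may be summed over, so two products can be compared over a common
box. -/
theorem psiMul_eq_sum {a b : ℤ} (hA : ∀ k, a < k → A k = 0) (hB : ∀ k, b < k → B k = 0)
    {k lo : ℤ} {N : ℕ} (hlo : lo ≤ k - b) (hN : a + b - k < N) (x : ℝ) :
    psiMul A B k x = ∑ p ∈ Finset.Icc lo a ×ˢ Finset.range N,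
      ((Ring.choose p.1 p.2 : ℤ) : ℝ) * A p.1 x * iteratedDeriv p.2 (B (k - p.1 + (p.2 : ℤ))) x := by
  refine finsum_eq_sum_of_support_subset _ fun p hp => ?_
  rw [Function.mem_support] at hp
  have h1 : p.1 ≤ a := by
    by_contra h
    exact hp (by simp [hA p.1 (by omega)])
  have h2 : k - p.1 + (p.2 : ℤ) ≤ b := by
    by_contra h
    refine hp ?_
    rw [hB _ (by omega), show (0 : ℝ → ℝ) = fun _ => 0 from rfl, iteratedDeriv_const]
    simp
  simp only [Finset.coe_product, Finset.coe_Icc, Finset.coe_range, mem_prod, mem_Icc, mem_Iio]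
  omega

theorem psiMul_eq_zero {a b : ℤ} (hA : ∀ k, a < k → A k = 0) (hB : ∀ k, b < k → B k = 0)
    {k : ℤ} (hk : a + b < k) : psiMul A B k = 0 := by
  ext x
  rw [psiMul_eq_sum hA hB (k := k) (lo := k - b) (N := 0) le_rfl (by omega)]
  simp

theorem contDiff_iteratedDeriv {E : Type*} [NormedAddCommGroup E] [NormedSpace ℝ E] {f : ℝ → E}
    (hf : ContDiff ℝ ∞ f) (n : ℕ) : ContDiff ℝ ∞ (iteratedDeriv n f) := by
  rw [iteratedDeriv_eq_iterate]
  exact hf.iterate_deriv n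

theorem Periodic.iteratedDeriv {f : ℝ → ℝ} {T : ℝ} (hf : Function.Periodic f T) (n : ℕ) :
    Function.Periodic (iteratedDeriv n f) T := fun x => by
  rw [← congrFun (iteratedDeriv_comp_add_const n f T) x]
  congr 1
  exact funext hf

theorem IsPseudoDiff.mul (hA : IsPseudoDiff A) (hB : IsPseudoDiff B) :
    IsPseudoDiff (psiMul A B) := by
  obtain ⟨a, ha⟩ := hA.order
  obtain ⟨b, hb⟩ := hB.order
  have key : ∀ k, psiMul A B k = fun x =>
      ∑ p ∈ Finset.Icc (k - b) a ×ˢ Finset.range (a + b - k + 1).toNat,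
      ((Ring.choose p.1 p.2 : ℤ) : ℝ) * A p.1 x * iteratedDeriv p.2 (B (k - p.1 + (p.2 : ℤ))) x :=
    fun k => funext fun x => psiMul_eq_sum ha hb le_rfl (by omega) x
  refine ⟨⟨a + b, fun k hk => psiMul_eq_zero ha hb hk⟩, fun k => ?_, fun k x => ?_⟩
  · rw [key]
    refine ContDiff.sum fun p _ => (contDiff_const.mul (hA.smooth _)).mul ?_
    exact contDiff_iteratedDeriv (hB.smooth _) p.2
  · simp only [key]
    refine Finset.sum_congr rfl fun p _ => ?_
    rw [hA.periodic, Periodic.iteratedDeriv (hB.periodic _)]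

theorem isPseudoDiff_one : IsPseudoDiff fun k _ => if k = 0 then (1 : ℝ) else 0 := by
  refine ⟨⟨0, fun k hk => ?_⟩, fun k => contDiff_const, fun k x => rfl⟩
  simp [hk.ne']
  rfl

theorem IsPseudoDiff.pow (hR : IsPseudoDiff R) (n : ℕ) : IsPseudoDiff (psiPow R n) := by
  induction n with
  | zero => exact isPseudoDiff_one
  | succ n ih => exact ih.mul hR

theorem psiPow_eq_zero (hR : ∀ k : ℤ, 1 < k → R k = 0) (n : ℕ) :
    ∀ k : ℤ, n < k → psiPow R n k = 0 := by
  induction n with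
  | zero =>
    intro k hk
    ext x
    simp only [psiPow, Pi.zero_apply]
    rw [if_neg (by simpa using hk.ne')]
  | succ n ih =>
    intro k hk
    exact psiMul_eq_zero ih hR (by push_cast at hk; omega)

theorem psiPow_leading (hR : ∀ k : ℤ, 1 < k → R k = 0) (hR1 : R 1 = 1) (n : ℕ) :
    psiPow R n n = 1 := by
  induction n with
  | zero => ext x; simp [psiPow]
  | succ n ih =>
    ext x
    rw [psiPow, psiMul_eq_sum (psiPow_eq_zero hR n) hR (lo := n) (N := 1)
      (by push_cast; omega) (by push_cast; omega)]
    simp [ih, hR1]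

/-- Products of monic pseudodifferential operators that agree to order `j`. -/
theorem psiMul_congr {m j : ℤ}
    (hA : ∀ k, m < k → A k = 0) (hA' : ∀ k, m < k → A' k = 0)
    (hB : ∀ k : ℤ, 1 < k → B k = 0) (hB' : ∀ k : ℤ, 1 < k → B' k = 0)
    (hAA : ∀ k, m - j < k → A k = A' k) (hBB : ∀ k, 1 - j < k → B k = B' k)
    {k : ℤ} (hk : m + 1 - j < k) : psiMul A B k = psiMul A' B' k := by
  ext x
  rw [psiMul_eq_sum hA hB (lo := k - 1) (N := (m + 1 - k + 1).toNat) (by omega) (by omega),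
    psiMul_eq_sum hA' hB' (lo := k - 1) (N := (m + 1 - k + 1).toNat) (by omega) (by omega)]
  refine Finset.sum_congr rfl fun p hp => ?_
  simp only [Finset.mem_product, Finset.mem_Icc, Finset.mem_range] at hp
  rw [hAA p.1 (by omega), hBB _ (by omega)]

/-- At the first order where the factors differ, the product is linear in the differences. Each
difference meets the leading coefficient 1 of the other factor, and derivatives of that constant
vanish, so only (m - j, 0) and (m, 0) contribute. -/
theorem psiMul_sub_psiMul {m j : ℤ} (hj : 1 ≤ j)
    (hA : ∀ k, m < k → A k = 0) (hA' : ∀ k, m < k → A' k = 0)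
    (hB : ∀ k : ℤ, 1 < k → B k = 0) (hB' : ∀ k : ℤ, 1 < k → B' k = 0)
    (hAm : A m = 1) (hB1 : B 1 = 1)
    (hAA : ∀ k, m - j < k → A k = A' k) (hBB : ∀ k, 1 - j < k → B k = B' k) (x : ℝ) :
    psiMul A B (m + 1 - j) x - psiMul A' B' (m + 1 - j) x =
      (A (m - j) x - A' (m - j) x) + (B (1 - j) x - B' (1 - j) x) := by
  have hAm' : A' m = 1 := by rw [← hAA m (by omega), hAm]
  have hB1' : B' 1 = 1 := by rw [← hBB 1 (by omega), hB1]
  rw [psiMul_eq_sum hA hB (lo := m - j) (N := j.toNat + 1) (by omega) (by omega),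
    psiMul_eq_sum hA' hB' (lo := m - j) (N := j.toNat + 1) (by omega) (by omega),
    ← Finset.sum_sub_distrib, Finset.sum_eq_add (m - j, 0) (m, 0)]
  · have e1 : m + 1 - j - (m - j) = 1 := by ring
    have e2 : m + 1 - j - m = 1 - j := by ring
    simp [e1, e2, hAm, hAm', hB1, hB1']
  · intro h
    have := congrArg Prod.fst h
    simp only at this
    omega
  · rintro ⟨i, n⟩ hp ⟨h1, h2⟩
    simp only [Finset.mem_product, Finset.mem_Icc, Finset.mem_range] at hp
    simp only [ne_eq, Prod.mk.injEq, not_and] at h1 h2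
    dsimp only
    have hBn : iteratedDeriv n (B (m + 1 - j - i + n)) x =
        iteratedDeriv n (B' (m + 1 - j - i + n)) x ∨ (i = m - j ∨ i = m) ∧ n = 0 := by
      by_cases h : 1 - j < m + 1 - j - i + n
      · left; rw [hBB _ h]
      · right; omega
    by_cases hi : i = m - j
    · have hn : n ≠ 0 := h1 hi
      rw [show m + 1 - j - i + (n : ℤ) = 1 + n by omega, hB (1 + n) (by omega),
        hB' (1 + n) (by omega), show (0 : ℝ → ℝ) = fun _ => 0 from rfl, iteratedDeriv_const]
      simp [hn]
    · rw [hAA i (by omega)]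
      rcases hBn with h | ⟨h3 | h3, h4⟩
      · rw [h, sub_self]
      · exact absurd h3 hi
      · exact absurd h4 (h2 h3)
  · intro h
    exfalso; apply h
    simp only [Finset.mem_product, Finset.mem_Icc, Finset.mem_range]
    omega
  · intro h
    exfalso; apply h
    simp only [Finset.mem_product, Finset.mem_Icc, Finset.mem_range]
    omega

/-- Powers of monic first order operators that agree to order `j`. -/
theorem psiPow_congr {j : ℤ} (hj : 1 ≤ j)
    (hR : ∀ k : ℤ, 1 < k → R k = 0) (hR' : ∀ k : ℤ, 1 < k → R' k = 0) (hR1 : R 1 = 1)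
    (hRR : ∀ k, 1 - j < k → R k = R' k) (n : ℕ) :
    (∀ k, n - j < k → psiPow R n k = psiPow R' n k) ∧
      ∀ x, psiPow R n (n - j) x - psiPow R' n (n - j) x = n * (R (1 - j) x - R' (1 - j) x) := by
  induction n with
  | zero => simp [psiPow]
  | succ n ih =>
    refine ⟨fun k hk => ?_, fun x => ?_⟩
    · exact psiMul_congr (m := n) (j := j) (psiPow_eq_zero hR n) (psiPow_eq_zero hR' n) hR hR'
        ih.1 hRR (by push_cast at hk; omega)
    · have := psiMul_sub_psiMul hj (psiPow_eq_zero hR n) (psiPow_eq_zero hR' n) hR hR'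
        (psiPow_leading hR hR1 n) hR1 ih.1 hRR x
      rw [ih.2 x] at this
      push_cast
      rw [psiPow, psiPow, this]
      ring

/-- The operator `∂`. -/
def partialOp : ℤ → ℝ → ℝ := fun k _ => if k = 1 then 1 else 0

theorem psiMul_partialOp (A : ℤ → ℝ → ℝ) (k : ℤ) : psiMul A partialOp k = A (k - 1) := by
  ext x
  rw [psiMul, finsum_eq_single _ (k - 1, 0)]
  · simp [partialOp]
  · rintro ⟨i, n⟩ h
    have : iteratedDeriv n (partialOp (k - i + n)) x = 0 := by
      unfold partialOp
      rw [iteratedDeriv_const]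
      by_cases hn : n = 0
      · have hi : i ≠ k - 1 := fun hi => h (by rw [hi, hn])
        simp only [hn, if_true, Nat.cast_zero, add_zero]
        rw [if_neg (by omega)]
      · simp [hn]
    simp only [this, mul_zero]

theorem psiPow_partialOp (n : ℕ) (k : ℤ) :
    psiPow partialOp n k = fun _ => if k = n then 1 else 0 := by
  induction n generalizing k with
  | zero => simp [psiPow]
  | succ n ih =>
    rw [psiPow, psiMul_partialOp, ih]
    push_cast
    simp only [sub_eq_iff_eq_add]

theorem isPseudoDiff_partialOp : IsPseudoDiff partialOp := by
  refine ⟨⟨1, fun k hk => ?_⟩, fun k => contDiff_const, fun k x => rfl⟩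
  ext x
  simp [partialOp, hk.ne']

/-- Successive approximations to the `n`-th root of `L`, correct to order `J + 1`. -/
def rootApprox (n : ℕ) (L : ℤ → ℝ → ℝ) : ℕ → ℤ → ℝ → ℝ
  | 0, k => partialOp k
  | J + 1, k => if k = -1 - (J : ℤ) then
      fun x => (L (n - 2 - J) x - psiPow (rootApprox n L J) n (n - 2 - J) x) / n
      else rootApprox n L J k

theorem rootApprox_zero (n : ℕ) (L : ℤ → ℝ → ℝ) : rootApprox n L 0 = partialOp := by
  ext k x
  rw [rootApprox]

theorem rootApprox_of_pos (n : ℕ) (L : ℤ → ℝ → ℝ) (J : ℕ) {k : ℤ} (hk : 0 ≤ k) :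
    rootApprox n L J k = partialOp k := by
  induction J with
  | zero => rfl
  | succ J ih => rw [rootApprox, if_neg (by omega), ih]

theorem rootApprox_of_lt (n : ℕ) (L : ℤ → ℝ → ℝ) (J : ℕ) {k : ℤ} (hk : k ≤ -1 - J) :
    rootApprox n L J k = 0 := by
  induction J with
  | zero => ext x; rw [rootApprox, partialOp, if_neg (by omega)]; rfl
  | succ J ih =>
    push_cast at hk
    rw [rootApprox, if_neg (by omega), ih (by omega)]

theorem rootApprox_stable (n : ℕ) (L : ℤ → ℝ → ℝ) {J J' : ℕ} (hJ : J ≤ J') {k : ℤ}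
    (hk : -1 - (J : ℤ) < k) : rootApprox n L J' k = rootApprox n L J k := by
  induction J', hJ using Nat.le_induction with
  | base => rfl
  | succ J' hJ' ih => rw [rootApprox, if_neg (by omega), ih]

theorem isPseudoDiff_rootApprox {n : ℕ} (hL : IsPseudoDiff L) (J : ℕ) :
    IsPseudoDiff (rootApprox n L J) := by
  induction J with
  | zero => rw [rootApprox_zero]; exact isPseudoDiff_partialOp
  | succ J ih =>
    have hp := ih.pow n
    refine ⟨⟨1, fun k hk => ?_⟩, fun k => ?_, fun k => ?_⟩
    · rw [rootApprox_of_pos _ _ _ (by omega)]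
      ext x
      simp [partialOp, hk.ne']
    · rw [rootApprox]
      split_ifs
      · exact ((hL.smooth _).sub (hp.smooth _)).div_const _
      · exact ih.smooth k
    · rw [rootApprox]
      split_ifs
      · intro x
        simp only
        rw [hL.periodic _ x, hp.periodic _ x]
      · exact ih.periodic k

theorem rootApprox_high (n : ℕ) (L : ℤ → ℝ → ℝ) (J : ℕ) :
    ∀ k : ℤ, 1 < k → rootApprox n L J k = 0 := fun k hk => by
  rw [rootApprox_of_pos _ _ _ (by omega)]
  ext x
  simp [partialOp, hk.ne']

theorem rootApprox_one (n : ℕ) (L : ℤ → ℝ → ℝ) (J : ℕ) : rootApprox n L J 1 = 1 := by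
  rw [rootApprox_of_pos _ _ _ (by omega)]
  ext x
  simp [partialOp]

/-- By `psiPow_congr` with j = J + 2, inserting a coefficient b at ∂^(-1-J) leaves the n-th power
unchanged above ∂^(n-2-J) and adds n·b there. The division by n in `rootApprox` is chosen to cancel
the defect. -/
theorem psiPow_rootApprox {n : ℕ} (hn : 0 < n) (hLn : L n = 1) (hLn' : L (n - 1) = 0)
    (hLh : ∀ k, (n : ℤ) < k → L k = 0) (J : ℕ) :
    ∀ k : ℤ, n - 2 - J < k → psiPow (rootApprox n L J) n k = L k := by
  induction J with
  | zero =>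
    intro k hk
    rw [rootApprox_zero, psiPow_partialOp]
    simp only [Nat.cast_zero, sub_zero] at hk
    rcases lt_trichotomy k n with h | h | h
    · rw [show k = n - 1 by omega, hLn']
      ext x; simp
    · rw [h, hLn]; ext x; simp
    · rw [hLh k h]; ext x; simp [h.ne']
  | succ J ih =>
    intro k hk
    have hstep := psiPow_congr (R := rootApprox n L (J + 1)) (R' := rootApprox n L J)
      (j := J + 2) (by omega) (rootApprox_high _ _ _) (rootApprox_high _ _ _)
      (rootApprox_one _ _ _) (fun k hk => rootApprox_stable n L (Nat.le_succ J) (by omega)) n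
    push_cast at hk
    by_cases h : (n : ℤ) - 2 - J < k
    · rw [hstep.1 k (by omega), ih k h]
    · obtain rfl : k = n - 2 - J := by omega
      ext x
      have h2 := hstep.2 x
      rw [show (1 : ℤ) - (J + 2) = -1 - J by ring, show (n : ℤ) - (J + 2) = n - 2 - J by ring,
        rootApprox_of_lt n L J le_rfl] at h2
      have hn' : (n : ℝ) ≠ 0 := by positivity
      simp only [rootApprox, if_true, Pi.zero_apply, sub_zero] at h2
      rw [mul_div_cancel₀ _ hn'] at h2
      exact sub_left_injective h2

/-- The first coefficient where two roots differ would produce n times that difference in their n-th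
powers, which are equal. -/
theorem isRoot_unique {n : ℕ} (hn : 0 < n) (hR : IsRoot n L R) (hR' : IsRoot n L R') : R = R' := by
  have key : ∀ j : ℕ, ∀ k : ℤ, -1 - (j : ℤ) < k → R k = R' k := by
    intro j
    induction j with
    | zero =>
      intro k hk
      rcases lt_trichotomy k 1 with h | h | h
      · obtain rfl : k = 0 := by simp at hk; omega
        rw [hR.zeroth, hR'.zeroth]
      · rw [h, hR.leading, hR'.leading]
      · rw [hR.higher k h, hR'.higher k h]
    | succ j ih =>
      intro k hk
      by_cases h : -1 - (j : ℤ) < k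
      · exact ih k h
      · obtain rfl : k = 1 - (j + 2) := by push_cast at hk; omega
        ext x
        have h2 := (psiPow_congr (j := j + 2) (by omega) hR.higher hR'.higher hR.leading
          (fun k hk => ih k (by omega)) n).2 x
        rw [hR.pow_eq, hR'.pow_eq, sub_self] at h2
        have hn' : (n : ℝ) ≠ 0 := by positivity
        exact sub_eq_zero.1 ((mul_eq_zero.1 h2.symm).resolve_left hn')
  ext k x
  rw [key k.natAbs k (by omega)]

theorem exists_isRoot {n : ℕ} (hn : 0 < n) (hL : IsPseudoDiff L) (hLn : L n = 1)
    (hLn' : L (n - 1) = 0) (hLh : ∀ k, (n : ℤ) < k → L k = 0) : ∃ R, IsRoot n L R := by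
  -- The coefficient of ∂^k no longer changes after stage (-k).toNat, so this is the coefficientwise
  -- limit.
  let R : ℤ → ℝ → ℝ := fun k => rootApprox n L (-k).toNat k
  have hRJ : ∀ (J : ℕ) (k : ℤ), -1 - (J : ℤ) < k → R k = rootApprox n L J k := fun J k hk => by
    rcases le_total (-k).toNat J with h | h
    · exact (rootApprox_stable n L h (by omega)).symm
    · exact rootApprox_stable n L h hk
  have hRh : ∀ k : ℤ, 1 < k → R k = 0 := fun k hk => rootApprox_high n L _ k hk
  have hR1 : R 1 = 1 := rootApprox_one n L _
  refine ⟨R, ⟨⟨1, hRh⟩, fun k => (isPseudoDiff_rootApprox hL _).smooth k,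
    fun k => (isPseudoDiff_rootApprox hL _).periodic k⟩, hR1, ?_, hRh, ?_⟩
  · rw [hRJ 0 0 (by simp), rootApprox]
    ext x
    simp [partialOp]
  · ext k x
    -- The coefficient of ∂^k in R^n depends only on coefficients of R already final at stage J.
    set J := (n - 1 - k).toNat with hJ
    rw [(psiPow_congr (j := J + 2) (by omega) hRh (rootApprox_high n L J) hR1
      (fun k hk => hRJ J k (by omega)) n).1 k (by omega),
      psiPow_rootApprox hn hLn hLn' hLh J k (by omega)]

end PseudoDiff

/-! ### The root of L and the differential part of its square -/

section DiffOp

variable {d : ℕ} {u : ℕ → ℝ → ℝ}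

theorem diffOp_top (d : ℕ) (u : ℕ → ℝ → ℝ) : diffOp d u (d + 1) = 1 := by
  ext x; simp [diffOp]

theorem diffOp_coe {i : ℕ} (hi : i < d) (u : ℕ → ℝ → ℝ) : diffOp d u i = u i := by
  ext x
  simp only [diffOp]
  rw [if_neg (by omega), if_pos (by omega)]
  simp

theorem diffOp_eq_zero {k : ℤ} (h1 : k ≠ d + 1) (h2 : ¬(0 ≤ k ∧ k < d)) (u : ℕ → ℝ → ℝ) :
    diffOp d u k = 0 := by
  ext x
  simp only [diffOp]
  rw [if_neg h1, if_neg h2]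

theorem isPseudoDiff_diffOp (hs : ∀ i < d, ContDiff ℝ ∞ (u i))
    (hp : ∀ i < d, Function.Periodic (u i) (2 * Real.pi)) : IsPseudoDiff (diffOp d u) := by
  refine ⟨⟨d + 1, fun k hk => diffOp_eq_zero (by omega) (by omega) u⟩, fun k => ?_, fun k => ?_⟩
  all_goals
    by_cases h1 : k = d + 1
    · rw [h1, diffOp_top]
      first | exact contDiff_const | exact fun x => rfl
    by_cases h2 : 0 ≤ k ∧ k < d
    · lift k to ℕ using h2.1
      rw [diffOp_coe (by omega)]
      first | exact hs k (by omega) | exact hp k (by omega)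
    · rw [diffOp_eq_zero h1 h2]
      first | exact contDiff_const | exact fun x => rfl

theorem existsUnique_isRoot_diffOp (hs : ∀ i < d, ContDiff ℝ ∞ (u i))
    (hp : ∀ i < d, Function.Periodic (u i) (2 * Real.pi)) :
    ∃! R, IsRoot (d + 1) (diffOp d u) R := by
  obtain ⟨R, hR⟩ := exists_isRoot (n := d + 1) (by omega) (isPseudoDiff_diffOp hs hp)
    (by push_cast; exact diffOp_top d u)
    (diffOp_eq_zero (by push_cast; omega) (by push_cast; omega) u)
    (fun k hk => diffOp_eq_zero (by push_cast at hk; omega) (by push_cast at hk; omega) u)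
  exact ⟨R, hR, fun R' hR' => isRoot_unique (by omega) hR' hR⟩

/-- `(L^(2/(d+1)))_+ = ∂² + (2/(d+1)) u_(d-1)`. -/
theorem kdvQ_two (hd : 2 ≤ d) (hs : ∀ i < d, ContDiff ℝ ∞ (u i))
    (hp : ∀ i < d, Function.Periodic (u i) (2 * Real.pi)) (k : ℤ) (x : ℝ) :
    kdvQ 2 d u k x =
      if k = 2 then 1 else if k = 0 then 2 / ((d : ℝ) + 1) * u (d - 1) x else 0 := by
  have hR : IsRoot (d + 1) (diffOp d u) _ :=
    Classical.epsilon_spec (existsUnique_isRoot_diffOp hs hp).exists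
  unfold kdvQ
  set R := Classical.epsilon fun R => IsRoot (d + 1) (diffOp d u) R
  have hRR : ∀ k : ℤ, 1 - 2 < k → R k = partialOp k := fun k hk => by
    rcases lt_trichotomy k 1 with h | h | h
    · obtain rfl : k = 0 := by omega
      rw [hR.zeroth]; ext x; simp [partialOp]
    · rw [h, hR.leading]; ext x; simp [partialOp]
    · rw [hR.higher k h]; ext x; simp [partialOp, h.ne']
  have hph : ∀ k : ℤ, 1 < k → partialOp k = 0 := fun k hk => by
    ext x; simp [partialOp, hk.ne']
  have hpm : partialOp (1 - 2) x = 0 := by simp [partialOp]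
  -- R is compared with ∂, from which it first differs at ∂^(-1). The power d + 1 gives (d+1) b_(-1)
  -- = u_(d-1), and the square below has zeroth coefficient 2 b_(-1).
  have h1 := (psiPow_congr (j := 2) (by omega) hR.higher hph hR.leading hRR (d + 1)).2 x
  rw [hR.pow_eq, psiPow_partialOp, hpm,
    show ((d + 1 : ℕ) : ℤ) - 2 = (d - 1 : ℕ) by omega, diffOp_coe (by omega)] at h1
  rw [if_neg (by omega), sub_zero, sub_zero] at h1
  have h2 := psiPow_congr (j := 2) (by omega) hR.higher hph hR.leading hRR 2
  have h20 := h2.2 x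
  rw [psiPow_partialOp, hpm] at h20
  simp only [Nat.cast_ofNat, sub_self, sub_zero] at h20
  norm_num at h20
  have hd' : (d : ℝ) + 1 ≠ 0 := by positivity
  unfold diffPart
  by_cases hk0 : k = 0
  · subst hk0
    simp only [le_refl, if_true]
    norm_num
    rw [h20, h1]
    push_cast
    field_simp
  · by_cases hk : 0 ≤ k
    · rw [if_pos hk, h2.1 k (by push_cast; omega), psiPow_partialOp]
      simp [hk0]
    · rw [if_neg hk, if_neg (by omega), if_neg hk0]; rfl

end DiffOp

/-! ### Derivatives of determinants, linear images and products -/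

section Calculus

/-- Stated within a set because the linearization of the normalization uses the variable η = ε²,
which only approaches 0 from the right. -/
theorem hasDerivWithinAt_det {n : Type*} [Fintype n] [DecidableEq n] {M : ℝ → Matrix n n ℝ}
    {M' : Matrix n n ℝ} {s : Set ℝ} {x : ℝ}
    (h : ∀ i j, HasDerivWithinAt (fun t => M t i j) (M' i j) s x) :
    HasDerivWithinAt (fun t => (M t).det) (∑ i, ((M x).updateRow i (M' i)).det) s x := by
  have hdet : ∀ A : Matrix n n ℝ, A.det = ∑ σ : Equiv.Perm n, ((Equiv.Perm.sign σ : ℤ) : ℝ) *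
      ∏ i, A i (σ i) := fun A => by rw [← Matrix.det_transpose, Matrix.det_apply']; rfl
  simp only [hdet]
  rw [Finset.sum_comm]
  refine HasDerivWithinAt.fun_sum fun σ _ => ?_
  rw [← Finset.mul_sum]
  refine (HasDerivWithinAt.fun_finsetProd fun i _ => h i (σ i)).const_mul _ |>.congr_deriv ?_
  congr 1
  refine Finset.sum_congr rfl fun i _ => ?_
  rw [← Finset.prod_erase_mul _ _ (Finset.mem_univ i), Matrix.updateRow_self, smul_eq_mul]
  congr 1
  refine Finset.prod_congr rfl fun j hj => ?_
  rw [Matrix.updateRow_ne (Finset.ne_of_mem_erase hj)]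

theorem iteratedDeriv_clm {E F : Type*} [NormedAddCommGroup E] [NormedSpace ℝ E]
    [NormedAddCommGroup F] [NormedSpace ℝ F] (A : E →L[ℝ] F) {f : ℝ → E} (hf : ContDiff ℝ ∞ f)
    (n : ℕ) : iteratedDeriv n (fun x => A (f x)) = fun x => A (iteratedDeriv n f x) := by
  induction n with
  | zero => simp
  | succ n ih =>
    ext1 x
    rw [iteratedDeriv_succ, ih, iteratedDeriv_succ]
    exact (A.hasFDerivAt.comp_hasDerivAt x
      ((contDiff_iteratedDeriv hf n).differentiable (by simp) x).hasDerivAt).deriv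

theorem hasDerivAt_iteratedDeriv {E : Type*} [NormedAddCommGroup E] [NormedSpace ℝ E]
    {f : ℝ → E} (hf : ContDiff ℝ ∞ f) (n : ℕ) (x : ℝ) :
    HasDerivAt (iteratedDeriv n f) (iteratedDeriv (n + 1) f x) x := by
  rw [iteratedDeriv_succ]
  exact ((contDiff_iteratedDeriv hf n).differentiable (by simp) x).hasDerivAt

theorem iteratedDeriv_component {ι : Type*} [Fintype ι] {f : ℝ → ι → ℝ} (hf : ContDiff ℝ ∞ f)
    (n : ℕ) (j : ι) (x : ℝ) :
    iteratedDeriv n f x j = iteratedDeriv n (fun y => f y j) x :=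
  (congrFun (iteratedDeriv_clm (ContinuousLinearMap.proj (R := ℝ) (φ := fun _ : ι => ℝ) j) hf n)
    x).symm

theorem iteratedDeriv_fun_smul {E : Type*} [NormedAddCommGroup E] [NormedSpace ℝ E]
    {f : ℝ → ℝ} {g : ℝ → E} (hf : ContDiff ℝ ∞ f) (hg : ContDiff ℝ ∞ g) (n : ℕ) (x : ℝ) :
    iteratedDeriv n (fun y => f y • g y) x = ∑ i ∈ Finset.range (n + 1),
      ((n.choose i : ℝ) * iteratedDeriv i f x) • iteratedDeriv (n - i) g x := by
  have := iteratedDerivWithin_smul (n := n) (Set.mem_univ x) uniqueDiffOn_univ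
    (f := f) (g := g) (hf.of_le (by exact_mod_cast le_top)).contDiffWithinAt
    (hg.of_le (by exact_mod_cast le_top)).contDiffWithinAt
  simp only [iteratedDerivWithin_univ] at this
  rw [show (fun y => f y • g y) = f • g from rfl, this]
  refine Finset.sum_congr rfl fun i _ => ?_
  rw [mul_smul, Nat.cast_smul_eq_nsmul]

end Calculus

/-! ### The moving frame Γ, Γ', …, Γ^(d) and the operator of a curve -/

section Frame

variable {d : ℕ}

/-- The matrix with rows `Γ, Γ', …, Γ^(d)`. -/
def frame (Γ : ℝ → Fin (d + 1) → ℝ) (x : ℝ) : Matrix (Fin (d + 1)) (Fin (d + 1)) ℝ :=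
  Matrix.of fun i => iteratedDeriv (i : ℕ) Γ x

theorem wronskian_eq (Γ : ℝ → Fin (d + 1) → ℝ) (x : ℝ) : wronskian Γ x = (frame Γ x).det := rfl

/-- The coordinates of `v` in the frame `Γ, Γ', …, Γ^(d)`. -/
def coef (Γ : ℝ → Fin (d + 1) → ℝ) (x : ℝ) (v : Fin (d + 1) → ℝ) (i : Fin (d + 1)) : ℝ :=
  ((frame Γ x).updateRow i v).det / wronskian Γ x

variable {Γ : ℝ → Fin (d + 1) → ℝ} {x : ℝ}

theorem det_updateRow_frame (c : Fin (d + 1) → ℝ) (i : Fin (d + 1)) :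
    ((frame Γ x).updateRow i (∑ k, c k • iteratedDeriv (k : ℕ) Γ x)).det =
      c i * wronskian Γ x :=
  Matrix.det_updateRow_sum (frame Γ x) i c

theorem coef_sum (h : wronskian Γ x ≠ 0) (c : Fin (d + 1) → ℝ) (i : Fin (d + 1)) :
    coef Γ x (∑ k, c k • iteratedDeriv (k : ℕ) Γ x) i = c i := by
  rw [coef, det_updateRow_frame, mul_div_cancel_right₀ _ h]

theorem exists_eq_sum (h : wronskian Γ x ≠ 0) (v : Fin (d + 1) → ℝ) :
    ∃ c : Fin (d + 1) → ℝ, v = ∑ k, c k • iteratedDeriv (k : ℕ) Γ x := by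
  refine ⟨Matrix.vecMul v (frame Γ x)⁻¹, ?_⟩
  have : Matrix.vecMul (Matrix.vecMul v (frame Γ x)⁻¹) (frame Γ x) = v := by
    rw [Matrix.vecMul_vecMul, Matrix.nonsing_inv_mul (frame Γ x) (isUnit_iff_ne_zero.2 h),
      Matrix.vecMul_one]
  rw [Matrix.vecMul_eq_sum] at this
  exact this.symm

theorem sum_coef (h : wronskian Γ x ≠ 0) (v : Fin (d + 1) → ℝ) :
    ∑ k, coef Γ x v k • iteratedDeriv (k : ℕ) Γ x = v := by
  obtain ⟨c, rfl⟩ := exists_eq_sum h v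
  simp only [coef_sum h]

theorem coef_iteratedDeriv (h : wronskian Γ x ≠ 0) (i k : Fin (d + 1)) :
    coef Γ x (iteratedDeriv (k : ℕ) Γ x) i = if i = k then 1 else 0 := by
  have := coef_sum h (Pi.single k 1) i
  simpa [Pi.single_apply] using this

theorem coef_unique (h : wronskian Γ x ≠ 0) {a b : Fin (d + 1) → ℝ}
    (hab : ∑ k, a k • iteratedDeriv (k : ℕ) Γ x = ∑ k, b k • iteratedDeriv (k : ℕ) Γ x) :
    a = b := by
  ext i
  rw [← coef_sum h a i, hab, coef_sum h b i]

theorem coef_clm (Γ : ℝ → Fin (d + 1) → ℝ) (x : ℝ) (i : Fin (d + 1)) :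
    ∃ A : (Fin (d + 1) → ℝ) →L[ℝ] ℝ, ∀ v, A v = coef Γ x v i := by
  refine ⟨LinearMap.toContinuousLinearMap
    { toFun := fun v => coef Γ x v i, map_add' := fun v w => ?_, map_smul' := fun r v => ?_ },
    fun v => rfl⟩
  · simp only [coef, Matrix.det_updateRow_add, add_div]
  · simp only [coef, Matrix.det_updateRow_smul, mul_div_assoc, RingHom.id_apply, smul_eq_mul]

/-- A linear map carrying one frame to the other preserves coordinates. With the monodromy as A,
this is the source of all periodicity in x. -/
theorem coef_map (A : (Fin (d + 1) → ℝ) →ₗ[ℝ] (Fin (d + 1) → ℝ)) {Γ' : ℝ → Fin (d + 1) → ℝ}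
    {x' : ℝ} (h : wronskian Γ x ≠ 0) (h' : wronskian Γ' x' ≠ 0)
    (hA : ∀ i : ℕ, iteratedDeriv i Γ' x' = A (iteratedDeriv i Γ x)) (v : Fin (d + 1) → ℝ)
    (i : Fin (d + 1)) : coef Γ' x' (A v) i = coef Γ x v i := by
  obtain ⟨c, rfl⟩ := exists_eq_sum h v
  rw [coef_sum h, map_sum]
  simp only [map_smul, ← hA]
  rw [coef_sum h']

theorem wronskian_map (A : (Fin (d + 1) → ℝ) →ₗ[ℝ] (Fin (d + 1) → ℝ)) {Γ' : ℝ → Fin (d + 1) → ℝ}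
    {x' : ℝ} (hA : ∀ i : ℕ, iteratedDeriv i Γ' x' = A (iteratedDeriv i Γ x)) :
    wronskian Γ' x' = LinearMap.det A * wronskian Γ x := by
  have : frame Γ' x' = frame Γ x * (LinearMap.toMatrix' A).transpose := by
    ext i j
    simp only [frame, Matrix.of_apply, hA, Matrix.mul_apply, Matrix.transpose_apply]
    rw [← LinearMap.toMatrix'_mulVec A]
    simp [Matrix.mulVec, dotProduct, mul_comm]
  rw [wronskian_eq, this, Matrix.det_mul, Matrix.det_transpose, LinearMap.det_toMatrix', mul_comm,
    wronskian_eq]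

/-- By the Leibniz rule the frame of fΓ is a lower triangular matrix T, with f on the diagonal,
times the frame of Γ. -/
theorem wronskian_smul {f : ℝ → ℝ} (hf : ContDiff ℝ ∞ f) (hΓ : ContDiff ℝ ∞ Γ) (x : ℝ) :
    wronskian (fun y => f y • Γ y) x = f x ^ (d + 1) * wronskian Γ x := by
  let T : Matrix (Fin (d + 1)) (Fin (d + 1)) ℝ := Matrix.of fun i k =>
    if k ≤ i then ((i : ℕ).choose ((i : ℕ) - k) : ℝ) * iteratedDeriv ((i : ℕ) - k) f x else 0
  have hT : frame (fun y => f y • Γ y) x = T * frame Γ x := by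
    ext i j
    rw [frame, Matrix.of_apply, iteratedDeriv_fun_smul hf hΓ, ← Finset.sum_range_reflect]
    simp only [Matrix.mul_apply, T, frame, Matrix.of_apply, Finset.sum_apply, Pi.smul_apply,
      smul_eq_mul]
    refine Eq.trans ?_ ((Fin.sum_univ_eq_sum_range (fun k => (if h : k < d + 1 then (if (⟨k, h⟩ : Fin (d + 1)) ≤ i
      then ((i : ℕ).choose ((i : ℕ) - k) : ℝ) * iteratedDeriv ((i : ℕ) - k) f x else 0) else 0)
        * iteratedDeriv k Γ x j) (d + 1)).symm.trans ?_)
    · have hsub : Finset.range (i + 1) ⊆ Finset.range (d + 1) :=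
        Finset.range_subset_range.2 (by omega)
      rw [← Finset.sum_subset hsub]
      · refine Finset.sum_congr rfl fun k hk => ?_
        rw [Finset.mem_range] at hk
        rw [dif_pos (by omega), if_pos (by rw [Fin.le_def]; simp; omega),
          show (i : ℕ) + 1 - 1 - k = i - k by omega, show (i : ℕ) - (i - k) = k by omega]
      · intro k hk hk'
        rw [Finset.mem_range] at hk hk'
        rw [dif_pos hk, if_neg (by rw [Fin.le_def]; simp; omega), zero_mul]
    · exact Finset.sum_congr rfl fun k _ => by rw [dif_pos k.2]
  rw [wronskian_eq, hT, Matrix.det_mul, wronskian_eq, Matrix.det_of_isLowerTriangular]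
  · simp [T]
  · intro i j hij
    have hij' : i < j := hij
    simp only [T, Matrix.of_apply, if_neg (not_le.2 hij')]

/-- Differentiating any row except the last duplicates the next row, so only one term of the row
expansion survives. -/
theorem hasDerivAt_wronskian (hΓ : ContDiff ℝ ∞ Γ) (x : ℝ) :
    HasDerivAt (wronskian Γ)
      ((frame Γ x).updateRow (Fin.last d) (iteratedDeriv (d + 1) Γ x)).det x := by
  rw [← hasDerivWithinAt_univ]
  refine (hasDerivWithinAt_det (M := frame Γ)
    (M' := Matrix.of fun i => iteratedDeriv ((i : ℕ) + 1) Γ x) fun i j => ?_).congr_deriv ?_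
  · exact (hasDerivAt_pi.1 (hasDerivAt_iteratedDeriv hΓ i x) j).hasDerivWithinAt
  · rw [Fin.sum_univ_castSucc, Finset.sum_eq_zero, zero_add]
    · rfl
    · intro i _
      refine Matrix.det_zero_of_row_eq (i := i.castSucc) (j := i.succ)
        (Fin.castSucc_lt_succ).ne ?_
      rw [Matrix.updateRow_self, Matrix.updateRow_ne (Fin.castSucc_lt_succ).ne']
      rfl

/-- The coefficient is the derivative of a constant determinant. This is why L has no ∂^d term, and
also why the last frame coordinate of Γ(x+t) has no t^(d+1) term. -/
theorem coef_last_of_wronskian_const (hΓ : ContDiff ℝ ∞ Γ)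
    (hW : ∀ x, wronskian Γ x = 1) (x : ℝ) :
    coef Γ x (iteratedDeriv (d + 1) Γ x) (Fin.last d) = 0 := by
  rw [coef, ← (hasDerivAt_wronskian hΓ x).deriv, show wronskian Γ = fun _ => 1 from funext hW]
  simp

variable {I : Set ℝ} {F v : ℝ → ℝ → Fin (d + 1) → ℝ}

theorem SmoothFamily.wronskian (hF : SmoothFamily I F) (hI : IsOpen I) :
    SmoothFamily I fun ε x => wronskian (F ε) x :=
  .det fun i j => (hF.iteratedDeriv_snd hI i).apply j

theorem SmoothFamily.coef (hF : SmoothFamily I F) (hv : SmoothFamily I v) (hI : IsOpen I)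
    (h : ∀ ε ∈ I, ∀ x, PentagramLimit.wronskian (F ε) x ≠ 0) (i : Fin (d + 1)) :
    SmoothFamily I fun ε x => coef (F ε) x (v ε x) i := by
  simp only [PentagramLimit.coef, div_eq_mul_inv]
  refine .mul (.det fun k j => ?_) ((hF.wronskian hI).inv h)
  by_cases hk : k = i
  · subst hk
    simpa only [Matrix.updateRow_self] using hv.apply j
  · simpa only [Matrix.updateRow_ne hk, frame, Matrix.of_apply] using
      (hF.iteratedDeriv_snd hI k).apply j

/-- The coefficients `u_i` of the differential operator of a curve. -/
def curveCoeff (Γ : ℝ → Fin (d + 1) → ℝ) (i : ℕ) (x : ℝ) : ℝ :=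
  if h : i < d + 1 then -coef Γ x (iteratedDeriv (d + 1) Γ x) ⟨i, h⟩ else 0

theorem SmoothFamily.curveCoeff (hF : SmoothFamily I F) (hI : IsOpen I)
    (h : ∀ ε ∈ I, ∀ x, PentagramLimit.wronskian (F ε) x ≠ 0) (i : ℕ) :
    SmoothFamily I fun ε x => curveCoeff (F ε) i x := by
  unfold PentagramLimit.curveCoeff
  split_ifs
  · exact (hF.coef (hF.iteratedDeriv_snd hI _) hI h _).neg
  · exact .const contDiff_const

theorem curveCoeff_equation (hΓ : ContDiff ℝ ∞ Γ) (hW : ∀ x, wronskian Γ x = 1) (x : ℝ) :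
    iteratedDeriv (d + 1) Γ x +
      ∑ i ∈ Finset.range d, curveCoeff Γ i x • iteratedDeriv i Γ x = 0 := by
  have h := sum_coef (Γ := Γ) (x := x) (by simp [hW]) (iteratedDeriv (d + 1) Γ x)
  rw [Fin.sum_univ_castSucc, coef_last_of_wronskian_const hΓ hW, zero_smul, add_zero] at h
  rw [← Fin.sum_univ_eq_sum_range (fun i => curveCoeff Γ i x • iteratedDeriv i Γ x) d]
  nth_rewrite 1 [← h]
  rw [← Finset.sum_add_distrib]
  refine Finset.sum_eq_zero fun i _ => ?_
  rw [curveCoeff, dif_pos (by omega), neg_smul]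
  exact add_neg_cancel _

theorem eq_curveCoeff {u : ℕ → ℝ → ℝ} (hW : wronskian Γ x ≠ 0)
    (heq : iteratedDeriv (d + 1) Γ x +
      ∑ i ∈ Finset.range d, u i x • iteratedDeriv i Γ x = 0) {i : ℕ} (hi : i < d) :
    u i x = curveCoeff Γ i x := by
  have h1 : iteratedDeriv (d + 1) Γ x =
      ∑ k : Fin (d + 1), (Fin.snoc (fun k : Fin d => -u k x) 0 : Fin (d + 1) → ℝ) k •
        iteratedDeriv (k : ℕ) Γ x := by
    rw [Fin.sum_univ_castSucc, Fin.snoc_last, zero_smul, add_zero]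
    simp only [Fin.snoc_castSucc, neg_smul, Finset.sum_neg_distrib, Fin.val_castSucc]
    rw [Fin.sum_univ_eq_sum_range (fun i => u i x • iteratedDeriv i Γ x) d]
    exact eq_neg_of_add_eq_zero_left heq
  rw [curveCoeff, dif_pos (by omega), h1, coef_sum hW,
    show (⟨i, by omega⟩ : Fin (d + 1)) = Fin.castSucc ⟨i, hi⟩ from rfl, Fin.snoc_castSucc]
  simp

theorem isCurveOperator_curveCoeff (hΓ : ContDiff ℝ ∞ Γ) (hW : ∀ x, wronskian Γ x = 1)
    (A : (Fin (d + 1) → ℝ) →ₗ[ℝ] (Fin (d + 1) → ℝ))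
    (hA : ∀ (i : ℕ) (x : ℝ), iteratedDeriv i Γ (x + 2 * Real.pi) = A (iteratedDeriv i Γ x)) :
    IsCurveOperator Γ (curveCoeff Γ) where
  smooth i _ := by
    have := (SmoothFamily.const (I := univ) hΓ).curveCoeff isOpen_univ (by simp [hW]) i
    exact this.contDiff (mem_univ 0)
  periodic i _ x := by
    unfold curveCoeff
    split_ifs
    · rw [hA, coef_map A (by simp [hW]) (by simp [hW]) (fun i => hA i x)]
    · rfl
  equation := curveCoeff_equation hΓ hW

end Frame

/-! ### The commutator of ∂² + v with L -/

section Commutator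

/-- The operator `∂² + v`. -/
def schrodingerOp (v : ℝ → ℝ) : ℤ → ℝ → ℝ := fun k x => if k = 2 then 1 else if k = 0 then v x else 0

theorem schrodingerOp_two (v : ℝ → ℝ) : schrodingerOp v 2 = fun _ => 1 := by
  ext x; simp [schrodingerOp]

theorem schrodingerOp_zero (v : ℝ → ℝ) : schrodingerOp v 0 = v := by
  ext x; simp [schrodingerOp]

theorem schrodingerOp_of_ne (v : ℝ → ℝ) {k : ℤ} (h2 : k ≠ 2) (h0 : k ≠ 0) :
    schrodingerOp v k = fun _ => 0 := by
  ext x; simp [schrodingerOp, h2, h0]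

theorem psiMul_schrodingerOp_left (v : ℝ → ℝ) (A : ℤ → ℝ → ℝ) (k : ℤ) (x : ℝ) :
    psiMul (schrodingerOp v) A k x =
      A (k - 2) x + 2 * deriv (A (k - 1)) x + iteratedDeriv 2 (A k) x + v x * A k x := by
  rw [psiMul, finsum_eq_sum_of_support_subset (s := {(2, 0), (2, 1), (2, 2), (0, 0)})]
  · have e1 : k - 2 + 1 = k - 1 := by ring
    have c1 : Ring.choose (2 : ℤ) 1 = 2 := by simp
    have c2 : Ring.choose (2 : ℤ) 2 = 1 := by
      rw [show (2 : ℤ) = ((2 : ℕ) : ℤ) from rfl, Ring.choose_natCast]; simp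
    rw [Finset.sum_insert (by simp), Finset.sum_insert (by simp), Finset.sum_insert (by simp),
      Finset.sum_singleton]
    simp only [schrodingerOp_two, schrodingerOp_zero, c1, c2]
    simp [e1]
    ring
  · rintro ⟨i, n⟩ h
    rw [Function.mem_support] at h
    dsimp only at h
    have hA : i = 2 ∨ i = 0 := by
      by_contra hi
      push Not at hi
      exact h (by rw [schrodingerOp_of_ne v hi.1 hi.2]; simp)
    have hc : Ring.choose i n ≠ 0 := fun hc => h (by rw [hc]; simp)
    rcases hA with rfl | rfl
    · rw [show (2 : ℤ) = ((2 : ℕ) : ℤ) from rfl, Ring.choose_natCast] at hc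
      have : n ≤ 2 := by
        by_contra hn
        exact hc (by rw [Nat.choose_eq_zero_of_lt (by omega)]; rfl)
      interval_cases n <;> simp
    · rw [show (0 : ℤ) = ((0 : ℕ) : ℤ) from rfl, Ring.choose_natCast] at hc
      have : n ≤ 0 := by
        by_contra hn
        exact hc (by rw [Nat.choose_eq_zero_of_lt (by omega)])
      interval_cases n
      simp

theorem psiMul_schrodingerOp_right (v : ℝ → ℝ) {A : ℤ → ℝ → ℝ} {N : ℤ}
    (hA : ∀ k, N < k → A k = 0) (k : ℤ) (x : ℝ) :
    psiMul A (schrodingerOp v) k x = A (k - 2) x + ∑ n ∈ Finset.range (N + 1 - k).toNat,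
      ((Ring.choose (k + n) n : ℤ) : ℝ) * A (k + n) x * iteratedDeriv n v x := by
  let e : ℕ ↪ ℤ × ℕ := ⟨fun n => (k + n, n), fun a b h => (Prod.ext_iff.1 h).2⟩
  have he : ∀ n, e n = (k + n, n) := fun n => rfl
  have hmem : (k - 2, 0) ∉ (Finset.range (N + 1 - k).toNat).map e := by
    simp only [Finset.mem_map, not_exists, not_and, he, Prod.mk.injEq]
    intro n _ h
    omega
  rw [psiMul, finsum_eq_sum_of_support_subset
    (s := insert (k - 2, 0) ((Finset.range (N + 1 - k).toNat).map e))]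
  · rw [Finset.sum_insert hmem, Finset.sum_map]
    have e1 : k - (k - 2) = 2 := by ring
    have e2 : ∀ n : ℕ, k - (k + n) + n = 0 := fun n => by ring
    simp only [he, e2, schrodingerOp_zero]
    simp [e1, schrodingerOp_two]
  · rintro ⟨i, n⟩ h
    rw [Function.mem_support] at h
    dsimp only at h
    have hi : i ≤ N := by
      by_contra hi
      exact h (by rw [hA i (by omega)]; simp)
    have hq : (k - i + n = 2 ∧ n = 0) ∨ k - i + n = 0 := by
      by_contra hq
      push Not at hq
      refine h ?_
      by_cases h2 : k - i + n = 2
      · rw [h2, schrodingerOp_two, iteratedDeriv_const, if_neg (hq.1 h2), mul_zero]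
      · rw [schrodingerOp_of_ne v h2 hq.2, iteratedDeriv_const]
        simp
    simp only [Finset.coe_insert, Finset.coe_map, Finset.coe_range, mem_insert_iff, Prod.mk.injEq,
      mem_image, mem_Iio, he]
    rcases hq with ⟨h2, h0⟩ | h0
    · left; omega
    · right; exact ⟨n, by omega, by omega, rfl⟩

variable {d : ℕ} {u : ℕ → ℝ → ℝ} {v : ℝ → ℝ}

theorem diffOp_high (d : ℕ) (u : ℕ → ℝ → ℝ) : ∀ k : ℤ, (d : ℤ) + 1 < k → diffOp d u k = 0 :=
  fun k hk => diffOp_eq_zero (by omega) (by omega) u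

theorem psiComm_schrodingerOp (k : ℤ) (x : ℝ) :
    psiComm (schrodingerOp v) (diffOp d u) k x =
      2 * deriv (diffOp d u (k - 1)) x + iteratedDeriv 2 (diffOp d u k) x + v x * diffOp d u k x -
      ∑ n ∈ Finset.range ((d : ℤ) + 2 - k).toNat,
        ((Ring.choose (k + n) n : ℤ) : ℝ) * diffOp d u (k + n) x * iteratedDeriv n v x := by
  rw [psiComm, Pi.sub_apply, Pi.sub_apply, psiMul_schrodingerOp_left,
    psiMul_schrodingerOp_right v (diffOp_high d u), show (d : ℤ) + 1 + 1 - k = d + 2 - k by ring]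
  ring

/-- A term with k + n ≥ 0 has n > k + n, so its binomial coefficient vanishes; for k + n < 0 the
coefficient of L is zero. -/
theorem psiComm_schrodingerOp_of_neg {k : ℤ} (hk : k < 0) (x : ℝ) :
    psiComm (schrodingerOp v) (diffOp d u) k x = 0 := by
  rw [psiComm_schrodingerOp, diffOp_eq_zero (k := k) (by omega) (by omega),
    diffOp_eq_zero (k := k - 1) (by omega) (by omega), Finset.sum_eq_zero]
  · simp [show (0 : ℝ → ℝ) = fun _ => 0 from rfl]
  · intro n _
    by_cases h : 0 ≤ k + n
    · obtain ⟨m, hm⟩ := Int.eq_ofNat_of_zero_le h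
      rw [hm, Ring.choose_natCast, Nat.choose_eq_zero_of_lt (by omega)]
      simp
    · rw [diffOp_eq_zero (k := k + n) (by omega) (by omega)]
      simp

/-- The coefficients of L in orders at least d are constant, so their derivatives drop out, and in
order d + 1 the two terms v cancel. The commutator thus has order at most d, low enough to be
determined by d + 1 independent functions. -/
theorem psiComm_schrodingerOp_of_gt {k : ℤ} (hk : (d : ℤ) < k) (x : ℝ) :
    psiComm (schrodingerOp v) (diffOp d u) k x = 0 := by
  have hconst : ∀ j : ℤ, (d : ℤ) ≤ j → ∃ c : ℝ, diffOp d u j = fun _ => c := fun j hj => by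
    by_cases h : j = d + 1
    · exact ⟨1, by rw [h, diffOp_top]; rfl⟩
    · exact ⟨0, by rw [diffOp_eq_zero h (by omega)]; rfl⟩
  obtain ⟨c, hc⟩ := hconst k hk.le
  obtain ⟨c', hc'⟩ := hconst (k - 1) (by omega)
  rw [psiComm_schrodingerOp, hc', hc]
  by_cases h : k = d + 1
  · rw [show ((d : ℤ) + 2 - k).toNat = 1 by omega]
    simp [iteratedDeriv_const, hc]
    ring
  · rw [diffOp_eq_zero h (by omega)] at hc
    have : c = 0 := (congrFun hc 0).symm
    rw [show ((d : ℤ) + 2 - k).toNat = 0 by omega]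
    simp [this]

/-- `[∂² + v, L] g = -L (g'' + v g)` if `L g = 0`, for scalar functions. -/
theorem sum_psiComm_schrodingerOp (hu : ∀ i < d, ContDiff ℝ ∞ (u i)) (hv : ContDiff ℝ ∞ v)
    {g : ℝ → ℝ} (hg : ContDiff ℝ ∞ g)
    (hLg : ∀ x, ∑ i ∈ Finset.range (d + 2), diffOp d u i x * iteratedDeriv i g x = 0) (x : ℝ) :
    ∑ k ∈ Finset.range (d + 2), psiComm (schrodingerOp v) (diffOp d u) k x * iteratedDeriv k g x =
      -∑ i ∈ Finset.range (d + 2), diffOp d u i x *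
        iteratedDeriv i (fun y => iteratedDeriv 2 g y + v y * g y) x := by
  set D : ℕ → ℝ → ℝ := fun i => diffOp d u i with hD
  have hDs : ∀ i, ContDiff ℝ ∞ (D i) := fun i => by
    by_cases h1 : i < d
    · rw [hD]; simp only; rw [diffOp_coe h1]; exact hu i h1
    · by_cases h2 : i = d + 1
      · have := diffOp_top d u
        rw [hD, h2]; push_cast; rw [this]; exact contDiff_const
      · rw [hD]; simp only; rw [diffOp_eq_zero (by omega) (by omega)]; exact contDiff_const
  have hgs : ∀ i, ContDiff ℝ ∞ (iteratedDeriv i g) := fun i => contDiff_iteratedDeriv hg i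
  -- the second derivative of `L g = 0`
  have E1 : ∑ i ∈ Finset.range (d + 2), (iteratedDeriv 2 (D i) x * iteratedDeriv i g x +
      2 * deriv (D i) x * iteratedDeriv (i + 1) g x + D i x * iteratedDeriv (i + 2) g x) = 0 := by
    have h1 : ∀ x, ∑ i ∈ Finset.range (d + 2),
        (deriv (D i) x * iteratedDeriv i g x + D i x * iteratedDeriv (i + 1) g x) = 0 := fun x => by
      have : HasDerivAt (fun x => ∑ i ∈ Finset.range (d + 2), D i x * iteratedDeriv i g x) _ x :=
        HasDerivAt.fun_sum fun i _ => (((hDs i).differentiable (by simp) x).hasDerivAt).mul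
          (hasDerivAt_iteratedDeriv hg i x)
      rw [show (fun x => ∑ i ∈ Finset.range (d + 2), D i x * iteratedDeriv i g x) = fun _ => 0 from
        funext hLg] at this
      exact this.unique (hasDerivAt_const x 0)
    have h2 : HasDerivAt (fun x => ∑ i ∈ Finset.range (d + 2),
        (deriv (D i) x * iteratedDeriv i g x + D i x * iteratedDeriv (i + 1) g x)) _ x :=
      HasDerivAt.fun_sum fun i _ =>
        ((by simpa [iteratedDeriv_one] using hasDerivAt_iteratedDeriv (hDs i) 1 x :
          HasDerivAt (deriv (D i)) (iteratedDeriv 2 (D i) x) x).mul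
            (hasDerivAt_iteratedDeriv hg i x)).add
          ((((hDs i).differentiable (by simp) x).hasDerivAt).mul
            (hasDerivAt_iteratedDeriv hg (i + 1) x))
    rw [funext h1] at h2
    rw [← h2.unique (hasDerivAt_const x 0)]
    refine Finset.sum_congr rfl fun i _ => ?_
    ring
  -- the Leibniz rule on the right-hand side
  have E2 : ∀ i : ℕ, iteratedDeriv i (fun y => iteratedDeriv 2 g y + v y * g y) x =
      iteratedDeriv (i + 2) g x + ∑ n ∈ Finset.range (i + 1),
        (i.choose n : ℝ) * iteratedDeriv n v x * iteratedDeriv (i - n) g x := fun i => by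
    have ht : (i : WithTop ℕ∞) ≤ ∞ := by exact_mod_cast le_top
    rw [iteratedDeriv_fun_add ((hgs 2).of_le ht).contDiffAt ((hv.mul hg).of_le ht).contDiffAt,
      iteratedDeriv_fun_mul (hv.of_le ht).contDiffAt (hg.of_le ht).contDiffAt]
    congr 1
    simp only [iteratedDeriv_eq_iterate, ← Function.iterate_add_apply]
  -- Both sides run over the triangle n ≤ i ≤ d + 1, with i = k + n.
  have E3 : ∑ k ∈ Finset.range (d + 2), (∑ n ∈ Finset.range ((d : ℤ) + 2 - k).toNat,
        ((Ring.choose ((k : ℤ) + n) n : ℤ) : ℝ) * diffOp d u (k + n) x * iteratedDeriv n v x) *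
          iteratedDeriv k g x =
      ∑ i ∈ Finset.range (d + 2), D i x * ∑ n ∈ Finset.range (i + 1),
        (i.choose n : ℝ) * iteratedDeriv n v x * iteratedDeriv (i - n) g x := by
    simp only [Finset.sum_mul, Finset.mul_sum]
    have := Finset.sum_range_diag_flip (d + 2) fun n k =>
      D (n + k) x * (((n + k).choose n : ℝ) * iteratedDeriv n v x * iteratedDeriv k g x)
    rw [Finset.sum_sigma'] at this ⊢
    trans ∑ k ∈ Finset.range (d + 2), ∑ n ∈ Finset.range (d + 2 - k),
      D (n + k) x * (((n + k).choose n : ℝ) * iteratedDeriv n v x * iteratedDeriv k g x)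
    · rw [Finset.sum_sigma']
      refine Finset.sum_congr ?_ fun p _ => ?_
      · congr 1
        ext k
        rw [show ((d : ℤ) + 2 - k).toNat = d + 2 - k by omega]
      · rw [show ((p.1 : ℤ) + p.2) = ((p.2 + p.1 : ℕ) : ℤ) by push_cast; ring,
          Ring.choose_natCast]
        simp only [hD, Int.cast_natCast]
        ring
    · rw [← Finset.sum_range_diag_flip (d + 2) fun k n =>
        D (n + k) x * (((n + k).choose n : ℝ) * iteratedDeriv n v x * iteratedDeriv k g x)]
      refine Finset.sum_congr rfl fun m _ => ?_
      rw [← Finset.sum_range_reflect]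
      refine Finset.sum_congr rfl fun n hn => ?_
      rw [Finset.mem_range] at hn
      rw [show m - (m + 1 - 1 - n) = n by omega, show m + 1 - 1 - n = m - n by omega,
        show n + (m - n) = m by omega]
  -- Index shift: L has no ∂^(-1) term, and its top coefficient is constant, so both boundary terms
  -- vanish.
  have E4 : ∑ k ∈ Finset.range (d + 2), 2 * deriv (diffOp d u ((k : ℤ) - 1)) x * iteratedDeriv k g x
      = ∑ i ∈ Finset.range (d + 2), 2 * deriv (D i) x * iteratedDeriv (i + 1) g x := by
    rw [Finset.sum_range_succ', Finset.sum_range_succ (n := d + 1)]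
    congr 1
    · refine Finset.sum_congr rfl fun i _ => ?_
      rw [show ((i + 1 : ℕ) : ℤ) - 1 = i by push_cast; ring]
    · rw [diffOp_eq_zero (k := ((0 : ℕ) : ℤ) - 1) (by simp; omega) (by simp)]
      have : D (d + 1) = fun _ => 1 := by
        have := diffOp_top d u
        rw [hD]; push_cast; rw [this]; rfl
      rw [this]
      simp
  have E5 := hLg x
  simp only [psiComm_schrodingerOp, sub_mul, add_mul, Finset.sum_sub_distrib,
    Finset.sum_add_distrib, E2, mul_add] at E1 ⊢
  rw [E3, E4]
  have E6 : ∑ k ∈ Finset.range (d + 2), v x * diffOp d u k x * iteratedDeriv k g x = 0 := by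
    simp only [mul_assoc]
    rw [← Finset.mul_sum, E5, mul_zero]
  rw [E6]
  linarith

variable {Γ : ℝ → Fin (d + 1) → ℝ}

theorem sum_diffOp_smul (f : ℝ → Fin (d + 1) → ℝ) (x : ℝ) :
    ∑ i ∈ Finset.range (d + 2), diffOp d u i x • iteratedDeriv i f x =
      iteratedDeriv (d + 1) f x + ∑ i ∈ Finset.range d, u i x • iteratedDeriv i f x := by
  rw [Finset.sum_range_succ, Finset.sum_range_succ]
  have h1 := congrFun (diffOp_top d u) x
  rw [diffOp_eq_zero (k := (d : ℤ)) (by omega) (by omega)]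
  push_cast
  rw [h1, Pi.zero_apply, Pi.one_apply, zero_smul, one_smul, add_zero, add_comm (Finset.sum _ _)]
  congr 1
  refine Finset.sum_congr rfl fun i hi => ?_
  rw [diffOp_coe (Finset.mem_range.1 hi)]

/-- If a variation of the coefficients of `L` satisfies `(δL) Γ + L (Γ'' + v Γ) = 0`, then
`δL = [∂² + v, L]`. -/
theorem psiComm_eq_of_variation (hu : ∀ i < d, ContDiff ℝ ∞ (u i)) (hv : ContDiff ℝ ∞ v)
    (hΓ : ContDiff ℝ ∞ Γ)
    (hLΓ : ∀ x, iteratedDeriv (d + 1) Γ x + ∑ i ∈ Finset.range d, u i x • iteratedDeriv i Γ x = 0)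
    {x : ℝ} (hW : wronskian Γ x ≠ 0) {w : ℕ → ℝ}
    (hw : ∑ i ∈ Finset.range d, w i • iteratedDeriv i Γ x +
      (iteratedDeriv (d + 1) (fun y => iteratedDeriv 2 Γ y + v y • Γ y) x +
        ∑ i ∈ Finset.range d, u i x •
          iteratedDeriv i (fun y => iteratedDeriv 2 Γ y + v y • Γ y) x) = 0) (k : ℤ) :
    psiComm (schrodingerOp v) (diffOp d u) k x = if 0 ≤ k ∧ k < d then w k.toNat else 0 := by
  have hvec : ∑ k ∈ Finset.range (d + 2),
      psiComm (schrodingerOp v) (diffOp d u) k x • iteratedDeriv k Γ x =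
        ∑ i ∈ Finset.range d, w i • iteratedDeriv i Γ x := by
    rw [eq_neg_of_add_eq_zero_left hw, ← sum_diffOp_smul]
    ext j
    have hs : ContDiff ℝ ∞ fun y => Γ y j := contDiff_pi.1 hΓ j
    have hq : ContDiff ℝ ∞ fun y => iteratedDeriv 2 Γ y + v y • Γ y :=
      (contDiff_iteratedDeriv hΓ 2).add (hv.smul hΓ)
    have := sum_psiComm_schrodingerOp (d := d) hu hv hs (fun y => by
      have := congrFun ((sum_diffOp_smul Γ y).trans (hLΓ y)) j
      simpa [Finset.sum_apply, iteratedDeriv_component hΓ] using this) x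
    simp only [Finset.sum_apply, Pi.smul_apply, Pi.neg_apply, smul_eq_mul,
      iteratedDeriv_component hΓ, iteratedDeriv_component hq]
    rw [this]
    simp only [Pi.add_apply, Pi.smul_apply, smul_eq_mul, iteratedDeriv_component hΓ]
  by_cases hk0 : k < 0
  · rw [psiComm_schrodingerOp_of_neg hk0, if_neg (by omega)]
  by_cases hkd : (d : ℤ) < k
  · rw [psiComm_schrodingerOp_of_gt hkd, if_neg (by omega)]
  have htop : psiComm (schrodingerOp v) (diffOp d u) ((d + 1 : ℕ) : ℤ) x = 0 :=
    psiComm_schrodingerOp_of_gt (by push_cast; omega) x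
  rw [Finset.sum_range_succ, htop, zero_smul, add_zero,
    ← Fin.sum_univ_eq_sum_range (fun k =>
      psiComm (schrodingerOp v) (diffOp d u) k x • iteratedDeriv k Γ x)] at hvec
  -- Padding w by 0 at index d lets independence of the full frame also kill the ∂^d coefficient of
  -- the commutator.
  have hvec' : ∑ i ∈ Finset.range d, w i • iteratedDeriv i Γ x =
      ∑ k : Fin (d + 1), (if (k : ℕ) < d then w k else 0) • iteratedDeriv (k : ℕ) Γ x := by
    rw [Fin.sum_univ_eq_sum_range (fun k => (if k < d then w k else 0) • iteratedDeriv k Γ x),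
      Finset.sum_range_succ, if_neg (by simp), zero_smul, add_zero]
    refine Finset.sum_congr rfl fun i hi => ?_
    rw [if_pos (Finset.mem_range.1 hi)]
  lift k to ℕ using (by omega)
  have := congrFun (coef_unique hW (a := fun k : Fin (d + 1) =>
    psiComm (schrodingerOp v) (diffOp d u) (k : ℕ) x) (hvec.trans hvec')) ⟨k, by omega⟩
  simp only at this
  rw [this]
  simp

end Commutator

/-! ### From the evolution of curves to the KdV equation -/

section Evolution

variable {d : ℕ}

theorem applyOp_schrodingerOp (v : ℝ → ℝ) (Γ : ℝ → Fin (d + 1) → ℝ) (x : ℝ) :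
    applyOp (schrodingerOp v) Γ x = iteratedDeriv 2 Γ x + v x • Γ x := by
  rw [applyOp, finsum_eq_sum_of_support_subset (s := {2, 0})]
  · rw [Finset.sum_insert (by simp), Finset.sum_singleton]
    simp [schrodingerOp]
  · intro k hk
    rw [Function.mem_support] at hk
    by_contra h
    simp only [Finset.coe_insert, Finset.coe_singleton, mem_insert_iff, mem_singleton_iff,
      not_or] at h
    exact hk (by rw [schrodingerOp_of_ne v (by omega) (by omega), zero_smul])

theorem kdvQ_eq_schrodingerOp (hd : 2 ≤ d) {u : ℕ → ℝ → ℝ} (hs : ∀ i < d, ContDiff ℝ ∞ (u i))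
    (hp : ∀ i < d, Function.Periodic (u i) (2 * Real.pi)) :
    kdvQ 2 d u = schrodingerOp fun x => 2 / ((d : ℝ) + 1) * u (d - 1) x := by
  ext k x
  rw [kdvQ_two hd hs hp, schrodingerOp]

/-- The evolution `dΓ/dt = Q_2 Γ` of curves induces the KdV evolution of their operators. -/
theorem solvesKdV_of_evolution (hd : 2 ≤ d) {a b : ℝ} {G : ℝ → ℝ → Fin (d + 1) → ℝ}
    {w : ℝ → ℕ → ℝ → ℝ} (hG : SmoothFamily (Ioo a b) G)
    (h : ∀ t ∈ Ioo a b, (∀ x, wronskian (G t) x ≠ 0) ∧ IsCurveOperator (G t) (w t) ∧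
      ∀ x, HasDerivAt (fun s => G s x) (applyOp (kdvQ 2 d (w t)) (G t) x) t) :
    SolvesKdV 2 d (Ioo a b) w := by
  intro t ht k x
  have hW : ∀ s ∈ Ioo a b, ∀ y, wronskian (G s) y ≠ 0 := fun s hs => (h s hs).1
  obtain ⟨-, hop, hev⟩ := h t ht
  -- Smoothness of the coefficients in t is not assumed; it follows because the curve determines
  -- them.
  have hwc : ∀ s ∈ Ioo a b, ∀ i < d, ∀ y, w s i y = curveCoeff (G s) i y := fun s hs i hi y =>
    eq_curveCoeff (hW s hs y) ((h s hs).2.1.equation y) hi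
  have hw : ∀ i < d, SmoothFamily (Ioo a b) fun s y => w s i y := fun i hi =>
    (hG.curveCoeff isOpen_Ioo hW i).congr fun s hs y => hwc s hs i hi y
  have hq := kdvQ_eq_schrodingerOp hd hop.smooth hop.periodic
  rw [hq] at hev ⊢
  set v : ℝ → ℝ := fun x => 2 / ((d : ℝ) + 1) * w t (d - 1) x with hvdef
  have hv : ContDiff ℝ ∞ v := contDiff_const.mul (hop.smooth (d - 1) (by omega))
  have hdt : (fun y => deriv (fun s => G s y) t) = fun y => iteratedDeriv 2 (G t) y + v y • G t y :=
    funext fun y => by rw [(hev y).deriv, applyOp_schrodingerOp]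
  have hiter : ∀ j x, HasDerivAt (fun s => iteratedDeriv j (G s) x)
      (iteratedDeriv j (fun y => iteratedDeriv 2 (G t) y + v y • G t y) x) t := fun j x => by
    rw [← hdt]
    exact hG.hasDerivAt_iteratedDeriv isOpen_Ioo j ht x
  have hwd : ∀ i < d, HasDerivAt (fun s => w s i x) (deriv (fun s => w s i x) t) t := fun i hi =>
    ((hw i hi).differentiableAt_fst isOpen_Ioo ht x).hasDerivAt
  have hsum : HasDerivAt (fun s => iteratedDeriv (d + 1) (G s) x +
      ∑ i ∈ Finset.range d, w s i x • iteratedDeriv i (G s) x) _ t :=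
    (hiter (d + 1) x).add (HasDerivAt.fun_sum fun i hi =>
      (hwd i (Finset.mem_range.1 hi)).smul (hiter i x))
  have hzero : (fun s => iteratedDeriv (d + 1) (G s) x +
      ∑ i ∈ Finset.range d, w s i x • iteratedDeriv i (G s) x) =ᶠ[𝓝 t] fun _ => 0 := by
    filter_upwards [isOpen_Ioo.mem_nhds ht] with s hs using (h s hs).2.1.equation x
  -- This is the t-derivative of LΓ = 0, that is (dL/dt)Γ + L Q_2 Γ = 0.
  have hvar := hsum.unique ((hasDerivAt_const t 0).congr_of_eventuallyEq hzero)
  rw [psiComm_eq_of_variation hop.smooth hv (hG.contDiff ht) hop.equation (hW t ht x)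
    (w := fun i => deriv (fun s => w s i x) t)]
  · unfold diffOp
    split_ifs with h1 h2 h2
    · omega
    · exact hasDerivAt_const _ _
    · exact hwd _ (by omega)
    · exact hasDerivAt_const _ _
  · rw [← hvar, Finset.sum_add_distrib]
    abel

end Evolution

/-! ### The limiting configuration on the moment curve -/

section MomentCurve

open Polynomial

/-- The centred nodes `k - (d-1)/2`, `0 ≤ k < d`. -/
def centre (d : ℕ) (k : Fin d) : ℝ := (k : ℝ) - ((d : ℝ) - 1) / 2

/-- The parameters of the vertices of the `k`-th short-diagonal hyperplane. -/
def node (d : ℕ) (k l : Fin d) : ℝ := centre d k + 2 * centre d l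

theorem centre_injective (d : ℕ) : Function.Injective (centre d) := fun a b h => by
  unfold centre at h
  exact Fin.ext (by exact_mod_cast sub_left_injective h)

theorem node_injective (d : ℕ) (k : Fin d) : Function.Injective (node d k) := fun a b h => by
  refine centre_injective d ?_
  unfold node at h
  linarith

theorem centre_rev (d : ℕ) (k : Fin d) : centre d k.rev = -centre d k := by
  unfold centre
  rw [Fin.val_rev, Nat.cast_sub (by omega)]
  push_cast
  ring

theorem node_rev (d : ℕ) (k l : Fin d) : node d k.rev l.rev = -node d k l := by
  unfold node
  rw [centre_rev, centre_rev]
  ring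

theorem sum_centre (d : ℕ) : ∑ k, centre d k = 0 := by
  have h : ∑ k, centre d k = ∑ k, centre d (Fin.rev k) := (Equiv.sum_comp Fin.revPerm _).symm
  simp only [centre_rev, Finset.sum_neg_distrib] at h
  linarith

theorem sum_centre_sq_pos {d : ℕ} (hd : 2 ≤ d) : 0 < ∑ k, centre d k ^ 2 := by
  refine Finset.sum_pos' (fun _ _ => sq_nonneg _) ⟨⟨0, by omega⟩, Finset.mem_univ _, ?_⟩
  have : (2 : ℝ) ≤ d := by exact_mod_cast hd
  have h : centre d ⟨0, by omega⟩ ≠ 0 := by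
    unfold centre
    simp only [Nat.cast_zero, zero_sub, ne_eq, neg_eq_zero]
    linarith
  positivity

/-- Vieta for the top three coefficients, with 2e₂ = p₁² - p₂ expressing the third through power
sums. -/
theorem coeff_prod_X_sub_C {ι : Type*} [DecidableEq ι] (s : Finset ι) (f : ι → ℝ) :
    (∏ i ∈ s, (X - C (f i))).coeff s.card = 1 ∧
    (∀ m, m + 1 = s.card → (∏ i ∈ s, (X - C (f i))).coeff m = -∑ i ∈ s, f i) ∧
    (∀ m, m + 2 = s.card → 2 * (∏ i ∈ s, (X - C (f i))).coeff m =
      (∑ i ∈ s, f i) ^ 2 - ∑ i ∈ s, f i ^ 2) := by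
  have hhigh : ∀ t : Finset ι, ∀ m, t.card < m → (∏ i ∈ t, (X - C (f i))).coeff m = 0 :=
    fun t m hm => coeff_eq_zero_of_natDegree_lt (by rwa [natDegree_finsetProd_X_sub_C_eq_card])
  induction s using Finset.induction_on with
  | empty => simp
  | insert a s ha ih =>
    obtain ⟨h0, h1, h2⟩ := ih
    rw [Finset.card_insert_of_notMem ha, Finset.prod_insert ha, Finset.sum_insert ha,
      Finset.sum_insert ha]
    simp only [sub_mul, coeff_sub, coeff_C_mul]
    refine ⟨?_, fun m hm => ?_, fun m hm => ?_⟩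
    · rw [coeff_X_mul, h0, hhigh s _ (Nat.lt_succ_self _)]
      ring
    · obtain rfl : m = s.card := by omega
      rw [h0]
      rcases Nat.eq_zero_or_pos s.card with h | h
      · rw [h, mul_coeff_zero]
        rw [Finset.card_eq_zero] at h
        simp [h]
      · obtain ⟨n, hn⟩ := Nat.exists_eq_succ_of_ne_zero h.ne'
        rw [hn, coeff_X_mul, h1 n (by omega)]
        ring
    · have h1' := h1 m (by omega)
      rw [h1']
      rcases Nat.eq_zero_or_pos m with h | h
      · subst h
        obtain ⟨b, rfl⟩ := Finset.card_eq_one.1 (show s.card = 1 by omega)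
        rw [mul_coeff_zero]
        simp
        ring
      · obtain ⟨n, rfl⟩ := Nat.exists_eq_succ_of_ne_zero h.ne'
        have h2' := h2 n (by omega)
        rw [coeff_X_mul]
        linear_combination h2'

/-- The monic polynomial with roots `2 c_l`, where the `c_l` are the centred nodes. -/
def nodePoly (d : ℕ) : ℝ[X] := ∏ l : Fin d, (X - C (2 * centre d l))

theorem nodePoly_coeff_self (d : ℕ) : (nodePoly d).coeff d = 1 := by
  have h := (coeff_prod_X_sub_C Finset.univ fun l : Fin d => 2 * centre d l).1
  rwa [Finset.card_univ, Fintype.card_fin] at h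

theorem nodePoly_coeff_of_gt {d m : ℕ} (h : d < m) : (nodePoly d).coeff m = 0 := by
  refine coeff_eq_zero_of_natDegree_lt ?_
  rw [nodePoly, natDegree_finsetProd_X_sub_C_eq_card]
  simpa using h

/-- The nodes of the k-th hyperplane are one fixed set translated by c_k, so a single polynomial
describes all d hyperplanes. -/
theorem prod_node_eq_taylor (d : ℕ) (k : Fin d) :
    ∏ l : Fin d, (X - C (node d k l)) = taylor (-centre d k) (nodePoly d) := by
  rw [taylor_apply, nodePoly, prod_comp]
  refine Finset.prod_congr rfl fun l _ => ?_
  simp only [node, sub_comp, X_comp, C_comp, C_neg, C_add]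
  ring

/-- A kernel vector would give a polynomial of degree below d with d distinct roots. -/
theorem det_moment_ne_zero (d : ℕ) (k : Fin d) :
    (Matrix.of fun l i : Fin d => node d k l ^ (i : ℕ) / ((i : ℕ).factorial : ℝ)).det ≠ 0 := by
  intro hdet
  obtain ⟨a, ha, haz⟩ := Matrix.exists_mulVec_eq_zero_iff.2 hdet
  refine ha ?_
  have hp : ∑ i : Fin d, C (a i / ((i : ℕ).factorial : ℝ)) * X ^ (i : ℕ) = (0 : ℝ[X]) := by
    refine eq_zero_of_degree_lt_of_eval_index_eq_zero Finset.univ (v := node d k)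
      (node_injective d k).injOn (by simpa using degree_sum_fin_lt _) fun l _ => ?_
    have := congrFun haz l
    simp only [Matrix.mulVec, dotProduct, Matrix.of_apply, Pi.zero_apply] at this
    simp only [eval_finsetSum, eval_mul, eval_C, eval_pow, eval_X]
    rw [← this]
    exact Finset.sum_congr rfl fun i _ => by ring
  ext i
  have h := congrArg (fun p => p.coeff (i : ℕ)) hp
  simp only [finsetSum_coeff, coeff_C_mul, coeff_X_pow, coeff_zero, Fin.val_inj, mul_ite,
    mul_one, mul_zero, Finset.sum_ite_eq, Finset.mem_univ, if_true] at h
  exact (div_eq_zero_iff.1 h).resolve_right (by positivity)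

/-- The polynomial ∑ N_i s^i / i! vanishes at the d nodes, and the last entry d! makes it monic, so
it is φ(s - c_k). Its Taylor coefficients at 0 give the entries. -/
theorem moment_covector {d : ℕ} {k : Fin d} {N : Fin (d + 1) → ℝ}
    (hN : N (Fin.last d) = d.factorial)
    (h : ∀ l, ∑ i, N i * (node d k l ^ (i : ℕ) / ((i : ℕ).factorial : ℝ)) = 0)
    (i : Fin (d + 1)) : N i = (derivative^[i] (nodePoly d)).eval (-centre d k) := by
  set p : ℝ[X] := ∑ i : Fin (d + 1), C (N i / ((i : ℕ).factorial : ℝ)) * X ^ (i : ℕ) with hp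
  have hcoeff : ∀ i : Fin (d + 1), p.coeff i = N i / ((i : ℕ).factorial : ℝ) := fun i => by
    simp only [hp, finsetSum_coeff, coeff_C_mul, coeff_X_pow, Fin.val_inj, mul_ite,
      mul_one, mul_zero, Finset.sum_ite_eq, Finset.mem_univ, if_true]
  have hpφ : p = ∏ l : Fin d, (X - C (node d k l)) := by
    refine eq_of_degree_sub_lt_of_eval_index_eq Finset.univ (v := node d k)
      (node_injective d k).injOn ?_ fun l _ => ?_
    · rw [Finset.card_univ, Fintype.card_fin, degree_lt_iff_coeff_zero]
      intro m hm
      rw [coeff_sub]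
      rcases hm.eq_or_lt with rfl | hm
      · have h1 := (coeff_prod_X_sub_C Finset.univ (node d k)).1
        rw [Finset.card_univ, Fintype.card_fin] at h1
        have h2 := hcoeff (Fin.last d)
        rw [hN, Fin.val_last, div_self (by positivity)] at h2
        rw [h1, h2, sub_self]
      · have h2 : p.coeff m = 0 := coeff_eq_zero_of_degree_lt
          ((degree_sum_fin_lt _).trans_le (by exact_mod_cast hm))
        rw [h2, coeff_eq_zero_of_natDegree_lt, sub_self]
        rw [natDegree_finsetProd_X_sub_C_eq_card]
        simpa using hm
    · rw [eval_prod, Finset.prod_eq_zero (Finset.mem_univ l) (by simp)]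
      simp only [hp, eval_finsetSum, eval_mul, eval_C, eval_pow, eval_X]
      rw [← h l]
      exact Finset.sum_congr rfl fun i _ => by ring
  have h1 := hcoeff i
  rw [hpφ, prod_node_eq_taylor, taylor_coeff] at h1
  have h2 : (derivative^[i] (nodePoly d)).eval (-centre d k) =
      ((i : ℕ).factorial : ℝ) * (hasseDeriv i (nodePoly d)).eval (-centre d k) := by
    rw [← factorial_smul_hasseDeriv]
    simp
  rw [h2, h1, mul_div_cancel₀ _ (by positivity)]

/-- The coefficients of `∑ q_i φ^(i)`. -/
theorem coeff_sum_derivative {d : ℕ} (q : Fin (d + 1) → ℝ) (m : ℕ) :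
    (∑ i : Fin (d + 1), C (q i) * derivative^[i] (nodePoly d)).coeff m =
      ∑ i : Fin (d + 1), q i * ((m + i).descFactorial i * (nodePoly d).coeff (m + i)) := by
  simp only [finsetSum_coeff, coeff_C_mul, coeff_iterate_derivative, nsmul_eq_mul]

/-- A kernel vector gives a combination of φ', …, φ^(d), of degree below d, that vanishes at the d
points -c_k and is therefore zero. These derivatives have distinct degrees, so the vector is zero.
-/
theorem det_momentCovector_ne_zero {d : ℕ} {N : Fin d → Fin (d + 1) → ℝ}
    (hN : ∀ k i, N k i = (derivative^[i] (nodePoly d)).eval (-centre d k)) :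
    (Matrix.of fun k i : Fin d => N k i.succ).det ≠ 0 := by
  intro hdet
  obtain ⟨a, ha, haz⟩ := Matrix.exists_mulVec_eq_zero_iff.2 hdet
  refine ha ?_
  set q : Fin (d + 1) → ℝ := Fin.cons 0 a with hq
  have hS : ∑ i : Fin (d + 1), C (q i) * derivative^[i] (nodePoly d) = 0 := by
    refine eq_zero_of_degree_lt_of_eval_index_eq_zero Finset.univ (v := fun k => -centre d k)
      (neg_injective.comp (centre_injective d)).injOn ?_ fun k _ => ?_
    · rw [Finset.card_univ, Fintype.card_fin, degree_lt_iff_coeff_zero]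
      intro m hm
      rw [coeff_sum_derivative]
      refine Finset.sum_eq_zero fun i _ => ?_
      refine Fin.cases ?_ (fun i => ?_) i
      · simp [hq]
      · rw [nodePoly_coeff_of_gt (by simp; omega)]
        simp
    · have := congrFun haz k
      simp only [Matrix.mulVec, dotProduct, Matrix.of_apply, Pi.zero_apply, hN] at this
      simp only [eval_finsetSum, eval_mul, eval_C]
      rw [Fin.sum_univ_succ, ← this]
      simp only [hq, Fin.cons_zero, zero_mul, zero_add, Fin.cons_succ]
      exact Finset.sum_congr rfl fun i _ => by ring
  have hq0 : ∀ n : ℕ, ∀ i : Fin (d + 1), (i : ℕ) = n → q i = 0 := by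
    intro n
    induction n using Nat.strong_induction_on with
    | _ n ih =>
      intro i hi
      have h := congrArg (fun p => p.coeff (d - n)) hS
      simp only [coeff_sum_derivative, coeff_zero] at h
      rw [Finset.sum_eq_single i] at h
      · rw [show d - n + (i : ℕ) = d by omega, nodePoly_coeff_self, mul_one] at h
        refine (mul_eq_zero.1 h).resolve_right ?_
        have : 0 < d.descFactorial i := Nat.pos_of_ne_zero fun h0 => by
          rw [Nat.descFactorial_eq_zero_iff_lt] at h0
          omega
        positivity
      · intro j _ hj
        rcases lt_or_gt_of_ne (fun h => hj (Fin.ext h) : (j : ℕ) ≠ i) with h | h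
        · rw [ih j (by omega) j rfl, zero_mul]
        · rw [nodePoly_coeff_of_gt (by omega)]
          simp
      · simp
  ext i
  have := hq0 _ i.succ rfl
  simpa [hq] using this

/-- The constant in front of the `(2, d+1)`-KdV flow. -/
def limitConst (d : ℕ) : ℝ := 3 * (∑ k, centre d k ^ 2) / (2 * (d * (d - 1)))

theorem limitConst_pos {d : ℕ} (hd : 2 ≤ d) : 0 < limitConst d := by
  have h2 : (2 : ℝ) ≤ d := by exact_mod_cast hd
  have := sum_centre_sq_pos hd
  have h3 : (0 : ℝ) < d - 1 := by linarith
  unfold limitConst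
  positivity

/-- The intersection point for the moment curve. -/
theorem moment_point {d : ℕ} (hd : 2 ≤ d) {N : Fin d → Fin (d + 1) → ℝ}
    (hN : ∀ k i, N k i = (derivative^[i] (nodePoly d)).eval (-centre d k))
    {q : Fin (d + 1) → ℝ} (hq0 : q 0 = 1) (hq : ∀ k, ∑ i, N k i * q i = 0) :
    q ⟨1, by omega⟩ = 0 ∧ q ⟨2, by omega⟩ = limitConst d := by
  -- Both sides are monic of degree d, the left one because q_0 = 1, and both vanish at the d points
  -- -c_k.
  have hS : ∑ i : Fin (d + 1), C (q i) * derivative^[i] (nodePoly d) =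
      ∏ k : Fin d, (X - C (-centre d k)) := by
    refine eq_of_degree_sub_lt_of_eval_index_eq Finset.univ (v := fun k => -centre d k)
      (neg_injective.comp (centre_injective d)).injOn ?_ fun k _ => ?_
    · rw [Finset.card_univ, Fintype.card_fin, degree_lt_iff_coeff_zero]
      intro m hm
      rw [coeff_sub, coeff_sum_derivative, Fin.sum_univ_succ, Finset.sum_eq_zero, hq0]
      · rcases hm.eq_or_lt with rfl | hm
        · have h1 := (coeff_prod_X_sub_C Finset.univ fun k => -centre d k).1
          rw [Finset.card_univ, Fintype.card_fin] at h1
          rw [h1]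
          simp [nodePoly_coeff_self]
        · rw [coeff_eq_zero_of_natDegree_lt (p := ∏ k : Fin d, (X - C (-centre d k)))]
          · simp [nodePoly_coeff_of_gt hm]
          · rw [natDegree_finsetProd_X_sub_C_eq_card]
            simpa using hm
      · intro i _
        rw [nodePoly_coeff_of_gt (by simp; omega)]
        simp
    · rw [eval_prod, Finset.prod_eq_zero (Finset.mem_univ k) (by simp)]
      simp only [eval_finsetSum, eval_mul, eval_C]
      rw [← hq k]
      exact Finset.sum_congr rfl fun i _ => by rw [hN]; ring
  obtain ⟨n, rfl⟩ : ∃ n, d = n + 2 := ⟨d - 2, by omega⟩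
  have hc0 := sum_centre (n + 2)
  obtain ⟨-, a1, a2⟩ := coeff_prod_X_sub_C Finset.univ fun l : Fin (n + 2) => 2 * centre (n + 2) l
  obtain ⟨-, b1, b2⟩ := coeff_prod_X_sub_C Finset.univ fun l : Fin (n + 2) => -centre (n + 2) l
  rw [← nodePoly] at a1 a2
  have hcard : (Finset.univ : Finset (Fin (n + 2))).card = n + 2 := by simp
  have a1' := a1 (n + 1) (by rw [hcard])
  have a2' := a2 n (by rw [hcard])
  have b1' := b1 (n + 1) (by rw [hcard])
  have b2' := b2 n (by rw [hcard])
  simp only [mul_pow, ← Finset.mul_sum, hc0, Finset.sum_neg_distrib, neg_sq] at a1' a2' b1' b2'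
  -- Since ∑ c_k = 0, the coefficient of X^(d-1) gives d·q_1 = 0. That of X^(d-2) gives e₂(2c) +
  -- d(d-1) q_2 = e₂(c), with e₂(c) = -½∑c_k².
  have e1 := congrArg (fun p => p.coeff (n + 1)) hS
  have e2 := congrArg (fun p => p.coeff n) hS
  simp only [coeff_sum_derivative] at e1 e2
  rw [b1', Fin.sum_univ_succ, Fin.sum_univ_succ, Finset.sum_eq_zero] at e1
  swap
  · intro i _
    rw [nodePoly_coeff_of_gt (by simp; omega)]
    simp
  rw [Fin.sum_univ_succ, Fin.sum_univ_succ, Fin.sum_univ_succ, Finset.sum_eq_zero] at e2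
  swap
  · intro i _
    rw [nodePoly_coeff_of_gt (by simp)]
    simp
  have s0 : (nodePoly (n + 2)).coeff (n + 2) = 1 := nodePoly_coeff_self _
  have f1 : (Fin.succ 0 : Fin (n + 2 + 1)) = ⟨1, by omega⟩ := rfl
  have f2 : (Fin.succ (Fin.succ 0) : Fin (n + 2 + 1)) = ⟨2, by omega⟩ := rfl
  rw [f1, hq0] at e1
  rw [f2, f1, hq0] at e2
  simp only [Fin.val_zero, Nat.descFactorial_zero, add_zero, Nat.cast_one, one_mul, a1',
    show n + 1 + 1 = n + 2 from rfl, s0, mul_zero, neg_zero, zero_add, mul_one,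
    Nat.descFactorial_succ] at e1 e2
  have hq1 : q ⟨1, by omega⟩ = 0 := by
    refine (mul_eq_zero.1 e1).resolve_right ?_
    push_cast
    positivity
  refine ⟨hq1, ?_⟩
  rw [Nat.sub_zero, show n + 2 - 1 = n + 1 from rfl] at e2
  unfold limitConst
  have hn : (n : ℝ) + 1 ≠ 0 := by positivity
  have hn2 : (n : ℝ) + 2 ≠ 0 := by positivity
  have hden : (2 : ℝ) * (((n + 2 : ℕ) : ℝ) * (((n + 2 : ℕ) : ℝ) - 1)) ≠ 0 := by
    push_cast
    rw [show (n : ℝ) + 2 - 1 = n + 1 by ring]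
    positivity
  rw [eq_div_iff hden]
  norm_num at e2 a2' b2'
  push_cast at e2 ⊢
  linear_combination 2 * e2 - a2' + b2'

end MomentCurve

/-! ### Hyperplanes through d points and intersections of d hyperplanes -/

section Configuration

open Module

variable {d : ℕ}

/-- The first `d` coordinates of `d` vectors. -/
def baseMatrix (V : Fin d → Fin (d + 1) → ℝ) : Matrix (Fin d) (Fin d) ℝ :=
  Matrix.of fun l i => V l i.castSucc

/-- The covector with last entry `d!` that annihilates the vectors `V l`. -/
def covector (V : Fin d → Fin (d + 1) → ℝ) : Fin (d + 1) → ℝ :=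
  Fin.snoc ((baseMatrix V)⁻¹.mulVec fun l => -(d.factorial * V l (Fin.last d)))
    (d.factorial : ℝ)

/-- The last `d` coordinates of `d` covectors. -/
def meetMatrix (N : Fin d → Fin (d + 1) → ℝ) : Matrix (Fin d) (Fin d) ℝ :=
  Matrix.of fun k i => N k i.succ

/-- The vector with first entry `1` that is annihilated by the covectors `N k`. -/
def meetPoint (N : Fin d → Fin (d + 1) → ℝ) : Fin (d + 1) → ℝ :=
  Fin.cons 1 ((meetMatrix N)⁻¹.mulVec fun k => -N k 0)

theorem covector_last (V : Fin d → Fin (d + 1) → ℝ) : covector V (Fin.last d) = d.factorial :=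
  Fin.snoc_last _ _

theorem meetPoint_zero (N : Fin d → Fin (d + 1) → ℝ) : meetPoint N 0 = 1 := rfl

theorem covector_dot {V : Fin d → Fin (d + 1) → ℝ} (h : (baseMatrix V).det ≠ 0) (l : Fin d) :
    ∑ i, covector V i * V l i = 0 := by
  have := congrFun (Matrix.mulVec_mulVec (fun l => -(d.factorial * V l (Fin.last d)))
    (baseMatrix V) (baseMatrix V)⁻¹) l
  rw [Matrix.mul_nonsing_inv _ (isUnit_iff_ne_zero.2 h), Matrix.one_mulVec] at this
  rw [Fin.sum_univ_castSucc, covector_last]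
  refine add_eq_zero_iff_eq_neg.2 (Eq.trans ?_ this)
  simp only [Matrix.mulVec, dotProduct, baseMatrix, Matrix.of_apply, covector, Fin.snoc_castSucc]
  exact Finset.sum_congr rfl fun i _ => mul_comm _ _

theorem meetPoint_dot {N : Fin d → Fin (d + 1) → ℝ} (h : (meetMatrix N).det ≠ 0) (k : Fin d) :
    ∑ i, N k i * meetPoint N i = 0 := by
  have := congrFun (Matrix.mulVec_mulVec (fun k => -N k 0) (meetMatrix N) (meetMatrix N)⁻¹) k
  rw [Matrix.mul_nonsing_inv _ (isUnit_iff_ne_zero.2 h), Matrix.one_mulVec] at this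
  rw [Fin.sum_univ_succ, meetPoint_zero, mul_one, add_comm]
  refine eq_neg_iff_add_eq_zero.1 (Eq.trans ?_ this)
  simp only [Matrix.mulVec, dotProduct, meetMatrix, Matrix.of_apply, meetPoint, Fin.cons_succ]

/-- The homogeneous case serves twice: for uniqueness of the normalized covector, and for its
ε-derivative, whose last entry is zero. `eq_zero_of_meet` plays the same roles for the intersection
point. -/
theorem eq_zero_of_covector {V : Fin d → Fin (d + 1) → ℝ} (h : (baseMatrix V).det ≠ 0)
    {a : Fin (d + 1) → ℝ} (ha : a (Fin.last d) = 0) (haV : ∀ l, ∑ i, a i * V l i = 0) : a = 0 := by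
  have h1 : (fun i : Fin d => a i.castSucc) = 0 := by
    refine Matrix.eq_zero_of_mulVec_eq_zero h (funext fun l => ?_)
    have := haV l
    rw [Fin.sum_univ_castSucc, ha, zero_mul, add_zero] at this
    simp only [mul_comm (a _)] at this
    exact this
  ext i
  exact Fin.lastCases ha (fun i => congrFun h1 i) i

theorem eq_zero_of_meet {N : Fin d → Fin (d + 1) → ℝ} (h : (meetMatrix N).det ≠ 0)
    {a : Fin (d + 1) → ℝ} (ha : a 0 = 0) (haN : ∀ k, ∑ i, N k i * a i = 0) : a = 0 := by
  have h1 : (fun i : Fin d => a i.succ) = 0 := by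
    refine Matrix.eq_zero_of_mulVec_eq_zero h (funext fun k => ?_)
    have := haN k
    rw [Fin.sum_univ_succ, ha, mul_zero, zero_add] at this
    exact Eq.trans rfl this
  ext i
  exact Fin.cases ha (fun i => congrFun h1 i) i

theorem eq_covector {V : Fin d → Fin (d + 1) → ℝ} (h : (baseMatrix V).det ≠ 0)
    {a : Fin (d + 1) → ℝ} (ha : a (Fin.last d) = d.factorial)
    (haV : ∀ l, ∑ i, a i * V l i = 0) : a = covector V := by
  rw [← sub_eq_zero]
  refine eq_zero_of_covector h (by rw [Pi.sub_apply, ha, covector_last, sub_self]) fun l => ?_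
  simp only [Pi.sub_apply, sub_mul, Finset.sum_sub_distrib, haV l, covector_dot h, sub_self]

theorem eq_meetPoint {N : Fin d → Fin (d + 1) → ℝ} (h : (meetMatrix N).det ≠ 0)
    {a : Fin (d + 1) → ℝ} (ha : a 0 = 1) (haN : ∀ k, ∑ i, N k i * a i = 0) : a = meetPoint N := by
  rw [← sub_eq_zero]
  refine eq_zero_of_meet h (by rw [Pi.sub_apply, ha, meetPoint_zero, sub_self]) fun k => ?_
  simp only [Pi.sub_apply, mul_sub, Finset.sum_sub_distrib, haN k, meetPoint_dot h, sub_self]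

/-- The linear form with coefficients `N`. -/
def dotForm (N : Fin (d + 1) → ℝ) : (Fin (d + 1) → ℝ) →ₗ[ℝ] ℝ :=
  ∑ i, N i • LinearMap.proj i

theorem dotForm_apply (N z : Fin (d + 1) → ℝ) : dotForm N z = ∑ i, N i * z i := by
  simp [dotForm, LinearMap.sum_apply]

theorem finrank_span_of_det {V : Fin d → Fin (d + 1) → ℝ} (h : (baseMatrix V).det ≠ 0) :
    finrank ℝ (Submodule.span ℝ (range V)) = d := by
  have hli : LinearIndependent ℝ V := by
    refine LinearIndependent.of_comp (LinearMap.funLeft ℝ ℝ Fin.castSucc) ?_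
    exact Matrix.linearIndependent_rows_of_det_ne_zero h
  rw [finrank_span_eq_card hli, Fintype.card_fin]

theorem span_eq_ker_of_det {V : Fin d → Fin (d + 1) → ℝ} (h : (baseMatrix V).det ≠ 0) :
    Submodule.span ℝ (range V) = LinearMap.ker (dotForm (covector V)) := by
  refine Submodule.eq_of_le_of_finrank_eq ?_ ?_
  · rw [Submodule.span_le]
    rintro _ ⟨l, rfl⟩
    simp only [SetLike.mem_coe, LinearMap.mem_ker, dotForm_apply]
    exact covector_dot h l
  · have hne : dotForm (covector V) ≠ 0 := fun h0 => by
      have := congrArg (fun f => f (Pi.single (Fin.last d) 1)) h0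
      simp only [dotForm_apply, LinearMap.zero_apply] at this
      rw [Finset.sum_eq_single (Fin.last d) (fun i _ hi => by simp [hi]) (by simp),
        covector_last] at this
      simp only [Pi.single_eq_same, mul_one] at this
      exact absurd this (by positivity)
    have := Module.Dual.finrank_ker_add_one_of_ne_zero (f := dotForm (covector V)) hne
    rw [finrank_span_of_det h]
    simp only [finrank_fintype_fun_eq_card, Fintype.card_fin] at this
    omega

/-- Subtracting z 0 times the normalized point from a common vector z gives a common vector with
first entry 0, which must vanish. -/
theorem iInf_span_eq_span_meetPoint {V : Fin d → Fin d → Fin (d + 1) → ℝ}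
    (hB : ∀ k, (baseMatrix (V k)).det ≠ 0)
    (hA : (meetMatrix fun k => covector (V k)).det ≠ 0) :
    ⨅ k, Submodule.span ℝ (range (V k)) =
      Submodule.span ℝ {meetPoint fun k => covector (V k)} := by
  ext z
  simp only [span_eq_ker_of_det (hB _), Submodule.mem_iInf, LinearMap.mem_ker, dotForm_apply,
    Submodule.mem_span_singleton]
  constructor
  · intro hz
    refine ⟨z 0, (sub_eq_zero.1 (eq_zero_of_meet hA ?_ fun k => ?_)).symm⟩
    · simp [meetPoint_zero]
    · simp only [Pi.sub_apply, Pi.smul_apply, smul_eq_mul, mul_sub, Finset.sum_sub_distrib, hz k,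
        mul_left_comm _ (z 0), ← Finset.mul_sum, meetPoint_dot hA k, mul_zero, sub_zero]
  · rintro ⟨c, rfl⟩ k
    simp only [Pi.smul_apply, smul_eq_mul, mul_left_comm _ c, ← Finset.mul_sum,
      meetPoint_dot hA k, mul_zero]

/-- A criterion for the short-diagonal pentagram map in terms of coordinates of the vertices. -/
theorem isShortDiagonalImage_of_coordinates {v : ℤ → RP d}
    (T : (Fin (d + 1) → ℝ) ≃ₗ[ℝ] (Fin (d + 1) → ℝ)) {V : Fin d → Fin d → Fin (d + 1) → ℝ}
    (hB : ∀ k, (baseMatrix (V k)).det ≠ 0)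
    (hA : (meetMatrix fun k => covector (V k)).det ≠ 0)
    (hv : ∀ k l : Fin d, (v (0 - ((d : ℤ) - 1) / 2 + (k : ℤ) - ((d : ℤ) - 1) + 2 * (l : ℤ))).submodule
      = Submodule.span ℝ {T (V k l)})
    {p : RP d} (hp : p.submodule = Submodule.span ℝ {T (meetPoint fun k => covector (V k))}) :
    IsShortDiagonalImage v 0 p := by
  have hplane : ∀ k : Fin d, shortDiagonalPlane v (0 - ((d : ℤ) - 1) / 2 + (k : ℤ)) =
      (Submodule.span ℝ (range (V k))).map T.toLinearMap := fun k => by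
    rw [shortDiagonalPlane, Submodule.map_span, ← range_comp, Submodule.span_range_eq_iSup]
    exact iSup_congr fun l => hv k l
  refine ⟨fun k => ?_, ?_⟩
  · rw [hplane, LinearEquiv.finrank_map_eq, finrank_span_of_det (hB k)]
  · simp only [hplane]
    rw [hp, ← Submodule.map_iInf_of_ker_le T.surjective (by simp), iInf_span_eq_span_meetPoint hB hA,
      Submodule.map_span, image_singleton]
    rfl

end Configuration

/-! ### The configuration in the rescaled frame, near ε = 0 -/

section Expansion

variable {d : ℕ} {Γ : ℝ → Fin (d + 1) → ℝ} {g : Fin (d + 1) → ℝ → ℝ → ℝ}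

theorem iteratedDeriv_add_period {A : (Fin (d + 1) → ℝ) →ₗ[ℝ] (Fin (d + 1) → ℝ)}
    (hΓ : ContDiff ℝ ∞ Γ) (hA : ∀ x, Γ (x + 2 * Real.pi) = A (Γ x)) (i : ℕ) (x : ℝ) :
    iteratedDeriv i Γ (x + 2 * Real.pi) = A (iteratedDeriv i Γ x) := by
  rw [← congrFun (iteratedDeriv_comp_add_const i Γ (2 * Real.pi)) x, funext hA]
  exact congrFun (iteratedDeriv_clm (LinearMap.toContinuousLinearMap A) hΓ i) x

/-- The coordinates of `Γ(x+t)` in the frame of `Γ` at `x` are `t^i g_i(t, x)`. -/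
structure IsFrameExpansion (Γ : ℝ → Fin (d + 1) → ℝ) (g : Fin (d + 1) → ℝ → ℝ → ℝ) : Prop where
  smooth : ∀ i, SmoothFamily univ (g i)
  expansion : ∀ t x, Γ (x + t) = ∑ i : Fin (d + 1), (t ^ (i : ℕ) * g i t x) • iteratedDeriv (i : ℕ) Γ x
  zero : ∀ i x, g i 0 x = 1 / ((i : ℕ).factorial : ℝ)
  hasDerivAt_zero : ∀ i x, HasDerivAt (fun t => g i t x) 0 0
  periodic : ∀ i t, Function.Periodic (g i t) (2 * Real.pi)

/-- The k-th t-derivative at 0 of the i-th coordinate of Γ(x+t) is the i-th coordinate of Γ^(k)(x):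
it is 0 for k < i, 1 for k = i, and again 0 for k = i + 1. In the last case i = d needs the constant
Wronskian. -/
theorem exists_isFrameExpansion (hΓ : ContDiff ℝ ∞ Γ) (hW : ∀ x, wronskian Γ x = 1)
    {A : (Fin (d + 1) → ℝ) →ₗ[ℝ] (Fin (d + 1) → ℝ)}
    (hA : ∀ x, Γ (x + 2 * Real.pi) = A (Γ x)) : ∃ g, IsFrameExpansion Γ g := by
  have hW0 : ∀ x, wronskian Γ x ≠ 0 := fun x => by simp [hW]
  have hshift : ContDiff ℝ ∞ fun p : ℝ × ℝ => Γ (p.2 + p.1) := hΓ.comp (by fun_prop)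
  have hE : ∀ i, SmoothFamily univ fun t x => coef Γ x (Γ (x + t)) i := fun i =>
    SmoothFamily.coef (F := fun _ => Γ) (.const hΓ) (v := fun t x => Γ (x + t))
      (.of_contDiff hshift) isOpen_univ (fun _ _ => hW0) i
  have hEd : ∀ i k x, iteratedDeriv k (fun t => coef Γ x (Γ (x + t)) i) 0 =
      coef Γ x (iteratedDeriv k Γ x) i := fun i k x => by
    obtain ⟨B, hB⟩ := coef_clm Γ x i
    simp only [← hB]
    rw [iteratedDeriv_clm B (f := fun t => Γ (x + t)) (hΓ.comp (by fun_prop)), iteratedDeriv_comp_const_add]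
    simp
  have hex : ∀ i : Fin (d + 1), ∃ G : ℝ → ℝ → ℝ, SmoothFamily univ G ∧
      (∀ t x, coef Γ x (Γ (x + t)) i = t ^ (i : ℕ) * G t x) ∧
      ∀ j x, coef Γ x (iteratedDeriv (i + j) Γ x) i =
        (i + j : ℕ).descFactorial i * iteratedDeriv j (fun t => G t x) 0 := fun i => by
    obtain ⟨G, h1, h2, h3⟩ := (hE i).exists_eq_pow_smul i fun k hk x => by
      rw [hEd, show k = ((⟨k, by omega⟩ : Fin (d + 1)) : ℕ) from rfl,
        coef_iteratedDeriv (hW0 x), if_neg]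
      intro h
      exact hk.ne (congrArg Fin.val h).symm
    exact ⟨G, h1, h2, fun j x => by rw [← h3, hEd]⟩
  choose g hg1 hg2 hg3 using hex
  have hexp : ∀ t x, Γ (x + t) = ∑ i : Fin (d + 1), (t ^ (i : ℕ) * g i t x) • iteratedDeriv (i : ℕ) Γ x :=
    fun t x => by
      rw [← sum_coef (hW0 x) (Γ (x + t))]
      exact Finset.sum_congr rfl fun i _ => by rw [hg2]
  have hzero : ∀ i x, g i 0 x = 1 / ((i : ℕ).factorial : ℝ) := fun i x => by
    have := hg3 i 0 x
    rw [add_zero, coef_iteratedDeriv (hW0 x), if_pos rfl, Nat.descFactorial_self,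
      iteratedDeriv_zero] at this
    rw [this, mul_div_cancel_left₀]
    positivity
  refine ⟨g, hg1, hexp, hzero, fun i x => ?_, fun i t x => ?_⟩
  · have h := hg3 i 1 x
    have h0 : coef Γ x (iteratedDeriv (i + 1) Γ x) i = 0 := by
      by_cases hi : (i : ℕ) < d
      · rw [show (i : ℕ) + 1 = ((⟨i + 1, by omega⟩ : Fin (d + 1)) : ℕ) from rfl,
          coef_iteratedDeriv (hW0 x), if_neg]
        intro h
        have := congrArg Fin.val h
        simp at this
      · obtain rfl : i = Fin.last d := Fin.ext (by simp; omega)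
        exact coef_last_of_wronskian_const hΓ hW x
    rw [h0, iteratedDeriv_one] at h
    have hpos : 0 < ((i : ℕ) + 1).descFactorial i := Nat.pos_of_ne_zero fun h0 => by
      rw [Nat.descFactorial_eq_zero_iff_lt] at h0
      omega
    refine HasDerivAt.congr_deriv ?_ ((mul_eq_zero.1 h.symm).resolve_left (by positivity))
    exact ((hg1 i).differentiableAt_fst isOpen_univ trivial x).hasDerivAt
  · by_cases ht : t = 0
    · rw [ht, hzero, hzero]
    · have := coef_map A (hW0 x) (hW0 _) (fun j => iteratedDeriv_add_period hΓ hA j x) (Γ (x + t)) i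
      rw [← hA, show x + t + 2 * Real.pi = x + 2 * Real.pi + t by ring, hg2, hg2] at this
      exact mul_left_cancel₀ (pow_ne_zero _ ht) this

/-- The coordinates of the vertices `γ(x + s ε)` in the rescaled frame `ε^i Γ^(i)(x)`. -/
def vertexCoords (g : Fin (d + 1) → ℝ → ℝ → ℝ) (ε x : ℝ) (k l : Fin d) (i : Fin (d + 1)) : ℝ :=
  node d k l ^ (i : ℕ) * g i (node d k l * ε) x

/-- The equations of the short-diagonal hyperplanes in the rescaled frame. -/
def planeCovector (g : Fin (d + 1) → ℝ → ℝ → ℝ) (ε x : ℝ) (k : Fin d) : Fin (d + 1) → ℝ :=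
  covector (vertexCoords g ε x k)

/-- The coordinates of the image point in the rescaled frame. -/
def imageCoords (g : Fin (d + 1) → ℝ → ℝ → ℝ) (ε x : ℝ) : Fin (d + 1) → ℝ :=
  meetPoint (planeCovector g ε x)

/-- The matrices of the linear systems for the hyperplanes and for the image point are
invertible. -/
structure IsGeneric (g : Fin (d + 1) → ℝ → ℝ → ℝ) (ε x : ℝ) : Prop where
  base : ∀ k, (baseMatrix (vertexCoords g ε x k)).det ≠ 0
  meet : (meetMatrix (planeCovector g ε x)).det ≠ 0

namespace IsFrameExpansion

theorem smooth_vertexCoords (hg : IsFrameExpansion Γ g) (k l : Fin d) (i : Fin (d + 1)) :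
    SmoothFamily univ fun ε x => vertexCoords g ε x k l i := by
  refine (SmoothFamily.const contDiff_const).mul ?_
  exact ContDiffOn.comp (f := fun p : ℝ × ℝ => (node d k l * p.1, p.2)) (hg.smooth i)
    (by fun_prop) fun p _ => ⟨trivial, trivial⟩

theorem vertexCoords_zero (hg : IsFrameExpansion Γ g) (x : ℝ) (k l : Fin d) (i : Fin (d + 1)) :
    vertexCoords g 0 x k l i = node d k l ^ (i : ℕ) / ((i : ℕ).factorial : ℝ) := by
  rw [vertexCoords, mul_zero, hg.zero, mul_one_div]

theorem hasDerivAt_vertexCoords (hg : IsFrameExpansion Γ g) (x : ℝ) (k l : Fin d) (i : Fin (d + 1)) :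
    HasDerivAt (fun ε => vertexCoords g ε x k l i) 0 0 := by
  have h1 : HasDerivAt (fun t => g i t x) 0 (node d k l * 0) := by
    rw [mul_zero]; exact hg.hasDerivAt_zero i x
  have h2 := h1.comp (0 : ℝ) ((hasDerivAt_id (0 : ℝ)).const_mul (node d k l))
  refine (h2.const_mul (node d k l ^ (i : ℕ))).congr_deriv ?_
  simp

theorem vertexCoords_periodic (hg : IsFrameExpansion Γ g) (ε x : ℝ) :
    vertexCoords g ε (x + 2 * Real.pi) = vertexCoords g ε x := by
  ext k l i
  rw [vertexCoords, hg.periodic i, vertexCoords]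

/-- Reversing both indices negates the node, so ε and -ε give the same vertices up to relabelling
and the signs of the rescaled frame. Evenness of the image curve rests on this. -/
theorem vertexCoords_neg (ε x : ℝ) (k l : Fin d) (i : Fin (d + 1)) :
    vertexCoords g (-ε) x k.rev l.rev i = (-1) ^ (i : ℕ) * vertexCoords g ε x k l i := by
  rw [vertexCoords, vertexCoords, node_rev, neg_mul_neg, neg_pow, mul_assoc]

theorem planeCovector_periodic (hg : IsFrameExpansion Γ g) (ε x : ℝ) :
    planeCovector g ε (x + 2 * Real.pi) = planeCovector g ε x := by
  ext1 k
  rw [planeCovector, hg.vertexCoords_periodic, planeCovector]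

theorem imageCoords_periodic (hg : IsFrameExpansion Γ g) (ε x : ℝ) :
    imageCoords g ε (x + 2 * Real.pi) = imageCoords g ε x := by
  rw [imageCoords, hg.planeCovector_periodic, imageCoords]

theorem isGeneric_base_zero (hg : IsFrameExpansion Γ g) (x : ℝ) (k : Fin d) :
    (baseMatrix (vertexCoords g 0 x k)).det ≠ 0 := by
  convert det_moment_ne_zero d k using 2
  ext l i
  simp [baseMatrix, hg.vertexCoords_zero]

theorem planeCovector_zero (hg : IsFrameExpansion Γ g) (x : ℝ) (k : Fin d) (i : Fin (d + 1)) :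
    planeCovector g 0 x k i =
      (Polynomial.derivative^[i] (nodePoly d)).eval (-centre d k) := by
  refine moment_covector (covector_last _) (fun l => ?_) i
  simp only [← hg.vertexCoords_zero x]
  exact covector_dot (hg.isGeneric_base_zero x k) l

theorem isGeneric_zero (hg : IsFrameExpansion Γ g) (x : ℝ) : IsGeneric g 0 x :=
  ⟨hg.isGeneric_base_zero x, det_momentCovector_ne_zero (hg.planeCovector_zero x)⟩

theorem imageCoords_zero (hg : IsFrameExpansion Γ g) (hd : 2 ≤ d) (x : ℝ) :
    imageCoords g 0 x ⟨1, by omega⟩ = 0 ∧ imageCoords g 0 x ⟨2, by omega⟩ = limitConst d :=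
  moment_point hd (hg.planeCovector_zero x) (meetPoint_zero _)
    (meetPoint_dot (hg.isGeneric_zero x).meet)

theorem smooth_planeCovector (hg : IsFrameExpansion Γ g) {I : Set ℝ}
    (h : ∀ ε ∈ I, ∀ x k, (baseMatrix (vertexCoords g ε x k)).det ≠ 0) (k : Fin d)
    (i : Fin (d + 1)) : SmoothFamily I fun ε x => planeCovector g ε x k i := by
  have hv := fun l i => (hg.smooth_vertexCoords k l i).mono (subset_univ I)
  unfold planeCovector covector
  refine Fin.lastCases ?_ (fun i => ?_) i
  · simp only [Fin.snoc_last]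
    exact .const contDiff_const
  · simp only [Fin.snoc_castSucc]
    exact .inv_mulVec (fun l i => hv l i.castSucc)
      (fun l => ((SmoothFamily.const contDiff_const).mul (hv l _)).neg) (fun ε hε x => h ε hε x k) i

theorem exists_isGeneric (hg : IsFrameExpansion Γ g) : ∃ r, 0 < r ∧ ∀ ε ∈ Ioo (-r) r, ∀ x, IsGeneric g ε x := by
  -- The product treats all hyperplanes at once. A second radius is needed afterwards, because the
  -- covectors are known to be smooth only where these determinants are nonzero.
  obtain ⟨r₁, hr₁, -, h₁⟩ := SmoothFamily.exists_forall_mem (r := 1) one_pos Real.two_pi_pos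
    (h := fun ε x => ∏ k : Fin d, (baseMatrix (vertexCoords g ε x k)).det)
    (.prod fun k _ => .det fun l i => (hg.smooth_vertexCoords k l _).mono (subset_univ _))
    (fun ε _ x => by simp only [hg.vertexCoords_periodic]) (isOpen_compl_singleton (x := 0))
    (fun x => Finset.prod_ne_zero_iff.2 fun k _ => hg.isGeneric_base_zero x k)
  have hb : ∀ ε ∈ Ioo (-r₁) r₁, ∀ x k, (baseMatrix (vertexCoords g ε x k)).det ≠ 0 :=
    fun ε hε x k => Finset.prod_ne_zero_iff.1 (h₁ ε hε x) k (Finset.mem_univ k)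
  obtain ⟨r₂, hr₂, hr₂₁, h₂⟩ := SmoothFamily.exists_forall_mem hr₁ Real.two_pi_pos
    (h := fun ε x => (meetMatrix (planeCovector g ε x)).det)
    (.det fun k i => hg.smooth_planeCovector hb k i.succ)
    (fun ε _ x => by simp only [hg.planeCovector_periodic]) (isOpen_compl_singleton (x := 0))
    (fun x => (hg.isGeneric_zero x).meet)
  exact ⟨r₂, hr₂, fun ε hε x => ⟨hb ε ⟨by linarith [hε.1], by linarith [hε.2]⟩ x, h₂ ε hε x⟩⟩

theorem smooth_imageCoords (hg : IsFrameExpansion Γ g) {I : Set ℝ} (h : ∀ ε ∈ I, ∀ x, IsGeneric g ε x) (i : Fin (d + 1)) :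
    SmoothFamily I fun ε x => imageCoords g ε x i := by
  have hN := hg.smooth_planeCovector fun ε hε x => (h ε hε x).base
  unfold imageCoords meetPoint
  refine Fin.cases ?_ (fun i => ?_) i
  · simp only [Fin.cons_zero]
    exact .const contDiff_const
  · simp only [Fin.cons_succ]
    exact .inv_mulVec (fun k i => hN k i.succ) (fun k => (hN k 0).neg)
      (fun ε hε x => (h ε hε x).meet) i

/-- Differentiate the incidence relations at ε = 0. The vertex coordinates have zero derivative
there, so the derivative of the covector annihilates the vertices and has last entry 0. -/
theorem deriv_planeCovector (hg : IsFrameExpansion Γ g) {I : Set ℝ} (hI : IsOpen I) (h0 : (0 : ℝ) ∈ I)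
    (h : ∀ ε ∈ I, ∀ x, IsGeneric g ε x) (x : ℝ) (k : Fin d) (i : Fin (d + 1)) :
    deriv (fun ε => planeCovector g ε x k i) 0 = 0 := by
  have hN := hg.smooth_planeCovector fun ε hε x => (h ε hε x).base
  refine congrFun (eq_zero_of_covector (hg.isGeneric_base_zero x k)
    (a := fun i => deriv (fun ε => planeCovector g ε x k i) 0) ?_ fun l => ?_) i
  · simp only [planeCovector, covector_last, deriv_const]
  · have h1 : HasDerivAt (fun ε => ∑ i, planeCovector g ε x k i * vertexCoords g ε x k l i) _ 0 :=
      HasDerivAt.fun_sum fun i _ =>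
        ((hN k i).differentiableAt_fst hI h0 x).hasDerivAt.mul (hg.hasDerivAt_vertexCoords x k l i)
    have h2 : (fun ε => ∑ i, planeCovector g ε x k i * vertexCoords g ε x k l i) =ᶠ[𝓝 0]
        fun _ => 0 := by
      filter_upwards [hI.mem_nhds h0] with ε hε using covector_dot ((h ε hε x).base k) l
    simpa using h1.unique ((hasDerivAt_const 0 0).congr_of_eventuallyEq h2)

theorem deriv_imageCoords (hg : IsFrameExpansion Γ g) {I : Set ℝ} (hI : IsOpen I) (h0 : (0 : ℝ) ∈ I)
    (h : ∀ ε ∈ I, ∀ x, IsGeneric g ε x) (x : ℝ) (i : Fin (d + 1)) :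
    deriv (fun ε => imageCoords g ε x i) 0 = 0 := by
  have hN := hg.smooth_planeCovector fun ε hε x => (h ε hε x).base
  refine congrFun (eq_zero_of_meet (hg.isGeneric_zero x).meet
    (a := fun i => deriv (fun ε => imageCoords g ε x i) 0) ?_ fun k => ?_) i
  · simp only [imageCoords, meetPoint_zero, deriv_const]
  · have h1 : HasDerivAt (fun ε => ∑ i, planeCovector g ε x k i * imageCoords g ε x i) _ 0 :=
      HasDerivAt.fun_sum fun i _ => ((hN k i).differentiableAt_fst hI h0 x).hasDerivAt.mul
        ((hg.smooth_imageCoords h i).differentiableAt_fst hI h0 x).hasDerivAt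
    have h2 : (fun ε => ∑ i, planeCovector g ε x k i * imageCoords g ε x i) =ᶠ[𝓝 0]
        fun _ => 0 := by
      filter_upwards [hI.mem_nhds h0] with ε hε using meetPoint_dot (h ε hε x).meet k
    simpa [hg.deriv_planeCovector hI h0 h] using
      h1.unique ((hasDerivAt_const 0 0).congr_of_eventuallyEq h2)

theorem imageCoords_neg {ε x : ℝ} (h : IsGeneric g ε x) (h' : IsGeneric g (-ε) x)
    (i : Fin (d + 1)) : imageCoords g (-ε) x i = (-1) ^ (i : ℕ) * imageCoords g ε x i := by
  -- The extra sign (-1)^d keeps the last entry equal to d!, so uniqueness of the normalized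
  -- covector applies.
  have hN : ∀ k i, planeCovector g (-ε) x k.rev i =
      (-1) ^ (d + (i : ℕ)) * planeCovector g ε x k i := fun k i => by
    refine (congrFun (eq_covector (h'.base k.rev)
      (a := fun i => (-1) ^ (d + (i : ℕ)) * planeCovector g ε x k i) ?_ fun l => ?_) i).symm
    · rw [planeCovector, covector_last, Fin.val_last, Even.neg_one_pow ⟨d, rfl⟩, one_mul]
    · rw [← Fin.rev_rev l]
      simp only [vertexCoords_neg]
      have : ∀ i : Fin (d + 1), (-1 : ℝ) ^ (d + (i : ℕ)) * planeCovector g ε x k i *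
          ((-1) ^ (i : ℕ) * vertexCoords g ε x k l.rev i) =
          (-1) ^ d * (planeCovector g ε x k i * vertexCoords g ε x k l.rev i) := fun i => by
        rw [pow_add]
        have : ((-1 : ℝ) ^ (i : ℕ)) * (-1) ^ (i : ℕ) = 1 := by
          rw [← pow_add, Even.neg_one_pow ⟨_, rfl⟩]
        linear_combination ((-1) ^ d * planeCovector g ε x k i *
          vertexCoords g ε x k l.rev i) * this
      simp only [this, ← Finset.mul_sum]
      rw [planeCovector, covector_dot (h.base k), mul_zero]
  refine (congrFun (eq_meetPoint h'.meet
    (a := fun i => (-1) ^ (i : ℕ) * imageCoords g ε x i) ?_ fun k => ?_) i).symm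
  · simp [imageCoords, meetPoint_zero]
  · rw [← Fin.rev_rev k]
    simp only [hN]
    have : ∀ i : Fin (d + 1), (-1 : ℝ) ^ (d + (i : ℕ)) * planeCovector g ε x k.rev i *
        ((-1) ^ (i : ℕ) * imageCoords g ε x i) =
        (-1) ^ d * (planeCovector g ε x k.rev i * imageCoords g ε x i) := fun i => by
      rw [pow_add]
      have : ((-1 : ℝ) ^ (i : ℕ)) * (-1) ^ (i : ℕ) = 1 := by
        rw [← pow_add, Even.neg_one_pow ⟨_, rfl⟩]
      linear_combination ((-1) ^ d * planeCovector g ε x k.rev i * imageCoords g ε x i) * this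
    simp only [this, ← Finset.mul_sum]
    rw [imageCoords, meetPoint_dot h.meet, mul_zero]

end IsFrameExpansion

end Expansion

/-! ### The image curve: monodromy, evenness and second order expansion -/

section ImageCurve

variable {d : ℕ} {γ : ℝ → RP d} {Γ : ℝ → Fin (d + 1) → ℝ} {g : Fin (d + 1) → ℝ → ℝ → ℝ}

theorem submodule_eq_span (hΓ : IsNormalizedLift γ Γ) (x : ℝ) :
    (γ x).submodule = Submodule.span ℝ {Γ x} := by
  obtain ⟨h, hx⟩ := hΓ.lift x
  rw [← hx, Projectivization.submodule_mk]

theorem ne_zero_of_wronskian {x : ℝ} (h : wronskian Γ x ≠ 0) : Γ x ≠ 0 := fun h0 => by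
  refine h (Matrix.det_eq_zero_of_row_eq_zero 0 fun j => ?_)
  simp [h0]

/-- A normalized lift of a curve with projective monodromy has linear monodromy. -/
theorem exists_linear_monodromy {M : (Fin (d + 1) → ℝ) ≃ₗ[ℝ] (Fin (d + 1) → ℝ)}
    (hM : HasMonodromy γ M) (hΓ : IsNormalizedLift γ Γ) :
    ∃ A : (Fin (d + 1) → ℝ) →ₗ[ℝ] (Fin (d + 1) → ℝ), ∀ x, Γ (x + 2 * Real.pi) = A (Γ x) := by
  have hex : ∀ x, ∃ a : ℝ, Γ (x + 2 * Real.pi) = a • M (Γ x) := fun x => by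
    obtain ⟨h1, hx1⟩ := hΓ.lift x
    obtain ⟨h2, hx2⟩ := hΓ.lift (x + 2 * Real.pi)
    have h := hM x
    rw [← hx1, ← hx2, Projectivization.map_mk, Projectivization.mk_eq_mk_iff'] at h
    obtain ⟨a, ha⟩ := h
    exact ⟨a, ha.symm⟩
  choose f hf using hex
  set B : (Fin (d + 1) → ℝ) →L[ℝ] (Fin (d + 1) → ℝ) :=
    LinearMap.toContinuousLinearMap M.toLinearMap with hB
  have hBM : ∀ v, B v = M v := fun v => rfl
  have hMΓ : ContDiff ℝ ∞ fun x => M (Γ x) := B.contDiff.comp hΓ.smooth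
  have hpos : ∀ x, dotProduct (M (Γ x)) (M (Γ x)) ≠ 0 := fun x h => by
    rw [dotProduct_self_eq_zero] at h
    exact (hΓ.lift x).1 (M.map_eq_zero_iff.1 h)
  have hfs : ContDiff ℝ ∞ f := by
    -- The pointwise chosen factor f is recovered by a quotient of dot products, which makes it
    -- smooth.
    have hfeq : f = fun x => dotProduct (Γ (x + 2 * Real.pi)) (M (Γ x)) /
        dotProduct (M (Γ x)) (M (Γ x)) := funext fun x => by
      rw [hf, smul_dotProduct, smul_eq_mul, mul_div_cancel_right₀ _ (hpos x)]
    have hsh : ContDiff ℝ ∞ fun x => Γ (x + 2 * Real.pi) := hΓ.smooth.comp (by fun_prop)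
    rw [hfeq]
    refine ContDiff.div ?_ ?_ hpos
    · exact ContDiff.sum fun i _ => (contDiff_pi.1 hsh i).mul (contDiff_pi.1 hMΓ i)
    · exact ContDiff.sum fun i _ => (contDiff_pi.1 hMΓ i).mul (contDiff_pi.1 hMΓ i)
  -- Both Γ and its translate have determinant 1, which fixes f^(d+1). Differentiating shows that f
  -- is constant, so f·M is a single linear map.
  have hpow : ∀ x, f x ^ (d + 1) * LinearMap.det M.toLinearMap = 1 := fun x => by
    have h1 : wronskian (fun y => M (Γ y)) x = LinearMap.det M.toLinearMap := by
      rw [wronskian_map (Γ := Γ) (x := x) (Γ' := fun y => M (Γ y)) (x' := x) M.toLinearMap fun i =>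
        congrFun (iteratedDeriv_clm B hΓ.smooth i) x, hΓ.normalized, mul_one]
    rw [← h1, ← wronskian_smul hfs hMΓ, ← hΓ.normalized (x + 2 * Real.pi)]
    have h2 : (fun y => f y • M (Γ y)) = fun y => Γ (y + 2 * Real.pi) := funext fun y => (hf y).symm
    rw [h2, wronskian_eq, wronskian_eq]
    congr 1
    ext i j
    simp only [frame, Matrix.of_apply, iteratedDeriv_comp_add_const]
  have hf0 : ∀ x, f x ≠ 0 := fun x h => by simpa [h] using hpow x
  have hdet : LinearMap.det M.toLinearMap ≠ 0 := fun h => by simpa [h] using hpow 0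
  have hderiv : ∀ x, deriv f x = 0 := fun x => by
    have h1 := (((hfs.differentiable (by simp) x).hasDerivAt).pow (d + 1)).mul_const
      (LinearMap.det M.toLinearMap)
    have h2 := h1.unique ((hasDerivAt_const x (1 : ℝ)).congr_of_eventuallyEq
      (.of_forall fun y => hpow y))
    have h3 := (mul_eq_zero.1 h2).resolve_right hdet
    refine (mul_eq_zero.1 h3).resolve_left (mul_ne_zero ?_ (pow_ne_zero _ (hf0 x)))
    exact_mod_cast Nat.succ_ne_zero d
  refine ⟨f 0 • M.toLinearMap, fun x => ?_⟩
  rw [hf, is_const_of_deriv_eq_zero (hfs.differentiable (by simp)) hderiv x 0]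
  rfl

/-- The unnormalized image of the curve under the pentagram map. -/
def imageCurve (Γ : ℝ → Fin (d + 1) → ℝ) (g : Fin (d + 1) → ℝ → ℝ → ℝ) (ε x : ℝ) :
    Fin (d + 1) → ℝ :=
  ∑ i : Fin (d + 1), (ε ^ (i : ℕ) * imageCoords g ε x i) • iteratedDeriv (i : ℕ) Γ x

theorem imageCurve_neg {ε x : ℝ} (h : IsGeneric g ε x) (h' : IsGeneric g (-ε) x) :
    imageCurve Γ g (-ε) x = imageCurve Γ g ε x := by
  refine Finset.sum_congr rfl fun i _ => ?_
  rw [IsFrameExpansion.imageCoords_neg h h', ← mul_assoc, ← mul_pow, neg_mul_neg, mul_one]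

theorem imageCurve_periodic (hg : IsFrameExpansion Γ g) (hΓ : ContDiff ℝ ∞ Γ)
    {A : (Fin (d + 1) → ℝ) →ₗ[ℝ] (Fin (d + 1) → ℝ)}
    (hA : ∀ x, Γ (x + 2 * Real.pi) = A (Γ x)) (ε x : ℝ) :
    imageCurve Γ g ε (x + 2 * Real.pi) = A (imageCurve Γ g ε x) := by
  rw [imageCurve, imageCurve, map_sum]
  refine Finset.sum_congr rfl fun i _ => ?_
  rw [map_smul, iteratedDeriv_add_period hΓ hA, hg.imageCoords_periodic]

theorem smooth_imageCurve (hg : IsFrameExpansion Γ g) (hΓ : ContDiff ℝ ∞ Γ) {I : Set ℝ}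
    (h : ∀ ε ∈ I, ∀ x, IsGeneric g ε x) : SmoothFamily I (imageCurve Γ g) :=
  .sum fun i _ => (SmoothFamily.mul (.pow _) (hg.smooth_imageCoords h i)).smul
    (.const (contDiff_iteratedDeriv hΓ i))

/-- The Γ' term is ε q_1, and q_1 vanishes to second order in ε. Hence the ε² term comes only from
q_2 at ε = 0. -/
theorem exists_imageCurve_expansion (hd : 2 ≤ d) (hg : IsFrameExpansion Γ g)
    (hΓ : ContDiff ℝ ∞ Γ) {r : ℝ} (hr : 0 < r)
    (h : ∀ ε ∈ Ioo (-r) r, ∀ x, IsGeneric g ε x) :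
    ∃ H : ℝ → ℝ → Fin (d + 1) → ℝ, SmoothFamily (Ioo (-r) r) H ∧
      (∀ ε ∈ Ioo (-r) r, ∀ x, imageCurve Γ g ε x = Γ x + ε ^ 2 • H ε x) ∧
      ∀ x, H 0 x = limitConst d • iteratedDeriv 2 Γ x := by
  have h0 : (0 : ℝ) ∈ Ioo (-r) r := by simp [hr]
  obtain ⟨n, rfl⟩ : ∃ n, d = n + 2 := ⟨d - 2, by omega⟩
  have hq := hg.smooth_imageCoords h
  obtain ⟨G, hG, hqG⟩ := (hq 1).exists_eq_add_smul isOpen_Ioo starConvex_zero_Ioo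
  have hq1 : ∀ x, imageCoords g 0 x 1 = 0 := fun x => (hg.imageCoords_zero hd x).1
  have hq2 : ∀ x, imageCoords g 0 x 2 = limitConst (n + 2) := fun x => (hg.imageCoords_zero hd x).2
  have hG0 : ∀ x, G 0 x = 0 := fun x => by
    have h1 := hg.deriv_imageCoords isOpen_Ioo h0 h x 1
    have h2 : (fun ε => imageCoords g ε x 1) =ᶠ[𝓝 0] fun ε => ε * G ε x := by
      filter_upwards [isOpen_Ioo.mem_nhds h0] with ε hε
      rw [hqG ε hε x, hq1, zero_add, smul_eq_mul]
    rw [h2.deriv_eq] at h1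
    have h3 := (hasDerivAt_id (0 : ℝ)).mul
      (hG.differentiableAt_fst isOpen_Ioo h0 x).hasDerivAt
    have h4 := h3.deriv
    simp only [id, one_mul, zero_mul, add_zero] at h4
    rw [← h4]
    exact h1
  have e1 : ((Fin.succ 0 : Fin (n + 2 + 1))) = 1 := rfl
  refine ⟨fun ε x => G ε x • iteratedDeriv 1 Γ x + ∑ i : Fin (n + 1),
    (ε ^ (i : ℕ) * imageCoords g ε x i.succ.succ) • iteratedDeriv ((i : ℕ) + 2) Γ x, ?_, ?_, ?_⟩
  · refine (hG.smul (.const (contDiff_iteratedDeriv hΓ 1))).add (.sum fun i _ => ?_)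
    exact (SmoothFamily.mul (.pow _) (hq _)).smul (.const (contDiff_iteratedDeriv hΓ _))
  · intro ε hε x
    rw [imageCurve, Fin.sum_univ_succ, Fin.sum_univ_succ, e1, hqG ε hε x, hq1]
    simp only [imageCoords, meetPoint_zero]
    rw [smul_add, smul_smul, Finset.smul_sum]
    congr 1
    · simp
    · congr 1
      · simp only [Fin.val_one, pow_one, zero_add, smul_eq_mul]
        congr 1
        ring
      · refine Finset.sum_congr rfl fun i _ => ?_
        rw [smul_smul, Fin.val_succ, Fin.val_succ]
        congr 1
        ring
  · intro x
    simp only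
    rw [hG0, zero_smul, zero_add, Fin.sum_univ_succ, Finset.sum_eq_zero, add_zero]
    · rw [show (Fin.succ (Fin.succ 0) : Fin (n + 2 + 1)) = 2 from rfl, hq2]
      simp
    · intro i _
      simp

/-- The frame `ε^i Γ^(i)(x)` as a linear equivalence. -/
theorem exists_scaledFrame {x ε : ℝ} (hW : wronskian Γ x ≠ 0) (hε : ε ≠ 0) :
    ∃ T : (Fin (d + 1) → ℝ) ≃ₗ[ℝ] (Fin (d + 1) → ℝ), ∀ a,
      T a = ∑ i : Fin (d + 1), (ε ^ (i : ℕ) * a i) • iteratedDeriv (i : ℕ) Γ x := by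
  let f : (Fin (d + 1) → ℝ) →ₗ[ℝ] (Fin (d + 1) → ℝ) :=
    { toFun := fun a => ∑ i : Fin (d + 1), (ε ^ (i : ℕ) * a i) • iteratedDeriv (i : ℕ) Γ x
      map_add' := fun a b => by
        simp only [Pi.add_apply, mul_add, add_smul, Finset.sum_add_distrib]
      map_smul' := fun c a => by
        simp only [Pi.smul_apply, smul_eq_mul, RingHom.id_apply, Finset.smul_sum, smul_smul]
        refine Finset.sum_congr rfl fun i _ => ?_
        congr 1
        ring }
  have hf : Function.Injective f := fun a b hab => by
    ext i
    exact mul_left_cancel₀ (pow_ne_zero _ hε) (congrFun (coef_unique hW hab) i)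
  exact ⟨LinearEquiv.ofInjectiveEndo f hf, fun a => rfl⟩

/-- For odd d the index offset is already centred. For even d the integer division leaves half a
step too much, which the shift by ε/2 removes. -/
theorem discretize_parameter (d : ℕ) (k l : Fin d) (x ε : ℝ) :
    (if Odd d then x else x - ε / 2) +
      ((0 - ((d : ℤ) - 1) / 2 + (k : ℤ) - ((d : ℤ) - 1) + 2 * (l : ℤ) : ℤ) : ℝ) * ε =
      x + node d k l * ε := by
  unfold node centre
  rcases Nat.even_or_odd' d with ⟨m, hm | hm⟩
  · have h1 : ((d : ℤ) - 1) / 2 = m - 1 := by omega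
    rw [h1, if_neg (by rw [hm]; simp)]
    have h2 : (d : ℝ) = 2 * m := by exact_mod_cast hm
    push_cast
    rw [h2]
    ring
  · have h1 : ((d : ℤ) - 1) / 2 = m := by omega
    rw [h1, if_pos (by rw [hm]; simp)]
    have h2 : (d : ℝ) = 2 * m + 1 := by exact_mod_cast hm
    push_cast
    rw [h2]
    ring

theorem isShortDiagonalImage_imageCurve (hg : IsFrameExpansion Γ g) (hΓ : IsNormalizedLift γ Γ)
    {ε x : ℝ} (hε : ε ≠ 0) (h : IsGeneric g ε x) {p : RP d}
    (hp : p.submodule = Submodule.span ℝ {imageCurve Γ g ε x}) :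
    IsShortDiagonalImage (discretize γ ε (if Odd d then x else x - ε / 2)) 0 p := by
  obtain ⟨T, hT⟩ := exists_scaledFrame (Γ := Γ) (x := x) (by simp [hΓ.normalized]) hε
  refine isShortDiagonalImage_of_coordinates T (V := vertexCoords g ε x) h.base h.meet
    (fun k l => ?_) ?_
  · rw [discretize, discretize_parameter, submodule_eq_span hΓ, hT, hg.expansion]
    congr 2
    refine Finset.sum_congr rfl fun i _ => ?_
    rw [vertexCoords, mul_pow]
    congr 1
    ring
  · rw [hp, hT]
    rfl

end ImageCurve

/-! ### Normalizing the determinant and varying the operator -/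

section Normalization

variable {d : ℕ} {Γ : ℝ → Fin (d + 1) → ℝ}

/-- The difference quotient in η = ε² is exactly c(√η), so continuity of c is enough. -/
theorem hasDerivWithinAt_smul_sqrt {c : ℝ → ℝ} (hc : ContinuousAt c 0) (a : ℝ) :
    HasDerivWithinAt (fun η => a + η * c (Real.sqrt η)) (c 0) (Ici 0) 0 := by
  rw [hasDerivWithinAt_iff_tendsto_slope]
  have hs : Tendsto (fun η => c (Real.sqrt η)) (𝓝[Ici 0 \ {0}] 0) (𝓝 (c 0)) := by
    have : Tendsto Real.sqrt (𝓝 0) (𝓝 0) := by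
      simpa using Real.continuous_sqrt.tendsto 0
    exact (hc.tendsto.comp this).mono_left nhdsWithin_le_nhds
  refine hs.congr' ?_
  filter_upwards [self_mem_nhdsWithin] with η hη
  have : η ≠ 0 := hη.2
  rw [slope_def_field]
  field_simp
  ring

/-- The linearization of `det (Γ, …, Γ^(d)) = 1` along an even family. -/
theorem sum_det_updateRow_eq_zero {r : ℝ} (hr : 0 < r) {F H : ℝ → ℝ → Fin (d + 1) → ℝ}
    (hΓ : ContDiff ℝ ∞ Γ) (hH : SmoothFamily (Ioo (-r) r) H)
    (hF : ∀ ε ∈ Ioo (-r) r, ∀ x, F ε x = Γ x + ε ^ 2 • H ε x)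
    (hW : ∀ ε ∈ Ioo (-r) r, ∀ x, wronskian (F ε) x = 1) (x : ℝ) :
    ∑ i : Fin (d + 1), ((frame Γ x).updateRow i (iteratedDeriv (i : ℕ) (H 0) x)).det = 0 := by
  have h0 : (0 : ℝ) ∈ Ioo (-r) r := by simp [hr]
  have hiter : ∀ ε ∈ Ioo (-r) r, ∀ i : ℕ, iteratedDeriv i (F ε) x =
      iteratedDeriv i Γ x + ε ^ 2 • iteratedDeriv i (H ε) x := fun ε hε i => by
    have ht : (i : WithTop ℕ∞) ≤ ∞ := by exact_mod_cast le_top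
    rw [show F ε = fun x => Γ x + ε ^ 2 • H ε x from funext (hF ε hε),
      iteratedDeriv_fun_add (hΓ.of_le ht).contDiffAt
        (((hH.contDiff hε).const_smul _).of_le ht).contDiffAt, iteratedDeriv_fun_const_smul_field]
  let Mx : ℝ → Matrix (Fin (d + 1)) (Fin (d + 1)) ℝ := fun η => Matrix.of fun i j =>
    iteratedDeriv (i : ℕ) Γ x j + η * iteratedDeriv (i : ℕ) (H (Real.sqrt η)) x j
  have hMx : HasDerivWithinAt (fun η => (Mx η).det)
      (∑ i : Fin (d + 1), ((Mx 0).updateRow i (iteratedDeriv (i : ℕ) (H 0) x)).det) (Ici 0) 0 :=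
    hasDerivWithinAt_det (M' := Matrix.of fun i : Fin (d + 1) => iteratedDeriv (i : ℕ) (H 0) x)
      fun i j => hasDerivWithinAt_smul_sqrt (c := fun ε => iteratedDeriv (i : ℕ) (H ε) x j)
        (((hH.iteratedDeriv_snd isOpen_Ioo i).apply j).continuousAt_fst isOpen_Ioo h0 x) _
  have hM0 : Mx 0 = frame Γ x := by
    ext i j
    simp [Mx, frame]
  rw [hM0] at hMx
  have hone : ∀ η ∈ Ici (0 : ℝ), η < r ^ 2 → (Mx η).det = 1 := fun η hη hηr => by
    have hs : Real.sqrt η ∈ Ioo (-r) r :=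
      ⟨by linarith [Real.sqrt_nonneg η], (Real.sqrt_lt' hr).2 hηr⟩
    rw [← hW _ hs x, wronskian_eq]
    congr 1
    ext i j
    simp only [Mx, frame, Matrix.of_apply, hiter _ hs, Real.sq_sqrt hη, Pi.add_apply, Pi.smul_apply,
      smul_eq_mul]
  have hconst : HasDerivWithinAt (fun η => (Mx η).det) 0 (Ici 0) 0 := by
    refine (hasDerivWithinAt_const (0 : ℝ) (Ici 0) (1 : ℝ)).congr_of_eventuallyEq ?_
      (hone 0 self_mem_Ici (by positivity))
    filter_upwards [self_mem_nhdsWithin, mem_nhdsWithin_of_mem_nhds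
      (Iio_mem_nhds (show (0 : ℝ) < r ^ 2 by positivity))] with η h1 h2 using hone η h1 h2
  exact (uniqueDiffWithinAt_Ici 0).eq_deriv _ hMx hconst

theorem coef_add (x : ℝ) (v w : Fin (d + 1) → ℝ) (i : Fin (d + 1)) :
    coef Γ x (v + w) i = coef Γ x v i + coef Γ x w i := by
  obtain ⟨B, hB⟩ := coef_clm Γ x i
  rw [← hB, map_add, hB, hB]

theorem coef_smul (x c : ℝ) (v : Fin (d + 1) → ℝ) (i : Fin (d + 1)) :
    coef Γ x (c • v) i = c * coef Γ x v i := by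
  obtain ⟨B, hB⟩ := coef_clm Γ x i
  rw [← hB, map_smul, hB, smul_eq_mul]

theorem coef_finsetSum {ι : Type*} (s : Finset ι) (x : ℝ) (v : ι → Fin (d + 1) → ℝ)
    (i : Fin (d + 1)) : coef Γ x (∑ k ∈ s, v k) i = ∑ k ∈ s, coef Γ x (v k) i := by
  obtain ⟨B, hB⟩ := coef_clm Γ x i
  simp only [← hB, map_sum]

theorem coef_iteratedDeriv_nat {x : ℝ} (hW : wronskian Γ x ≠ 0) {k : ℕ} (hk : k < d + 1)
    (i : Fin (d + 1)) : coef Γ x (iteratedDeriv k Γ x) i = if (i : ℕ) = k then 1 else 0 := by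
  have := coef_iteratedDeriv hW i ⟨k, hk⟩
  simpa [Fin.ext_iff] using this

theorem coef_smul_iteratedDeriv {x : ℝ} (hW : wronskian Γ x ≠ 0) (hΓ : ContDiff ℝ ∞ Γ) {m : ℝ → ℝ}
    (hm : ContDiff ℝ ∞ m) (i : Fin (d + 1)) :
    coef Γ x (iteratedDeriv (i : ℕ) (fun y => m y • Γ y) x) i = m x := by
  rw [iteratedDeriv_fun_smul hm hΓ, coef_finsetSum, Finset.sum_eq_single 0]
  · rw [coef_smul, Nat.sub_zero, coef_iteratedDeriv hW]
    simp
  · intro k hk hk0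
    rw [Finset.mem_range] at hk
    rw [coef_smul, coef_iteratedDeriv_nat hW (by omega), if_neg (by omega), mul_zero]
  · simp

/-- The trace of the operator `∂²` in the frame of a normalized curve. -/
theorem sum_coef_iteratedDeriv_add_two (hd : 1 ≤ d) (hΓ : ContDiff ℝ ∞ Γ)
    (hW : ∀ x, wronskian Γ x = 1) (x : ℝ) :
    ∑ i : Fin (d + 1), coef Γ x (iteratedDeriv ((i : ℕ) + 2) Γ x) i =
      -2 * curveCoeff Γ (d - 1) x := by
  have hW0 : ∀ x, wronskian Γ x ≠ 0 := fun x => by simp [hW]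
  obtain ⟨n, rfl⟩ : ∃ n, d = n + 1 := ⟨d - 1, by omega⟩
  have hu : ∀ i, ContDiff ℝ ∞ (curveCoeff Γ i) := fun i =>
    ((SmoothFamily.const (I := univ) hΓ).curveCoeff isOpen_univ (fun _ _ => hW0) i).contDiff
      (mem_univ 0)
  have h1 : ∀ x, coef Γ x (iteratedDeriv (n + 2) Γ x) ⟨n, by omega⟩ = -curveCoeff Γ n x := fun x => by
    rw [curveCoeff, dif_pos (by omega), neg_neg]
  have hd1 : iteratedDeriv (n + 2) Γ = fun x =>
      -∑ i ∈ Finset.range (n + 1), curveCoeff Γ i x • iteratedDeriv i Γ x := funext fun x =>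
    eq_neg_of_add_eq_zero_left (curveCoeff_equation hΓ hW x)
  have hd2 : iteratedDeriv (n + 3) Γ x = -∑ i ∈ Finset.range (n + 1),
      (curveCoeff Γ i x • iteratedDeriv (i + 1) Γ x +
        deriv (curveCoeff Γ i) x • iteratedDeriv i Γ x) := by
    have h := (HasDerivAt.fun_sum (u := Finset.range (n + 1)) fun i _ =>
      (((hu i).differentiable (by simp) x).hasDerivAt).smul (hasDerivAt_iteratedDeriv hΓ i x)).neg
    have h' := hasDerivAt_iteratedDeriv hΓ (n + 2) x
    rw [hd1] at h'
    exact h'.unique h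
  have h2 : coef Γ x (iteratedDeriv (n + 3) Γ x) (Fin.last (n + 1)) = -curveCoeff Γ n x := by
    have hneg : ∀ v, coef Γ x (-v) (Fin.last (n + 1)) = -coef Γ x v (Fin.last (n + 1)) := fun v => by
      rw [← neg_one_smul ℝ v, coef_smul, neg_one_mul]
    rw [hd2, hneg, coef_finsetSum, Finset.sum_eq_single n]
    · rw [coef_add, coef_smul, coef_smul, coef_iteratedDeriv_nat (hW0 x) (by omega),
        coef_iteratedDeriv_nat (hW0 x) (by omega)]
      simp
    · intro i hi hin
      rw [Finset.mem_range] at hi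
      rw [coef_add, coef_smul, coef_smul, coef_iteratedDeriv_nat (hW0 x) (by omega),
        coef_iteratedDeriv_nat (hW0 x) (by omega), Fin.val_last, if_neg (by omega),
        if_neg (by omega)]
      ring
    · simp
  -- For i ≤ d - 2, Γ^(i+2) is a different frame vector from Γ^(i). Only i = d - 1 and i = d
  -- contribute, each -u_(d-1).
  rw [Fin.sum_univ_castSucc, Fin.sum_univ_castSucc, Finset.sum_eq_zero]
  · have e1 : (Fin.last n).castSucc = (⟨n, by omega⟩ : Fin (n + 1 + 1)) := rfl
    rw [e1, Fin.val_last]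
    have := h1 x
    have h2' := h2
    simp only [Nat.add_sub_cancel]
    linarith
  · intro i _
    rw [coef_iteratedDeriv_nat (hW0 x) (by simp)]
    simp

/-- Normalization of an even family of curves `Γ + ε² C Γ'' + O(ε⁴)`. -/
theorem exists_normalization (hd : 1 ≤ d) (hΓ : ContDiff ℝ ∞ Γ) (hW : ∀ x, wronskian Γ x = 1)
    {A : (Fin (d + 1) → ℝ) →ₗ[ℝ] (Fin (d + 1) → ℝ)}
    (hA : ∀ x, Γ (x + 2 * Real.pi) = A (Γ x)) {r : ℝ} (hr : 0 < r)
    {P H : ℝ → ℝ → Fin (d + 1) → ℝ} (hP : SmoothFamily (Ioo (-r) r) P)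
    (hH : SmoothFamily (Ioo (-r) r) H)
    (hPeven : ∀ ε ∈ Ioo (-r) r, ∀ x, P (-ε) x = P ε x)
    (hPH : ∀ ε ∈ Ioo (-r) r, ∀ x, P ε x = Γ x + ε ^ 2 • H ε x)
    (hPA : ∀ ε ∈ Ioo (-r) r, ∀ x, P ε (x + 2 * Real.pi) = A (P ε x)) {C : ℝ}
    (hH0 : ∀ x, H 0 x = C • iteratedDeriv 2 Γ x) :
    ∃ r', 0 < r' ∧ r' ≤ r ∧ ∃ σ : ℝ → ℝ → ℝ, ∃ K : ℝ → ℝ → Fin (d + 1) → ℝ,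
      (∀ ε ∈ Ioo (-r') r', ∀ x, σ ε x ≠ 0) ∧
      SmoothFamily (Ioo (-r') r') (fun ε x => σ ε x • P ε x) ∧
      (∀ ε ∈ Ioo (-r') r', ∀ x, σ (-ε) x • P (-ε) x = σ ε x • P ε x) ∧
      (∀ ε ∈ Ioo (-r') r', ∀ x, wronskian (fun x => σ ε x • P ε x) x = 1) ∧
      (∀ ε ∈ Ioo (-r') r', ∀ x, σ ε (x + 2 * Real.pi) • P ε (x + 2 * Real.pi) =
        A (σ ε x • P ε x)) ∧
      SmoothFamily (Ioo (-r') r') K ∧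
      (∀ ε ∈ Ioo (-r') r', ∀ x, K (-ε) x = K ε x) ∧
      (∀ ε ∈ Ioo (-r') r', ∀ x, σ ε x • P ε x = Γ x + ε ^ 2 • K ε x) ∧
      ∀ x, K 0 x = C • (iteratedDeriv 2 Γ x +
        (2 / ((d : ℝ) + 1) * curveCoeff Γ (d - 1) x) • Γ x) := by
  have hW0 : ∀ x, wronskian Γ x ≠ 0 := fun x => by simp [hW]
  have h0 : (0 : ℝ) ∈ Ioo (-r) r := by simp [hr]
  have hP0 : P 0 = Γ := funext fun x => by rw [hPH 0 h0 x]; simp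
  -- With det A = 1 the Wronskian of P is periodic, so it stays positive for small ε uniformly in x.
  have hdetA : LinearMap.det A = 1 := by
    have := wronskian_map A fun i => iteratedDeriv_add_period hΓ hA i 0
    rwa [hW, hW, mul_one, eq_comm] at this
  have hWper : ∀ ε ∈ Ioo (-r) r, Function.Periodic (wronskian (P ε)) (2 * Real.pi) :=
    fun ε hε x => by
      rw [wronskian_map A fun i => iteratedDeriv_add_period (hP.contDiff hε) (hPA ε hε) i x, hdetA,
        one_mul]
  obtain ⟨r', hr', hrr', hpos⟩ := (hP.wronskian isOpen_Ioo).exists_forall_mem hr Real.two_pi_pos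
    hWper (isOpen_Ioi (a := (0 : ℝ))) (fun x => by rw [hP0, hW]; exact mem_Ioi.2 one_pos)
  have hsub : Ioo (-r') r' ⊆ Ioo (-r) r := Ioo_subset_Ioo (by linarith) hrr'
  have h0' : (0 : ℝ) ∈ Ioo (-r') r' := by simp [hr']
  -- By `wronskian_smul` the factor σ multiplies the Wronskian by σ^(d+1), which dictates the
  -- exponent.
  set σ : ℝ → ℝ → ℝ := fun ε x => wronskian (P ε) x ^ (-1 / ((d : ℝ) + 1)) with hσ
  have hσpos : ∀ ε ∈ Ioo (-r') r', ∀ x, 0 < σ ε x := fun ε hε x =>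
    Real.rpow_pos_of_pos (hpos ε hε x) _
  have hσs : SmoothFamily (Ioo (-r') r') σ :=
    ((hP.wronskian isOpen_Ioo).mono hsub).rpow _ fun ε hε x => (hpos ε hε x).ne'
  have hσeven : ∀ ε ∈ Ioo (-r') r', ∀ x, σ (-ε) x = σ ε x := fun ε hε x => by
    simp only [hσ]
    rw [show P (-ε) = P ε from funext (hPeven ε (hsub hε))]
  have hσ0 : ∀ x, σ 0 x = 1 := fun x => by
    simp only [hσ]
    rw [hP0, hW, Real.one_rpow]
  have hσW : ∀ ε ∈ Ioo (-r') r', ∀ x, σ ε x ^ (d + 1) * wronskian (P ε) x = 1 := fun ε hε x => by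
    simp only [hσ]
    have hd1 : (d : ℝ) + 1 ≠ 0 := by positivity
    rw [← Real.rpow_natCast, ← Real.rpow_mul (le_of_lt (hpos ε hε x))]
    push_cast
    rw [div_mul_cancel₀ _ hd1, Real.rpow_neg_one]
    exact inv_mul_cancel₀ (ne_of_gt (hpos ε hε x))
  obtain ⟨m, hm, -, hσm⟩ := hσs.exists_eq_add_sq_smul hσeven
  have hT := hσs.smul (hP.mono hsub)
  have hTeven : ∀ ε ∈ Ioo (-r') r', ∀ x, σ (-ε) x • P (-ε) x = σ ε x • P ε x := fun ε hε x => by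
    rw [hσeven ε hε, hPeven ε (hsub hε)]
  obtain ⟨K, hK, hKeven, hTK⟩ := hT.exists_eq_add_sq_smul hTeven
  simp only [hσ0, one_smul, hP0] at hTK
  have hTW : ∀ ε ∈ Ioo (-r') r', ∀ x, wronskian (fun x => σ ε x • P ε x) x = 1 := fun ε hε x => by
    rw [wronskian_smul (hσs.contDiff hε) (hP.contDiff (hsub hε)), hσW ε hε]
  have hK0 : ∀ x, K 0 x = C • iteratedDeriv 2 Γ x + m 0 x • Γ x := fun x => by
    have key : ∀ ε ∈ Ioo (-r') r', ε ≠ 0 → K ε x = H ε x + m ε x • Γ x + (ε ^ 2 * m ε x) • H ε x :=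
      fun ε hε hne => by
        have h1 := hTK ε hε x
        rw [hσm ε hε x, hσ0, hPH ε (hsub hε) x] at h1
        have h2 : ε ^ 2 • K ε x = ε ^ 2 • (H ε x + m ε x • Γ x + (ε ^ 2 * m ε x) • H ε x) := by
          rw [← add_right_inj (Γ x), ← h1]
          simp only [smul_eq_mul]
          module
        exact smul_right_injective _ (pow_ne_zero 2 hne) h2
    have hG : SmoothFamily (Ioo (-r') r')
        fun ε x => H ε x + m ε x • Γ x + (ε ^ 2 * m ε x) • H ε x :=
      ((hH.mono hsub).add (hm.smul (.const hΓ))).add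
        ((SmoothFamily.mul (.pow 2) hm).smul (hH.mono hsub))
    rw [hK.eq_at_zero hG isOpen_Ioo h0' key, hH0]
    simp
  have hms : ContDiff ℝ ∞ (m 0) := hm.contDiff h0'
  -- The linearized determinant condition reads C·(-2u_(d-1)) + (d+1)·m = 0.
  have hm0 : ∀ x, m 0 x = C * (2 / ((d : ℝ) + 1) * curveCoeff Γ (d - 1) x) := fun x => by
    have h1 := sum_det_updateRow_eq_zero hr' hΓ hK hTK hTW x
    have h2 : ∀ i : Fin (d + 1), ((frame Γ x).updateRow i (iteratedDeriv (i : ℕ) (K 0) x)).det =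
        C * coef Γ x (iteratedDeriv ((i : ℕ) + 2) Γ x) i + m 0 x := fun i => by
      have ht : ((i : ℕ) : WithTop ℕ∞) ≤ ∞ := by exact_mod_cast le_top
      have h3 : iteratedDeriv (i : ℕ) (K 0) x = C • iteratedDeriv ((i : ℕ) + 2) Γ x +
          iteratedDeriv (i : ℕ) (fun y => m 0 y • Γ y) x := by
        rw [show K 0 = fun x => C • iteratedDeriv 2 Γ x + m 0 x • Γ x from funext hK0,
          iteratedDeriv_fun_add (f := fun x => C • iteratedDeriv 2 Γ x) (g := fun x => m 0 x • Γ x)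
            (((contDiff_iteratedDeriv hΓ 2).const_smul C).of_le ht).contDiffAt
            ((hms.smul hΓ).of_le ht).contDiffAt, iteratedDeriv_fun_const_smul_field]
        simp only [iteratedDeriv_eq_iterate, ← Function.iterate_add_apply]
      rw [h3, show ∀ v, ((frame Γ x).updateRow i v).det = coef Γ x v i from fun v => by
        rw [coef, hW, div_one], coef_add, coef_smul, coef_smul_iteratedDeriv (hW0 x) hΓ hms]
    simp only [h2, Finset.sum_add_distrib, ← Finset.mul_sum,
      sum_coef_iteratedDeriv_add_two hd hΓ hW, Finset.sum_const, Finset.card_univ,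
      Fintype.card_fin, nsmul_eq_mul] at h1
    push_cast at h1
    have hd1 : (d : ℝ) + 1 ≠ 0 := by positivity
    field_simp
    linarith
  refine ⟨r', hr', hrr', σ, K, fun ε hε x => (hσpos ε hε x).ne', hT, hTeven, hTW,
    fun ε hε x => ?_, hK, hKeven, hTK, fun x => ?_⟩
  · have : σ ε (x + 2 * Real.pi) = σ ε x := by
      simp only [hσ]
      rw [hWper ε (hsub hε)]
    rw [this, hPA ε (hsub hε), map_smul]
  · rw [hK0, hm0, smul_add, smul_smul]

/-- The second order coefficient of the differential operators along an even family of normalized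
curves `Γ + ε² C (∂² + v) Γ + O(ε⁴)`. -/
theorem operator_variation {r : ℝ} (hr : 0 < r) (hΓ : ContDiff ℝ ∞ Γ)
    (hW : ∀ x, wronskian Γ x = 1) {F K : ℝ → ℝ → Fin (d + 1) → ℝ}
    (hF : SmoothFamily (Ioo (-r) r) F) (hFW : ∀ ε ∈ Ioo (-r) r, ∀ x, wronskian (F ε) x = 1)
    (hK : SmoothFamily (Ioo (-r) r) K)
    (hFK : ∀ ε ∈ Ioo (-r) r, ∀ x, F ε x = Γ x + ε ^ 2 • K ε x) {C : ℝ} (hC : C ≠ 0)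
    {v : ℝ → ℝ} (hv : ContDiff ℝ ∞ v)
    (hK0 : ∀ x, K 0 x = C • (iteratedDeriv 2 Γ x + v x • Γ x)) {w : ℕ → ℝ → ℝ → ℝ}
    (hw : ∀ i, SmoothFamily (Ioo (-r) r) (w i))
    (hwF : ∀ i, ∀ ε ∈ Ioo (-r) r, ∀ x,
      curveCoeff (F ε) i x = curveCoeff Γ i x + ε ^ 2 * w i ε x) (k : ℤ) (x : ℝ) :
    C * psiComm (schrodingerOp v) (diffOp d (curveCoeff Γ)) k x =
      if 0 ≤ k ∧ k < d then w k.toNat 0 x else 0 := by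
  have h0 : (0 : ℝ) ∈ Ioo (-r) r := by simp [hr]
  have hu : ∀ i, ContDiff ℝ ∞ (curveCoeff Γ i) := fun i =>
    ((SmoothFamily.const (I := univ) hΓ).curveCoeff isOpen_univ (by simp [hW]) i).contDiff
      (mem_univ 0)
  have hq : ContDiff ℝ ∞ fun y => iteratedDeriv 2 Γ y + v y • Γ y :=
    (contDiff_iteratedDeriv hΓ 2).add (hv.smul hΓ)
  have hiter : ∀ ε ∈ Ioo (-r) r, ∀ i : ℕ, iteratedDeriv i (F ε) x =
      iteratedDeriv i Γ x + ε ^ 2 • iteratedDeriv i (K ε) x := fun ε hε i => by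
    have ht : (i : WithTop ℕ∞) ≤ ∞ := by exact_mod_cast le_top
    rw [show F ε = fun x => Γ x + ε ^ 2 • K ε x from funext (hFK ε hε),
      iteratedDeriv_fun_add (hΓ.of_le ht).contDiffAt
        (((hK.contDiff hε).const_smul _).of_le ht).contDiffAt, iteratedDeriv_fun_const_smul_field]
  have hKi := hK.iteratedDeriv_snd isOpen_Ioo
  -- This is (L_ε F_ε - LΓ)/ε² written without division. It vanishes for ε ≠ 0, hence at 0 by
  -- continuity, where it becomes the variation of LΓ = 0.
  let E : ℝ → ℝ → Fin (d + 1) → ℝ := fun ε x => iteratedDeriv (d + 1) (K ε) x +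
    ∑ i ∈ Finset.range d, (w i ε x • iteratedDeriv i Γ x + curveCoeff Γ i x • iteratedDeriv i (K ε) x
      + (ε ^ 2 * w i ε x) • iteratedDeriv i (K ε) x)
  have hEs : SmoothFamily (Ioo (-r) r) E :=
    (hKi (d + 1)).add (.sum fun i _ =>
      (((hw i).smul (.const (contDiff_iteratedDeriv hΓ i))).add
        ((SmoothFamily.const (hu i)).smul (hKi i))).add
          ((SmoothFamily.mul (.pow 2) (hw i)).smul (hKi i)))
  have hE : E 0 x = 0 := by
    refine hEs.eq_at_zero (G := fun _ _ => 0) (.const contDiff_const) isOpen_Ioo h0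
      fun ε hε hne => ?_
    have h1 := curveCoeff_equation (hF.contDiff hε) (hFW ε hε) x
    have h2 := curveCoeff_equation hΓ hW x
    refine (smul_eq_zero.1 (?_ : ε ^ 2 • E ε x = 0)).resolve_left (pow_ne_zero 2 hne)
    rw [← sub_eq_zero.2 (h1.trans h2.symm)]
    simp only [hiter ε hε, hwF _ ε hε, E, smul_add, Finset.smul_sum]
    rw [add_sub_add_comm, ← Finset.sum_sub_distrib]
    congr 1
    · abel
    · refine Finset.sum_congr rfl fun i _ => ?_
      module
  have hKd : ∀ i : ℕ, iteratedDeriv i (K 0) x =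
      C • iteratedDeriv i (fun y => iteratedDeriv 2 Γ y + v y • Γ y) x := fun i => by
    rw [show K 0 = fun x => C • (iteratedDeriv 2 Γ x + v x • Γ x) from funext hK0,
      iteratedDeriv_fun_const_smul_field]
  have hvar := psiComm_eq_of_variation (d := d) (u := curveCoeff Γ) (fun i _ => hu i) hv hΓ
    (curveCoeff_equation hΓ hW) (x := x) (by simp [hW]) (w := fun i => C⁻¹ * w i 0 x) (by
      have h3 : C⁻¹ • E 0 x = 0 := by rw [hE, smul_zero]
      rw [← h3]
      simp only [E, hKd, smul_add, Finset.smul_sum, smul_smul, inv_mul_cancel₀ hC, one_smul,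
        zero_pow two_ne_zero, zero_mul, zero_smul, add_zero, Finset.sum_add_distrib,
        Finset.sum_const_zero,
        mul_left_comm C⁻¹ _ C, mul_one]
      abel) k
  rw [hvar]
  split_ifs
  · rw [mul_inv_cancel_left₀ hC]
  · rw [mul_zero]

end Normalization

/-! ### Projective image curves and the expansion of their operators -/

section Assembly

variable {d : ℕ}

/-- The projective curve with lift `F`; where `F` vanishes, the value of `γ` is used. -/
def projCurve (γ : ℝ → RP d) (F : ℝ → Fin (d + 1) → ℝ) (x : ℝ) : RP d :=
  open Classical in if h : F x ≠ 0 then Projectivization.mk ℝ (F x) h else γ x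

theorem projCurve_eq (γ : ℝ → RP d) {F : ℝ → Fin (d + 1) → ℝ} {x : ℝ} (h : F x ≠ 0) :
    projCurve γ F x = Projectivization.mk ℝ (F x) h := dif_pos h

theorem isNormalizedLift_projCurve (γ : ℝ → RP d) {F : ℝ → Fin (d + 1) → ℝ}
    (hF : ContDiff ℝ ∞ F) (hW : ∀ x, wronskian F x = 1) : IsNormalizedLift (projCurve γ F) F where
  smooth := hF
  lift x := by
    have h : F x ≠ 0 := ne_zero_of_wronskian (by simp [hW])
    exact ⟨h, (projCurve_eq γ h).symm⟩
  normalized := hW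

theorem submodule_projCurve_smul (γ : ℝ → RP d) {F : ℝ → Fin (d + 1) → ℝ} {σ : ℝ → ℝ} {x : ℝ}
    (hσ : σ x ≠ 0) (h : σ x • F x ≠ 0) :
    (projCurve γ (fun y => σ y • F y) x).submodule = Submodule.span ℝ {F x} := by
  rw [projCurve_eq γ h, Projectivization.submodule_mk]
  exact Submodule.span_singleton_smul_eq (IsUnit.mk0 _ hσ) _

/-- The differential operators along an even family of normalized curves
`Γ + ε² C (∂² + v) Γ + O(ε⁴)`. -/
theorem isBigOSmooth_diffOp {Γ : ℝ → Fin (d + 1) → ℝ} {r : ℝ} (hr : 0 < r) (hΓ : ContDiff ℝ ∞ Γ)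
    (hW : ∀ x, wronskian Γ x = 1) {F K : ℝ → ℝ → Fin (d + 1) → ℝ}
    (hF : SmoothFamily (Ioo (-r) r) F) (hFW : ∀ ε ∈ Ioo (-r) r, ∀ x, wronskian (F ε) x = 1)
    (hFeven : ∀ ε ∈ Ioo (-r) r, ∀ x, F (-ε) x = F ε x) (hK : SmoothFamily (Ioo (-r) r) K)
    (hFK : ∀ ε ∈ Ioo (-r) r, ∀ x, F ε x = Γ x + ε ^ 2 • K ε x) {C : ℝ} (hC : C ≠ 0)
    {v : ℝ → ℝ} (hv : ContDiff ℝ ∞ v)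
    (hK0 : ∀ x, K 0 x = C • (iteratedDeriv 2 Γ x + v x • Γ x)) (k : ℤ) :
    IsBigOSmooth 4 fun ε x => diffOp d (curveCoeff (F ε)) k x - (diffOp d (curveCoeff Γ) k x +
      ε ^ 2 * C * psiComm (schrodingerOp v) (diffOp d (curveCoeff Γ)) k x) := by
  have h0 : (0 : ℝ) ∈ Ioo (-r) r := by simp [hr]
  have hF0 : F 0 = Γ := funext fun x => by rw [hFK 0 h0 x]; simp
  have hFc : ∀ i, SmoothFamily (Ioo (-r) r) fun ε x => curveCoeff (F ε) i x := fun i =>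
    hF.curveCoeff isOpen_Ioo (fun ε hε x => by simp [hFW ε hε]) i
  have hFce : ∀ i, ∀ ε ∈ Ioo (-r) r, ∀ x, curveCoeff (F (-ε)) i x = curveCoeff (F ε) i x :=
    fun i ε hε x => by rw [show F (-ε) = F ε from funext (hFeven ε hε)]
  choose w hw hweven hwF using fun i => (hFc i).exists_eq_add_sq_smul (hFce i)
  have hcomm := operator_variation hr hΓ hW hF hFW hK hFK hC hv hK0 hw
    (fun i ε hε x => by rw [hwF i ε hε x, hF0, smul_eq_mul]) k
  simp only [mul_assoc, hcomm]
  by_cases hk : 0 ≤ k ∧ k < d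
  · obtain ⟨i, rfl⟩ := Int.eq_ofNat_of_zero_le hk.1
    have hi : i < d := by omega
    have := SmoothFamily.isBigOSmooth_four hr (hw i) (hweven i) (hwF i)
    simpa only [hF0, diffOp_coe hi, if_pos hk, Int.toNat_natCast, smul_eq_mul] using this
  · refine isBigOSmooth_of_eq hr (K := fun _ _ => 0) (.const contDiff_const) fun ε _ x => ?_
    simp only [if_neg hk, diffOp, mul_zero, add_zero, smul_zero]
    split_ifs <;> simp

end Assembly

end PentagramLimit

end

theorem theorem3p4 (d : ℕ) (hd : 2 ≤ d) :
    -- the expansion of the normalized lift, with a constant depending only on `d`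
    (∃ C : ℝ, C ≠ 0 ∧
      ∀ (γ : ℝ → PentagramLimit.RP d) (Γ : ℝ → Fin (d + 1) → ℝ)
        (M : (Fin (d + 1) → ℝ) ≃ₗ[ℝ] (Fin (d + 1) → ℝ)),
        PentagramLimit.HasMonodromy γ M →
        PentagramLimit.IsNormalizedLift γ Γ →
        ∃ u : ℕ → ℝ → ℝ, PentagramLimit.IsCurveOperator Γ u ∧
          -- the root of `L` exists and is unique, and `Q_2 = ∂^2 + (2/(d+1)) u_(d-1)`
          (∃! R : ℤ → ℝ → ℝ,
            PentagramLimit.IsRoot (d + 1) (PentagramLimit.diffOp d u) R) ∧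
          (∀ (k : ℤ) (x : ℝ), PentagramLimit.kdvQ 2 d u k x =
            if k = 2 then 1 else if k = 0 then 2 / ((d : ℝ) + 1) * u (d - 1) x else 0) ∧
          ∃ (ε₀ : ℝ) (γt : ℝ → ℝ → PentagramLimit.RP d)
            (Γt : ℝ → ℝ → Fin (d + 1) → ℝ) (ut : ℝ → ℕ → ℝ → ℝ),
            0 < ε₀ ∧
            (∀ ε : ℝ, 0 < |ε| → |ε| < ε₀ →
              PentagramLimit.IsPentagramCurve γ ε (γt ε) ∧
              PentagramLimit.IsNormalizedLift (γt ε) (Γt ε) ∧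
              PentagramLimit.IsCurveOperator (Γt ε) (ut ε)) ∧
            PentagramLimit.IsBigOSmooth 4 (fun ε x =>
              Γt ε x - (Γ x + (ε ^ 2 * C) •
                (iteratedDeriv 2 Γ x + (2 / ((d : ℝ) + 1) * u (d - 1) x) • Γ x))) ∧
            -- the induced evolution of the operator `L` is the `(2, d+1)`-KdV flow
            (∀ k : ℤ, PentagramLimit.IsBigOSmooth 4 (fun ε x =>
              PentagramLimit.diffOp d (ut ε) k x - (PentagramLimit.diffOp d u k x
                + ε ^ 2 * C * PentagramLimit.psiComm (PentagramLimit.kdvQ 2 d u)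
                    (PentagramLimit.diffOp d u) k x)))) ∧
    -- the limiting evolution `dΓ/dt = Q_2 Γ` implies the `(2, d+1)`-KdV equation
    (∀ (a b : ℝ) (G : ℝ → ℝ → Fin (d + 1) → ℝ) (w : ℝ → ℕ → ℝ → ℝ),
      ContDiffOn ℝ ∞ (fun p : ℝ × ℝ => G p.1 p.2) (Set.Ioo a b ×ˢ Set.univ) →
      (∀ t ∈ Set.Ioo a b, (∀ x, PentagramLimit.wronskian (G t) x ≠ 0) ∧
        PentagramLimit.IsCurveOperator (G t) (w t) ∧
        ∀ x, HasDerivAt (fun s => G s x)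
          (PentagramLimit.applyOp (PentagramLimit.kdvQ 2 d (w t)) (G t) x) t) →
      PentagramLimit.SolvesKdV 2 d (Set.Ioo a b) w) := by
  refine ⟨⟨PentagramLimit.limitConst d, (PentagramLimit.limitConst_pos hd).ne',
    fun γ Γ M hM hΓ => ?_⟩, fun a b G w hG h => PentagramLimit.solvesKdV_of_evolution hd hG h⟩
  obtain ⟨A, hA⟩ := PentagramLimit.exists_linear_monodromy hM hΓ
  have hop := PentagramLimit.isCurveOperator_curveCoeff hΓ.smooth hΓ.normalized A
    (PentagramLimit.iteratedDeriv_add_period hΓ.smooth hA)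
  refine ⟨PentagramLimit.curveCoeff Γ, hop,
    PentagramLimit.existsUnique_isRoot_diffOp hop.smooth hop.periodic,
    PentagramLimit.kdvQ_two hd hop.smooth hop.periodic, ?_⟩
  obtain ⟨g, hg⟩ := PentagramLimit.exists_isFrameExpansion hΓ.smooth hΓ.normalized hA
  obtain ⟨r, hr, hgen⟩ := hg.exists_isGeneric
  obtain ⟨H, hH, hPH, hH0⟩ :=
    PentagramLimit.exists_imageCurve_expansion hd hg hΓ.smooth hr hgen
  obtain ⟨r', hr', hrr', σ, K, hσ, hT, hTeven, hTW, hTA, hK, hKeven, hTK, hK0⟩ :=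
    PentagramLimit.exists_normalization (by omega) hΓ.smooth hΓ.normalized hA hr
      (PentagramLimit.smooth_imageCurve hg hΓ.smooth hgen) hH
      (fun ε hε x => PentagramLimit.imageCurve_neg (hgen ε hε x)
        (hgen (-ε) ⟨by linarith [hε.2], by linarith [hε.1]⟩ x))
      hPH (fun ε _ x => PentagramLimit.imageCurve_periodic hg hΓ.smooth hA ε x) hH0
  set F : ℝ → ℝ → Fin (d + 1) → ℝ := fun ε x => σ ε x • PentagramLimit.imageCurve Γ g ε x with hF
  have hF0 : F 0 = Γ := funext fun x => by
    have := hTK 0 (by simp [hr']) x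
    simpa [hF] using this
  refine ⟨r', fun ε => PentagramLimit.projCurve γ (F ε), F,
    fun ε => PentagramLimit.curveCoeff (F ε), hr', fun ε hε hεr => ?_, ?_, fun k => ?_⟩
  · have hI := abs_lt.1 hεr
    refine ⟨fun x => ?_, PentagramLimit.isNormalizedLift_projCurve γ (hT.contDiff hI) (hTW ε hI),
      PentagramLimit.isCurveOperator_curveCoeff (hT.contDiff hI) (hTW ε hI) A
        (PentagramLimit.iteratedDeriv_add_period (hT.contDiff hI) (hTA ε hI))⟩
    exact PentagramLimit.isShortDiagonalImage_imageCurve hg hΓ (abs_pos.1 hε)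
      (hgen ε ⟨by linarith [hI.1], by linarith [hI.2]⟩ x)
      (PentagramLimit.submodule_projCurve_smul γ (hσ ε hI x)
        (PentagramLimit.ne_zero_of_wronskian ((hTW ε hI x).trans_ne one_ne_zero)))
  · have := PentagramLimit.SmoothFamily.isBigOSmooth_four (F := F) hr' hK hKeven
      (fun ε hε x => (hTK ε hε x).trans (by rw [hF0]))
    simpa only [hF0, hK0, smul_smul] using this
  · rw [PentagramLimit.kdvQ_eq_schrodingerOp hd hop.smooth hop.periodic]
    exact PentagramLimit.isBigOSmooth_diffOp hr' hΓ.smooth hΓ.normalized hT hTW hTeven hK hTK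
      (PentagramLimit.limitConst_pos hd).ne'
      (contDiff_const.mul (hop.smooth (d - 1) (by omega))) hK0 k
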